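/- **Setting.** Let $M$ be a smooth manifold of dimension $4n+3$; $(a,b,c)$ always denotes a cyclic permutation of $(1,2,3)$. *Hyper CR structures.* An almost CR structure on an open set $U\subset M$ is a corank one subbundle of $TU$ with a complex structure on it. An almost hyper CR structure on $U$ is a pair of almost CR structures $(Q_1,I_1)$, $(Q_2,I_2)$ such that $Q_1,Q_2$ are transversal and $I_1I_2=-I_2I_1$ on $I_1(Q_1\cap Q_2)\cap I_2(Q_1\cap Q_2)$; it determines $Q_3=I_1(Q_1\cap Q_2)+I_2(Q_1\cap Q_2)$ and $I_3\colon Q_3\to Q_3$, equal to $-I_2I_1$ on $I_1(Q_1\cap Q_2)$ and to $I_1I_2$ on $I_2(Q_1\cap Q_2)$. Put $Q=Q_1\cap Q_2\cap Q_3$. It is a hyper CR structure if for all $a$ and all local sections $X,Y$ of $Q$ one has $[X,Y]-[I_aX,I_aY]\in Q_a$ and $I_a([X,Y]-[I_aX,I_aY])-[X,I_aY]-[I_aX,Y]\in Q$. An admissible triple is a triple of vector fields $T_1,T_2,T_3$, nowhere in $Q$, with $T_a\in Q_b\cap Q_c$ and $I_aT_b=T_c$; its span $Q^\perp$ is called an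 admissible three-plane field, and $TU=Q\oplus Q^\perp$. For a unit vector $\mathbf v\in\mathbb R^3$ let $Q_{\mathbf v}=Q\oplus\{\sum_a x_aT_a:\sum_a x_av_a=0\}$ and $I_{\mathbf v}=(\sum_a v_a\widetilde I_a)|_{Q_{\mathbf v}}$, where $\widetilde I_a$ extends $I_a$ by $\widetilde I_aT_a=0$ (this does not depend on the admissible triple). A compatible one-form is an $\mathbb R^3$-valued one-form $\theta=(\theta_1,\theta_2,\theta_3)$ with $\ker\theta_a=Q_a$ and $\theta_c\circ I_a=\theta_b$ on $Q_a$. On $Q$ put $$\mathrm{Levi}_\theta(X,Y)=\tfrac12\bigl(d\theta_1(X,I_1Y)+d\theta_1(I_2X,I_3Y)\bigr),\qquad h(X,Y)=(2n+4)\,\mathrm{Levi}_\theta(X,Y)-\sum_{a=1}^3d\theta_a(X,I_aY).$$ *Quaternionic pseudohermitian structures.* A quaternionic CR structure on $M$ is a covering of $M$ by open sets $U$ with hyper CR structures $\{(Q_a,I_a)\}$ such that on each overlap $U\cap U'$ there is a function $S=(s_{ab})$ with values in $SO(3)$ and $Q'_{\mathbf v}=Q_{S\mathbf v}$, $I'_{\mathbf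 v}=I_{S\mathbf v}$ for all unit vectors $\mathbf v$. A quaternionic pseudohermitian structure is in addition a collection $\Theta=\{\theta_U\}$ of compatible one-forms with $(\theta_{U'})_a=\sum_b s_{ba}(\theta_U)_b$ on overlaps, for which the Levi form is positive definite on $Q$. It is ultra-pseudoconvex if $h$ is positive definite or negative definite on $Q$. *Canonical objects on $(U,\theta)$.* Let $g=\mathrm{Levi}_\theta$ and $g^\perp=\theta_1^2+\theta_2^2+\theta_3^2$. Given an admissible three-plane field $Q^\perp$ on $U$, extend $g$ to $TU$ by $g(Q^\perp,\cdot)=0$, and let $\nabla$ be the affine connection on $U$, with torsion $\mathrm{Tor}$, for which: (i) $Q$ and $Q^\perp$ are preserved; (ii) $g$ and $g^\perp$ are parallel; (iii) $\mathrm{Tor}(X,Y)_Q=0$ for $X,Y\in Q$, $\mathrm{Tor}(A,B)_{Q^\perp}=0$ for $A,B\in Q^\perp$, the map $X\in Q\mapsto\mathrm{Tor}(A,X)_Q$ is $g$-symmetric for $A\in Q^\perp$, and the map $A\in Q^\perp\mapsto\mathrm{Tor}(A,X)_{Q^\perp}$ is $g^\perp$-symmetric for $X\in Q$. For a local orthonormal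 frame of $Q$ of the form $(\varepsilon_k,I_1\varepsilon_k,I_2\varepsilon_k,I_3\varepsilon_k)_{1\le k\le n}$ let $\omega$ be the $so(4n)$-valued matrix of connection forms of $\nabla$ on $Q$, restricted to $Q$, and let $\omega^{\rm obs}\in Q^*\otimes(sp(n)+sp(1))^\perp$ be its component in the orthogonal complement of $sp(n)+sp(1)$ in $so(4n)$. Let $\omega^{E\otimes H}$ be the component of $\omega^{\rm obs}$ in the $Sp(n)\cdot Sp(1)$-submodule $E\otimes H\cong\mathbb H^n\otimes\mathbb C$ of $(\mathbb H^n)^*\otimes(sp(n)+sp(1))^\perp\otimes\mathbb C$ ($E$, $H$ being the standard complex modules of $Sp(n)$ and $Sp(1)$); this submodule is the complexification of the image of $v\mapsto\sum_p e_p\otimes(e_p\wedge v)^\perp$, where $(e_p)$ is the standard basis of $\mathbb H^n=\mathbb R^{4n}$ and $(\cdot)^\perp$ is the $(sp(n)+sp(1))^\perp$-component. If $\omega^{E\otimes H}=0$, then $Q^\perp$ is called a canonical three-plane field and $\nabla$ a canonical connection of $(U,\theta)$. **Theorem.** Let $(M,\Theta=\{\theta_U\})$ be an ultra-pseudoconvex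 quaternionic pseudohermitian manifold of dimension $4n+3>7$. Then every $(U,\theta_U)$ has exactly one canonical three-plane field $(Q^\perp)_U$ and exactly one canonical connection $D_U$, and these patch together: there are a global three-plane field $Q^\perp$ on $M$, admissible for every local hyper CR structure, and a global smooth affine connection $D$ on $M$ such that $Q^\perp|_U=(Q^\perp)_U$ and $D|_U=D_U$ for every $U$. -/

import Mathlib

open scoped Manifold ContDiff Topology

noncomputable section

namespace QCR

/-! ### Vector fields, one-forms and subbundles on open subsets of a `(4n+3)`-manifold -/

/-- The model space `ℝ^(4n+3)`. -/
abbrev Model (n : ℕ) : Type := EuclideanSpace ℝ (Fin (4 * n + 3))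

/-- The tangent space at a point of a manifold modelled on `ℝ^(4n+3)`. -/
abbrev Tan (n : ℕ) {M : Type*} [TopologicalSpace M] [ChartedSpace (Model n) M] (x : M) : Type :=
  TangentSpace 𝓘(ℝ, Model n) x

section

variable {n : ℕ} {M : Type*} [TopologicalSpace M] [ChartedSpace (Model n) M]
  [IsManifold 𝓘(ℝ, Model n) ∞ M]

/-- The vector field `X` is smooth on `V`. -/
def SmoothOn (X : Π x : M, Tan n x) (V : Set M) : Prop :=
  ContMDiffOn 𝓘(ℝ, Model n) (𝓘(ℝ, Model n)).tangent ∞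
    (fun x ↦ (⟨x, X x⟩ : TangentBundle 𝓘(ℝ, Model n) M)) V

/-- `X` is a smooth section over `V` of the field of subspaces `P`. -/
def IsSection (P : Π x : M, Submodule ℝ (Tan n x)) (X : Π x : M, Tan n x) (V : Set M) : Prop :=
  SmoothOn X V ∧ ∀ x ∈ V, X x ∈ P x

/-- `P` restricts to a smooth subbundle of rank `r` of the tangent bundle over the set `U`:
it is locally spanned by `r` pointwise linearly independent smooth vector fields. -/
def IsSubbundle (U : Set M) (r : ℕ) (P : Π x : M, Submodule ℝ (Tan n x)) : Prop :=
  ∀ x ∈ U, ∃ V : Set M, IsOpen V ∧ x ∈ V ∧ V ⊆ U ∧ ∃ X : Fin r → Π y : M, Tan n y,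
    (∀ i, SmoothOn (X i) V) ∧
      ∀ y ∈ V, LinearIndependent ℝ (fun i ↦ X i y) ∧
        Submodule.span ℝ (Set.range fun i ↦ X i y) = P y

/-- The one-form `θ` is smooth on `U`. -/
def SmoothFormOn (θ : Π x : M, Tan n x →L[ℝ] ℝ) (U : Set M) : Prop :=
  ∀ V : Set M, IsOpen V → V ⊆ U → ∀ X : Π x : M, Tan n x, SmoothOn X V →
    ContMDiffOn 𝓘(ℝ, Model n) 𝓘(ℝ, ℝ) ∞ (fun x ↦ θ x (X x)) V

/-- The Lie bracket of vector fields. -/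
abbrev bracket (X Y : Π x : M, Tan n x) : Π x : M, Tan n x :=
  VectorField.mlieBracket 𝓘(ℝ, Model n) X Y

/-- `X θ(Y) - Y θ(X) - θ([X, Y])`, the value of `dθ` on the vector fields `X`, `Y`. -/
def dFormField (θ : Π x : M, Tan n x →L[ℝ] ℝ) (X Y : Π x : M, Tan n x) (x : M) : ℝ :=
  mvfderiv 𝓘(ℝ, Model n) (fun y ↦ θ y (Y y)) x (X x)
    - mvfderiv 𝓘(ℝ, Model n) (fun y ↦ θ y (X y)) x (Y x) - θ x (bracket X Y x)

/-- The exterior derivative `dθ` at a point, evaluated on two tangent vectors; the vectors are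
extended to vector fields that are smooth near the point. -/
def dForm (θ : Π x : M, Tan n x →L[ℝ] ℝ) (x : M) (v w : Tan n x) : ℝ :=
  dFormField θ (FiberBundle.extend (Model n) v) (FiberBundle.extend (Model n) w) x

/-! ### Hyper CR structures -/

/-- `(Q, J)` is an almost CR structure on `U`: a corank one subbundle with a complex structure.
Only the restriction of `J x` to `Q x` is meaningful. -/
structure IsAlmostCR (U : Set M) (Q : Π x : M, Submodule ℝ (Tan n x))
    (J : Π x : M, Tan n x →ₗ[ℝ] Tan n x) : Prop where
  subbundle : IsSubbundle U (4 * n + 2) Q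
  maps : ∀ x ∈ U, ∀ v ∈ Q x, J x v ∈ Q x
  sq : ∀ x ∈ U, ∀ v ∈ Q x, J x (J x v) = -v
  smooth : ∀ V : Set M, IsOpen V → V ⊆ U → ∀ X : Π x : M, Tan n x, IsSection Q X V →
    SmoothOn (fun x ↦ J x (X x)) V

variable (n M) in
/-- The fields `(Q_a, I_a)`, `a = 1, 2, 3`, underlying a local hyper CR structure; the indices are
`0, 1, 2 : Fin 3`, and `(a, a + 1, a + 2)` is a cyclic permutation of them. -/
structure Triple where
  /-- The hyperplane fields. -/
  Q : Fin 3 → Π x : M, Submodule ℝ (Tan n x)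
  /-- The complex structures; only the restriction of `J a x` to `Q a x` is meaningful. -/
  J : Fin 3 → Π x : M, Tan n x →ₗ[ℝ] Tan n x

/-- The corank three bundle `Q = Q₁ ∩ Q₂ ∩ Q₃`. -/
def Triple.core (H : Triple n M) (x : M) : Submodule ℝ (Tan n x) := ⨅ a, H.Q a x

/-- The vector field `I_a X`. -/
def Triple.act (H : Triple n M) (a : Fin 3) (X : Π x : M, Tan n x) : Π x : M, Tan n x :=
  fun x ↦ H.J a x (X x)

/-- Almost hyper CR structure on `U`: a pair of almost CR structures `(Q₁, I)`, `(Q₂, J)` that are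
transversal and anti-commute on `I(Q₁ ∩ Q₂) ∩ J(Q₁ ∩ Q₂)`; the third pair `(Q₃, K)` is the one
determined by the first two. -/
structure IsAlmostHyperCR (U : Set M) (H : Triple n M) : Prop where
  first : IsAlmostCR U (H.Q 0) (H.J 0)
  second : IsAlmostCR U (H.Q 1) (H.J 1)
  transversal : ∀ x ∈ U, H.Q 0 x ⊔ H.Q 1 x = ⊤
  anticomm : ∀ x ∈ U, ∀ v ∈ (H.Q 0 x ⊓ H.Q 1 x).map (H.J 0 x) ⊓ (H.Q 0 x ⊓ H.Q 1 x).map (H.J 1 x),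
    H.J 0 x (H.J 1 x v) = -H.J 1 x (H.J 0 x v)
  third_Q : ∀ x ∈ U,
    H.Q 2 x = (H.Q 0 x ⊓ H.Q 1 x).map (H.J 0 x) ⊔ (H.Q 0 x ⊓ H.Q 1 x).map (H.J 1 x)
  third_J_left : ∀ x ∈ U, ∀ v ∈ (H.Q 0 x ⊓ H.Q 1 x).map (H.J 0 x),
    H.J 2 x v = -H.J 1 x (H.J 0 x v)
  third_J_right : ∀ x ∈ U, ∀ v ∈ (H.Q 0 x ⊓ H.Q 1 x).map (H.J 1 x),
    H.J 2 x v = H.J 0 x (H.J 1 x v)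

/-- Hyper CR structure on `U`: an integrable almost hyper CR structure. -/
structure IsHyperCR (U : Set M) (H : Triple n M) : Prop extends IsAlmostHyperCR U H where
  integrable₁ : ∀ V : Set M, IsOpen V → V ⊆ U → ∀ X Y : Π x : M, Tan n x,
    IsSection H.core X V → IsSection H.core Y V → ∀ a, ∀ x ∈ V,
      bracket X Y x - bracket (H.act a X) (H.act a Y) x ∈ H.Q a x
  integrable₂ : ∀ V : Set M, IsOpen V → V ⊆ U → ∀ X Y : Π x : M, Tan n x,
    IsSection H.core X V → IsSection H.core Y V → ∀ a, ∀ x ∈ V,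
      H.J a x (bracket X Y x - bracket (H.act a X) (H.act a Y) x)
        - bracket X (H.act a Y) x - bracket (H.act a X) Y x ∈ H.core x

/-- `t = (t₁, t₂, t₃)` is an admissible triple of tangent vectors at `x`: it is transverse to `Q`,
`t_a ∈ Q_b ∩ Q_c` and `I_a t_b = t_c`. -/
def Triple.IsAdmissibleAt (H : Triple n M) (x : M) (t : Fin 3 → Tan n x) : Prop :=
  ∀ a : Fin 3, t a ∉ H.core x ∧ t a ∈ H.Q (a + 1) x ∧ t a ∈ H.Q (a + 2) x ∧
    H.J a x (t (a + 1)) = t (a + 2)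

/-- `(T₁, T₂, T₃)` is an admissible triple of vector fields on `U`. -/
def IsAdmissibleTriple (U : Set M) (H : Triple n M) (T : Fin 3 → Π x : M, Tan n x) : Prop :=
  (∀ a, SmoothOn (T a) U) ∧ ∀ x ∈ U, H.IsAdmissibleAt x (fun a ↦ T a x)

/-- `P` is an admissible three-plane field on `U`: it is spanned by an admissible triple. -/
def IsAdmissiblePlaneField (U : Set M) (H : Triple n M) (P : Π x : M, Submodule ℝ (Tan n x)) :
    Prop :=
  ∃ T : Fin 3 → Π x : M, Tan n x, IsAdmissibleTriple U H T ∧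
    ∀ x ∈ U, P x = Submodule.span ℝ (Set.range fun a ↦ T a x)

/-- `Jt a` extends `I_a` to the whole tangent space at `x` by sending `t a` to zero. -/
def Triple.IsExtension (H : Triple n M) (x : M) (t : Fin 3 → Tan n x)
    (Jt : Fin 3 → Tan n x →ₗ[ℝ] Tan n x) : Prop :=
  ∀ a, (∀ v ∈ H.Q a x, Jt a v = H.J a x v) ∧ Jt a (t a) = 0

/-- The hyperplane `Q_v = Q ⊕ {∑ c_a t_a | ∑ c_a v_a = 0}` at `x`. -/
def Triple.familyQ (H : Triple n M) (x : M) (t : Fin 3 → Tan n x) (v : Fin 3 → ℝ) :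
    Set (Tan n x) :=
  {w | ∃ q ∈ H.core x, ∃ c : Fin 3 → ℝ, ∑ a, c a * v a = 0 ∧ w = q + ∑ a, c a • t a}

/-- At the point `x`, the `S²`-families of `H` and `H'` are related by
`Q'_v = Q_{Sv}`, `I'_v = I_{Sv}` for all unit vectors `v`, where `I_v` is the restriction to `Q_v`
of `∑ v_a Ĩ_a`. (The families do not depend on the admissible triples `t`, `t'`.) -/
def GluesAt (H H' : Triple n M) (x : M) (S : Matrix (Fin 3) (Fin 3) ℝ) : Prop :=
  ∃ (t t' : Fin 3 → Tan n x) (Jt Jt' : Fin 3 → Tan n x →ₗ[ℝ] Tan n x),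
    H.IsAdmissibleAt x t ∧ H'.IsAdmissibleAt x t' ∧
    H.IsExtension x t Jt ∧ H'.IsExtension x t' Jt' ∧
    ∀ v : Fin 3 → ℝ, ∑ a, v a ^ 2 = 1 →
      H'.familyQ x t' v = H.familyQ x t (S.mulVec v) ∧
      ∀ w ∈ H'.familyQ x t' v, ∑ a, v a • Jt' a w = ∑ a, (S.mulVec v) a • Jt a w

/-! ### Compatible one-forms, Levi form, pseudohermitian structures -/

/-- The `ℝ³`-valued one-form `θ` on `U` is compatible with the structure `H`. -/
structure IsCompatible (U : Set M) (H : Triple n M) (θ : Fin 3 → Π x : M, Tan n x →L[ℝ] ℝ) :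
    Prop where
  smooth : ∀ a, SmoothFormOn (θ a) U
  ker : ∀ x ∈ U, ∀ a, ∀ v : Tan n x, θ a x v = 0 ↔ v ∈ H.Q a x
  comp : ∀ x ∈ U, ∀ a, ∀ v ∈ H.Q a x, θ (a + 2) x (H.J a x v) = θ (a + 1) x v

/-- The Levi form `½ (dθ₁(v, I w) + dθ₁(J v, K w))`, for `v`, `w` in `Q`. -/
def levi (H : Triple n M) (θ : Fin 3 → Π x : M, Tan n x →L[ℝ] ℝ) (x : M) (v w : Tan n x) : ℝ :=
  (1 / 2) * (dForm (θ 0) x v (H.J 0 x w) + dForm (θ 0) x (H.J 1 x v) (H.J 2 x w))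

/-- The form `h(v, w) = (2n+4) Levi(v, w) - ∑ dθ_a(v, I_a w)`, for `v`, `w` in `Q`. -/
def ultraForm (H : Triple n M) (θ : Fin 3 → Π x : M, Tan n x →L[ℝ] ℝ) (x : M) (v w : Tan n x) :
    ℝ :=
  (2 * (n : ℝ) + 4) * levi H θ x v w - ∑ a, dForm (θ a) x v (H.J a x w)

variable (n M) in
/-- A quaternionic CR structure: a covering by local hyper CR structures, any two of which are
related on the overlap of their domains by an `SO(3)`-valued function. -/
structure QuaternionicCR (ι : Type*) where
  /-- The domains of the local structures. -/
  U : ι → Set M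
  /-- The local structures. -/
  str : ι → Triple n M
  isOpen : ∀ i, IsOpen (U i)
  cover : ∀ x : M, ∃ i, x ∈ U i
  hyper : ∀ i, IsHyperCR (U i) (str i)
  glue : ∀ i j, ∀ x ∈ U i ∩ U j, ∃ S ∈ Matrix.specialOrthogonalGroup (Fin 3) ℝ,
    GluesAt (str i) (str j) x S

variable (n M) in
/-- A quaternionic pseudohermitian structure: a quaternionic CR structure together with compatible
local `ℝ³`-valued one-forms that are related by the same `SO(3)`-valued functions as the local
hyper CR structures, such that the Levi form is positive definite. -/
structure QuaternionicPseudohermitian (ι : Type*) extends QuaternionicCR n M ι where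
  /-- The local `ℝ³`-valued one-forms. -/
  θ : ι → Fin 3 → Π x : M, Tan n x →L[ℝ] ℝ
  compatible : ∀ i, IsCompatible (U i) (str i) (θ i)
  θ_glue : ∀ i j, ∀ x ∈ U i ∩ U j, ∀ S ∈ Matrix.specialOrthogonalGroup (Fin 3) ℝ,
    GluesAt (str i) (str j) x S → ∀ a, θ j a x = ∑ b, S b a • θ i b x
  levi_pos : ∀ i, ∀ x ∈ U i, ∀ v ∈ (str i).core x, v ≠ 0 → 0 < levi (str i) (θ i) x v v

/-- Ultra-pseudoconvexity: the form `h` is positive definite or negative definite. -/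
def QuaternionicPseudohermitian.IsUltraPseudoconvex {ι : Type*}
    (Θ : QuaternionicPseudohermitian n M ι) : Prop :=
  (∀ i, ∀ x ∈ Θ.U i, ∀ v ∈ (Θ.str i).core x, v ≠ 0 → 0 < ultraForm (Θ.str i) (Θ.θ i) x v v) ∨
  (∀ i, ∀ x ∈ Θ.U i, ∀ v ∈ (Θ.str i).core x, v ≠ 0 → ultraForm (Θ.str i) (Θ.θ i) x v v < 0)

/-! ### The connection associated with an admissible three-plane field -/

open Classical in
/-- The `A`-component of `v` with respect to the splitting `A ⊕ B`. -/
def component {T : Type*} [AddCommGroup T] [Module ℝ T] (A B : Submodule ℝ T) (v : T) : T :=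
  if h : IsCompl A B then (A.projectionOnto B h v : T) else 0

/-- The Levi form `g` extended to the tangent space by `g(P, ·) = 0`. -/
def leviExt (H : Triple n M) (θ : Fin 3 → Π x : M, Tan n x →L[ℝ] ℝ)
    (P : Π x : M, Submodule ℝ (Tan n x)) (x : M) (v w : Tan n x) : ℝ :=
  levi H θ x (component (H.core x) (P x) v) (component (H.core x) (P x) w)

/-- The form `g^⊥ = θ₁² + θ₂² + θ₃²`. -/
def perpForm (θ : Fin 3 → Π x : M, Tan n x →L[ℝ] ℝ) (x : M) (v w : Tan n x) : ℝ :=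
  ∑ a, θ a x v * θ a x w

variable (n M) in
/-- Candidates for affine connections; `D Y x w` is the covariant derivative `∇_w Y` at `x`. -/
abbrev ConnectionMap : Type _ := (Π x : M, Tan n x) → Π x : M, Tan n x →L[ℝ] Tan n x

/-- The torsion `∇_X Y - ∇_Y X - [X, Y]`. -/
def torsion (D : ConnectionMap n M) (X Y : Π x : M, Tan n x) (x : M) : Tan n x :=
  D Y x (X x) - D X x (Y x) - bracket X Y x

/-- The bilinear form `b` on the tangent bundle is parallel on `U`. -/
def IsParallel (U : Set M) (D : ConnectionMap n M) (b : Π x : M, Tan n x → Tan n x → ℝ) : Prop :=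
  ∀ V : Set M, IsOpen V → V ⊆ U → ∀ Y Z : Π x : M, Tan n x, SmoothOn Y V → SmoothOn Z V →
    ∀ x ∈ V, ∀ w : Tan n x,
      mvfderiv 𝓘(ℝ, Model n) (fun y ↦ b y (Y y) (Z y)) x w
        = b x (D Y x w) (Z x) + b x (Y x) (D Z x w)

/-- The field of subspaces `P` is preserved by the connection on `U`. -/
def IsPreserved (U : Set M) (D : ConnectionMap n M) (P : Π x : M, Submodule ℝ (Tan n x)) : Prop :=
  ∀ V : Set M, IsOpen V → V ⊆ U → ∀ Y : Π x : M, Tan n x, IsSection P Y V →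
    ∀ x ∈ V, ∀ w : Tan n x, D Y x w ∈ P x

/-- `D` is, on `U`, the connection associated with the admissible three-plane field `P`
(written `Q^⊥`) on the hyper pseudohermitian manifold `(U, H, θ)`. -/
structure IsAssociatedConnection (U : Set M) (H : Triple n M)
    (θ : Fin 3 → Π x : M, Tan n x →L[ℝ] ℝ) (P : Π x : M, Submodule ℝ (Tan n x))
    (D : ConnectionMap n M) : Prop where
  isConnection : IsCovariantDerivativeOn (Model n) D U
  smooth : ContMDiffCovariantDerivativeOn (Model n) ∞ D U
  preserves_core : IsPreserved U D H.core
  preserves_perp : IsPreserved U D P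
  parallel_levi : IsParallel U D (leviExt H θ P)
  parallel_perp : IsParallel U D (perpForm θ)
  torsion_core : ∀ V : Set M, IsOpen V → V ⊆ U → ∀ X Y : Π x : M, Tan n x,
    IsSection H.core X V → IsSection H.core Y V →
      ∀ x ∈ V, component (H.core x) (P x) (torsion D X Y x) = 0
  torsion_perp : ∀ V : Set M, IsOpen V → V ⊆ U → ∀ A B : Π x : M, Tan n x,
    IsSection P A V → IsSection P B V →
      ∀ x ∈ V, component (P x) (H.core x) (torsion D A B x) = 0
  torsion_symm_core : ∀ V : Set M, IsOpen V → V ⊆ U → ∀ A X Y : Π x : M, Tan n x,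
    IsSection P A V → IsSection H.core X V → IsSection H.core Y V →
      ∀ x ∈ V, levi H θ x (component (H.core x) (P x) (torsion D A X x)) (Y x)
        = levi H θ x (X x) (component (H.core x) (P x) (torsion D A Y x))
  torsion_symm_perp : ∀ V : Set M, IsOpen V → V ⊆ U → ∀ X A B : Π x : M, Tan n x,
    IsSection H.core X V → IsSection P A V → IsSection P B V →
      ∀ x ∈ V, perpForm θ x (component (P x) (H.core x) (torsion D A X x)) (B x)
        = perpForm θ x (A x) (component (P x) (H.core x) (torsion D B X x))

end

/-! ### The `E ⊗ H`-component of the obstruction -/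

/-- Index set of an adapted frame of a `4n`-dimensional space: `(k, 0), (k, 1), (k, 2), (k, 3)` are
the indices of `ε, Iε, Jε, Kε`, for the `k`-th vector `ε`. -/
abbrev Idx (n : ℕ) : Type := Fin n × Fin 4

/-- Real `4n × 4n` matrices. -/
abbrev Mat (n : ℕ) : Type := Matrix (Idx n) (Idx n) ℝ

/-- Left multiplication by `i`, `j`, `k` on the quaternions, in the basis `1, i, j, k`. -/
def quatUnit : Fin 3 → Matrix (Fin 4) (Fin 4) ℝ :=
  ![!![0, -1, 0, 0; 1, 0, 0, 0; 0, 0, 0, -1; 0, 0, 1, 0],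
    !![0, 0, -1, 0; 0, 0, 0, 1; 1, 0, 0, 0; 0, -1, 0, 0],
    !![0, 0, 0, -1; 0, 0, -1, 0; 0, 1, 0, 0; 1, 0, 0, 0]]

/-- The matrix of `I_a` with respect to an adapted frame. -/
def frameJ (n : ℕ) (a : Fin 3) : Mat n :=
  Matrix.of fun p q ↦ if p.1 = q.1 then quatUnit a p.2 q.2 else 0

/-- The Lie algebra `so(4n)` of skew-symmetric matrices. -/
def so (n : ℕ) : Submodule ℝ (Mat n) :=
  LinearMap.ker ((Matrix.transposeLinearEquiv (Idx n) (Idx n) ℝ ℝ).toLinearMap + LinearMap.id)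

/-- The Lie algebra `sp(n)`: the elements of `so(4n)` that commute with `I`, `J`, `K`. -/
def spn (n : ℕ) : Submodule ℝ (Mat n) :=
  so n ⊓ ⨅ a, LinearMap.ker
    (LinearMap.mulLeft ℝ (frameJ n a) - LinearMap.mulRight ℝ (frameJ n a))

/-- The Lie algebra `sp(1)`, spanned by `I`, `J`, `K`. -/
def sp1 (n : ℕ) : Submodule ℝ (Mat n) := Submodule.span ℝ (Set.range (frameJ n))

/-- The orthogonal complement `(sp(n) + sp(1))^⊥` in `so(4n)`; the Killing inner product is a
negative multiple of `tr(AB)`. -/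
def spPerp (n : ℕ) : Submodule ℝ (Mat n) :=
  so n ⊓ ⨅ B ∈ spn n ⊔ sp1 n,
    LinearMap.ker (Matrix.traceLinearMap (Idx n) ℝ ℝ ∘ₗ LinearMap.mulRight ℝ B)

/-- `C` is the `(sp(n) + sp(1))^⊥`-component of `A`. -/
def IsObsPart {n : ℕ} (A C : Mat n) : Prop := C ∈ spPerp n ∧ A - C ∈ spn n ⊔ sp1 n

/-- The submodule `E ⊗ H` of `(ℍⁿ)* ⊗ (sp(n) + sp(1))^⊥`. An element of the latter is given by its
values `σ p` on the vectors `e_p` of the standard basis of `ℍⁿ = ℝ^(4n)`. The embedding of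
`ℍⁿ` (whose complexification is `E ⊗ H`) sends `v` to
`∑_p e_p ⊗ (e_p ∧ v)^⊥`, where `^⊥` denotes the `(sp(n) + sp(1))^⊥`-component; after
complexification this is the tensor product of the embeddings `E → E ⊗ Λ²₀E` and `H → H ⊗ S²H` that
are given by contraction with the symplectic forms. -/
def IsEH {n : ℕ} (σ : Idx n → Mat n) : Prop :=
  ∃ v : Idx n → ℝ, ∀ p : Idx n,
    IsObsPart (Matrix.vecMulVec (Pi.single p 1) v - Matrix.vecMulVec v (Pi.single p 1)) (σ p)

/-- The `E ⊗ H`-component of `τ` vanishes: the `(sp(n) + sp(1))^⊥`-component of `τ` is orthogonal to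
the submodule `E ⊗ H`. Here `τ p` is the value of the `so(4n)`-valued form `τ` on the `p`-th
vector of the frame. -/
def EHComponentVanishes {n : ℕ} (τ : Idx n → Mat n) : Prop :=
  ∀ obs : Idx n → Mat n, (∀ p, IsObsPart (τ p) (obs p)) →
    ∀ σ : Idx n → Mat n, IsEH σ → ∑ p, (obs p * σ p).trace = 0

section

variable {n : ℕ} {M : Type*} [TopologicalSpace M] [ChartedSpace (Model n) M]
  [IsManifold 𝓘(ℝ, Model n) ∞ M]

/-- `ε` is an adapted orthonormal frame for `Q` over `V`. -/
structure IsAdaptedFrame (V : Set M) (H : Triple n M) (θ : Fin 3 → Π x : M, Tan n x →L[ℝ] ℝ)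
    (ε : Idx n → Π x : M, Tan n x) : Prop where
  isSection : ∀ p, IsSection H.core (ε p) V
  orthonormal : ∀ x ∈ V, ∀ p q, levi H θ x (ε p x) (ε q x) = if p = q then 1 else 0
  adapted : ∀ x ∈ V, ∀ k : Fin n, ε (k, 1) x = H.J 0 x (ε (k, 0) x) ∧
    ε (k, 2) x = H.J 1 x (ε (k, 0) x) ∧ ε (k, 3) x = H.J 2 x (ε (k, 0) x)

/-- The matrix `ω(w)` of connection forms, `∇_w ε_q = ∑_p ω_{pq}(w) ε_p`, for an orthonormal
frame `ε` of `Q`. -/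
def connectionMatrix (H : Triple n M) (θ : Fin 3 → Π x : M, Tan n x →L[ℝ] ℝ)
    (D : ConnectionMap n M) (ε : Idx n → Π x : M, Tan n x) (x : M) (w : Tan n x) : Mat n :=
  Matrix.of fun p q ↦ levi H θ x (D (ε q) x w) (ε p x)

/-- The condition `ω^{E ⊗ H} = 0` on `U`, for the restriction of `D` to a `Q`-partial connection
on `Q`. -/
def EHCondition (U : Set M) (H : Triple n M) (θ : Fin 3 → Π x : M, Tan n x →L[ℝ] ℝ)
    (D : ConnectionMap n M) : Prop :=
  ∀ V : Set M, IsOpen V → V ⊆ U → ∀ ε : Idx n → Π x : M, Tan n x, IsAdaptedFrame V H θ ε →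
    ∀ x ∈ V, EHComponentVanishes fun p ↦ connectionMatrix H θ D ε x (ε p x)

/-- `P` is the canonical three-plane field and `D` the canonical connection of the hyper
pseudohermitian manifold `(U, H, θ)`. -/
structure IsCanonical (U : Set M) (H : Triple n M) (θ : Fin 3 → Π x : M, Tan n x →L[ℝ] ℝ)
    (P : Π x : M, Submodule ℝ (Tan n x)) (D : ConnectionMap n M) : Prop where
  admissible : IsAdmissiblePlaneField U H P
  associated : IsAssociatedConnection U H θ P D
  eh : EHCondition U H θ D

/-- The three-plane fields `P`, `P'` and the connections `D`, `D'` coincide on `U`. -/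
def AgreeOn (U : Set M) (P P' : Π x : M, Submodule ℝ (Tan n x)) (D D' : ConnectionMap n M) : Prop :=
  ∀ x ∈ U, P x = P' x ∧ ∀ Y : Π y : M, Tan n y,
    MDifferentiableAt 𝓘(ℝ, Model n) (𝓘(ℝ, Model n)).tangent
      (fun y ↦ (⟨y, Y y⟩ : TangentBundle 𝓘(ℝ, Model n) M)) x → D Y x = D' Y x

end

end QCR

end

/-! Fix one local structure `(U, θ)`. An admissible three-plane field is spanned by exactly one
triple with `θ_a(T_b) = δ_ab`, and two such triples differ by `T'_a = T_a + I_a Z` for a single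
section `Z` of `Q`. So admissible fields form an affine space over the sections of `Q`.

Given `T` and an adapted orthonormal frame `ε` of `Q`, conditions (i)-(iii) are linear equations for
the Christoffel symbols in the frame `(ε, T)`, with a unique solution: Koszul's formula when the
three indices are of one type, and the skew part of the bracket coefficients in the mixed case.
Hence each plane field has one associated connection (`coeff_associated`,
`isAssociatedConnection_connection`), and only the `E ⊗ H` condition remains to determine `Z`.

That condition is the vanishing of one vector in `ℝ^(4n)`, the contraction `∑_p ω^obs(ε_p) ε_p`
(`ehComponentVanishes_iff`). Replacing `T_a` by `T_a + I_a Z` changes the `Q`-part of `[ε_p, ε_q]`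
by `∑_a dθ_a(ε_p, ε_q) I_a Z`, and so changes the connection forms linearly in `Z`. If `W_a` is the
matrix of `dθ_a` on `Q` and `J_a` that of `I_a`, integrability and the definition of the Levi form
make `W_a + J_a` commute with all `J_b` (`dMatrix_commute`). This evaluates every trace and every
sum `∑ J_b W_a J_b` that occurs, and the contraction turns out to change by `-3(n-1)/(4n)` times the
matrix of `h` applied to `Z` (`obstruction_add_act`). For `n > 1` and `h` definite this map is
invertible, with smoothly varying inverse: there is one `Z` that removes the obstruction, and it is
smooth (`exists_balanced`, `agree_of_balanced`).

On an overlap the two structures differ by a smooth `SO(3)`-valued function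
(`isRotation_of_gluesAt`). The Levi form, `g^⊥`, `Q` and the span of `T` are unchanged, hence so is
the associated connection. Adapted frames change by an orthogonal matrix `G` that normalizes
`sp(1)`. The inhomogeneous term `Gᵀ dG` of the connection forms then brackets `sp(1)` into itself
and has no component in `(sp(n) + sp(1))^⊥`, so the contracted obstruction is merely rotated
(`contract_change`). A field canonical for one structure is therefore canonical for the other, and
local uniqueness patches the local solutions together. -/

noncomputable section
namespace QCR

set_option linter.unusedSectionVars false

/-! ### Smooth vector fields, functions and local frames. -/

section Calculus

variable {n : ℕ} {M : Type*} [TopologicalSpace M] [ChartedSpace (Model n) M]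
  [IsManifold 𝓘(ℝ, Model n) ∞ M]

variable (n M) in
/-- Vector fields on `M`, without any regularity. -/
abbrev VF : Type _ := Π x : M, Tan n x

/-- The vector field `X` is differentiable at `x`. -/
abbrev DiffAt (X : VF n M) (x : M) : Prop :=
  MDifferentiableAt 𝓘(ℝ, Model n) (𝓘(ℝ, Model n)).tangent
    (fun y ↦ (⟨y, X y⟩ : TangentBundle 𝓘(ℝ, Model n) M)) x

variable (n) in
/-- The function `f` is differentiable at `x`. -/
abbrev FDiffAt (f : M → ℝ) (x : M) : Prop :=
  MDifferentiableAt 𝓘(ℝ, Model n) 𝓘(ℝ, ℝ) f x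

variable (n) in
/-- The function `f` is smooth on `V`. -/
abbrev FSmoothOn (f : M → ℝ) (V : Set M) : Prop :=
  ContMDiffOn 𝓘(ℝ, Model n) 𝓘(ℝ, ℝ) ∞ f V

theorem SmoothOn.mono {X : VF n M} {V W : Set M} (h : SmoothOn X V) (hW : W ⊆ V) :
    SmoothOn X W := ContMDiffOn.mono h hW

theorem SmoothOn.diffAt {X : VF n M} {V : Set M} (h : SmoothOn X V) (hV : IsOpen V) {x : M}
    (hx : x ∈ V) : DiffAt X x :=
  (ContMDiffOn.contMDiffAt h (hV.mem_nhds hx)).mdifferentiableAt (by simp)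

theorem FSmoothOn.fdiffAt {f : M → ℝ} {V : Set M} (h : FSmoothOn n f V) (hV : IsOpen V) {x : M}
    (hx : x ∈ V) : FDiffAt n f x :=
  (ContMDiffOn.contMDiffAt h (hV.mem_nhds hx)).mdifferentiableAt (by simp)

theorem SmoothOn.congr {X Y : VF n M} {V : Set M} (h : SmoothOn X V) (hXY : ∀ x ∈ V, Y x = X x) :
    SmoothOn Y V :=
  ContMDiffOn.congr h fun x hx ↦ by rw [hXY x hx]

theorem SmoothOn.add {X Y : VF n M} {V : Set M} (hX : SmoothOn X V) (hY : SmoothOn Y V) :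
    SmoothOn (fun x ↦ X x + Y x) V := ContMDiffOn.add_section hX hY

theorem SmoothOn.sub {X Y : VF n M} {V : Set M} (hX : SmoothOn X V) (hY : SmoothOn Y V) :
    SmoothOn (fun x ↦ X x - Y x) V := ContMDiffOn.sub_section hX hY

theorem SmoothOn.neg {X : VF n M} {V : Set M} (hX : SmoothOn X V) :
    SmoothOn (fun x ↦ - X x) V := ContMDiffOn.neg_section hX

theorem SmoothOn.smul {X : VF n M} {f : M → ℝ} {V : Set M} (hf : FSmoothOn n f V)
    (hX : SmoothOn X V) : SmoothOn (fun x ↦ f x • X x) V := ContMDiffOn.smul_section hf hX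

theorem SmoothOn.sum {ι : Type*} {s : Finset ι} {X : ι → VF n M} {V : Set M}
    (hX : ∀ i ∈ s, SmoothOn (X i) V) : SmoothOn (fun x ↦ ∑ i ∈ s, X i x) V :=
  ContMDiffOn.sum_section hX

theorem SmoothOn.of_local {X : VF n M} {V : Set M}
    (h : ∀ x ∈ V, ∃ W, IsOpen W ∧ x ∈ W ∧ SmoothOn X W) : SmoothOn X V := by
  intro x hx
  obtain ⟨W, hW, hxW, h⟩ := h x hx
  exact (ContMDiffOn.contMDiffAt h (hW.mem_nhds hxW)).contMDiffWithinAt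

theorem DiffAt.add {X Y : VF n M} {x : M} (hX : DiffAt X x) (hY : DiffAt Y x) :
    DiffAt (X + Y) x := mdifferentiableAt_add_section hX hY

theorem DiffAt.smul {X : VF n M} {f : M → ℝ} {x : M} (hf : FDiffAt n f x) (hX : DiffAt X x) :
    DiffAt (f • X) x := hf.smul_section hX

theorem DiffAt.sum {ι : Type*} {s : Finset ι} {X : ι → VF n M} {x : M}
    (hX : ∀ i ∈ s, DiffAt (X i) x) : DiffAt (fun x ↦ ∑ i ∈ s, X i x) x :=
  .sum_section hX

theorem diffAt_extend {x : M} (v : Tan n x) : DiffAt (FiberBundle.extend (Model n) v) x :=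
  FiberBundle.mdifferentiableAt_extend ..

theorem FDiffAt.const (c : ℝ) (x : M) : FDiffAt n (fun _ : M ↦ c) x := mdifferentiableAt_const

theorem FDiffAt.sum {ι : Type*} {s : Finset ι} {f : ι → M → ℝ} {x : M}
    (hf : ∀ i ∈ s, FDiffAt n (f i) x) : FDiffAt n (fun y ↦ ∑ i ∈ s, f i y) x := by
  classical
  induction s using Finset.induction_on with
  | empty => simpa using FDiffAt.const 0 x
  | insert a s ha ih =>
    simp only [Finset.sum_insert ha]
    exact (hf a (by simp)).add (ih fun i hi ↦ hf i (by simp [hi]))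

theorem mvfderiv_finsetSum {ι : Type*} {s : Finset ι} {f : ι → M → ℝ} {x : M}
    (hf : ∀ i ∈ s, FDiffAt n (f i) x) (w : Tan n x) :
    mvfderiv 𝓘(ℝ, Model n) (fun y ↦ ∑ i ∈ s, f i y) x w
      = ∑ i ∈ s, mvfderiv 𝓘(ℝ, Model n) (f i) x w := by
  classical
  induction s using Finset.induction_on with
  | empty => simp [mvfderiv_const]
  | insert a s ha ih =>
    simp only [Finset.sum_insert ha]
    rw [mvfderiv_fun_add (hf a (by simp)) (FDiffAt.sum fun i hi ↦ hf i (by simp [hi])),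
      add_apply, ih fun i hi ↦ hf i (by simp [hi])]

theorem FSmoothOn.sum {ι : Type*} {s : Finset ι} {f : ι → M → ℝ} {V : Set M}
    (hf : ∀ i ∈ s, FSmoothOn n (f i) V) : FSmoothOn n (fun x ↦ ∑ i ∈ s, f i x) V :=
  contMDiffOn_finsetSum hf

theorem FSmoothOn.prod {ι : Type*} {s : Finset ι} {f : ι → M → ℝ} {V : Set M}
    (hf : ∀ i ∈ s, FSmoothOn n (f i) V) : FSmoothOn n (fun x ↦ ∏ i ∈ s, f i x) V :=
  contMDiffOn_finsetProd hf

theorem FSmoothOn.mul {f g : M → ℝ} {V : Set M} (hf : FSmoothOn n f V) (hg : FSmoothOn n g V) :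
    FSmoothOn n (fun x ↦ f x * g x) V := ContMDiffOn.mul hf hg

theorem FSmoothOn.add {f g : M → ℝ} {V : Set M} (hf : FSmoothOn n f V) (hg : FSmoothOn n g V) :
    FSmoothOn n (fun x ↦ f x + g x) V := ContMDiffOn.add hf hg

theorem FSmoothOn.sub {f g : M → ℝ} {V : Set M} (hf : FSmoothOn n f V) (hg : FSmoothOn n g V) :
    FSmoothOn n (fun x ↦ f x - g x) V := ContMDiffOn.sub hf hg

theorem FSmoothOn.const (c : ℝ) {V : Set M} : FSmoothOn n (fun _ : M ↦ c) V := contMDiffOn_const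

theorem FSmoothOn.inv {f : M → ℝ} {V : Set M} (hf : FSmoothOn n f V) (h0 : ∀ x ∈ V, f x ≠ 0) :
    FSmoothOn n (fun x ↦ (f x)⁻¹) V := ContMDiffOn.inv₀ hf h0

theorem FSmoothOn.comp {f : M → ℝ} {V : Set M} (hf : FSmoothOn n f V) {φ : ℝ → ℝ}
    (hφ : ∀ x ∈ V, ContDiffAt ℝ ∞ φ (f x)) : FSmoothOn n (fun x ↦ φ (f x)) V :=
  fun x hx ↦ (hφ x hx).contMDiffAt.comp_contMDiffWithinAt x (hf x hx)

/-- The entries of the inverse of a smooth invertible matrix are smooth. -/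
theorem FSmoothOn.matrix_inv {ι : Type*} [Fintype ι] [DecidableEq ι] {A : M → Matrix ι ι ℝ}
    {V : Set M} (hA : ∀ i j, FSmoothOn n (fun x ↦ A x i j) V) (h0 : ∀ x ∈ V, (A x).det ≠ 0)
    (i j : ι) : FSmoothOn n (fun x ↦ (A x)⁻¹ i j) V := by
  have hdet : ∀ B : M → Matrix ι ι ℝ, (∀ i j, FSmoothOn n (fun x ↦ B x i j) V) →
      FSmoothOn n (fun x ↦ (B x).det) V := by
    intro B hB
    simp only [Matrix.det_apply']
    exact FSmoothOn.sum fun σ _ ↦ (FSmoothOn.const _).mul (FSmoothOn.prod fun k _ ↦ hB _ _)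
  have hadj : FSmoothOn n (fun x ↦ (A x).adjugate i j) V := by
    simp only [Matrix.adjugate_apply]
    refine hdet _ fun k l ↦ ?_
    by_cases hk : k = j
    · subst hk
      simpa using FSmoothOn.const _
    · simpa [Matrix.updateRow_ne hk] using hA k l
  simpa [Matrix.inv_def] using ((hdet A hA).inv h0).mul hadj

theorem continuousOn_det {ι : Type*} [Fintype ι] [DecidableEq ι] {A : M → Matrix ι ι ℝ}
    {V : Set M} (hA : ∀ i j, FSmoothOn n (fun x ↦ A x i j) V) :
    ContinuousOn (fun x ↦ (A x).det) V := by
  simp only [Matrix.det_apply']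
  exact continuousOn_finsetSum _ fun σ _ ↦ continuousOn_const.mul
    (continuousOn_finsetProd _ fun k _ ↦ (hA _ _).continuousOn)

/-! ### Frames -/

/-- `E` is a smooth frame of the tangent bundle over `V`. -/
abbrev IsFrame {ι : Type*} (E : ι → VF n M) (V : Set M) : Prop :=
  IsLocalFrameOn 𝓘(ℝ, Model n) (Model n) ∞ E V

/-- Near every point there is a smooth frame. -/
theorem exists_isFrame (x : M) : ∃ (V : Set M) (E : Fin (4 * n + 3) → VF n M),
    IsOpen V ∧ x ∈ V ∧ IsFrame E V := by
  let t := trivializationAt (Model n) (TangentSpace 𝓘(ℝ, Model n) : M → Type _) x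
  let b := (EuclideanSpace.basisFun (Fin (4 * n + 3)) ℝ).toBasis
  exact ⟨t.baseSet, t.localFrame b, t.open_baseSet,
    FiberBundle.mem_baseSet_trivializationAt _ _ x, t.isLocalFrameOn_localFrame_baseSet _ _ b⟩

variable {ι : Type*} [Fintype ι]

/-- The frame has an invertible matrix `A` of coefficients in a trivialization; `B = A⁻¹` converts
trivialization coefficients `s`, whose regularity is known, into coefficients in `E`. Regularity on
open sets and at a point are both recorded. -/
theorem IsFrame.exists_coeff_local [DecidableEq ι] {E : ι → VF n M} {V : Set M} (hE : IsFrame E V)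
    (hV : IsOpen V) {x : M} (hx : x ∈ V) :
    ∃ (W : Set M) (s : ι → Π y : M, Tan n y →ₗ[ℝ] ℝ) (B : ι → ι → M → ℝ), IsOpen W ∧ x ∈ W ∧
      W ⊆ V ∧ (∀ i j, FSmoothOn n (B i j) W) ∧
      (∀ i, ∀ W' : Set M, IsOpen W' → W' ⊆ W → ∀ Y : VF n M, SmoothOn Y W' →
        FSmoothOn n (fun y ↦ s i y (Y y)) W') ∧
      (∀ i, ∀ y ∈ W, ∀ Y : VF n M, DiffAt Y y → FDiffAt n (fun y ↦ s i y (Y y)) y) ∧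
      ∀ y ∈ W, ∀ v : Tan n y, ∀ i, hE.coeff i y v = ∑ j, B i j y * s j y v := by
  let t := trivializationAt (Model n) (TangentSpace 𝓘(ℝ, Model n) : M → Type _) x
  let b : Module.Basis ι ℝ (Model n) := hE.toBasisAt hx
  let A : M → Matrix ι ι ℝ := fun y ↦ Matrix.of fun i j ↦
    t.localFrameCoeff 𝓘(ℝ, Model n) b i y (E j y)
  have hxt : x ∈ t.baseSet := FiberBundle.mem_baseSet_trivializationAt _ _ x
  have hWo : IsOpen (V ∩ t.baseSet) := hV.inter t.open_baseSet
  have hA : ∀ i j, FSmoothOn n (fun y ↦ A y i j) (V ∩ t.baseSet) := fun i j ↦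
    contMDiffOn_localFrameCoeff (e := t) b hWo Set.inter_subset_right
      ((hE.contMDiffOn j).mono Set.inter_subset_left) i
  have key : ∀ y ∈ V ∩ t.baseSet, ∀ v : Tan n y, ∀ i,
      t.localFrameCoeff 𝓘(ℝ, Model n) b i y v = ∑ j, A y i j * hE.coeff j y v := by
    intro y hy v i
    have h1 : v = ∑ j, hE.coeff j y v • E j y := by
      simpa using hE.coeff_sum_eq (FiberBundle.extend (Model n) v) hy.1
    conv_lhs => rw [h1]
    simp [A, mul_comm]
  have hdet : ∀ y ∈ V ∩ t.baseSet, (A y).det ≠ 0 := by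
    intro y hy
    have h1 : A y = (t.basisAt b hy.2).toMatrix (hE.toBasisAt hy.1) := by
      ext i j
      have := t.localFrameCoeff_apply_of_mem_baseSet (I := 𝓘(ℝ, Model n)) b hy.2 (E j) i
      simp [A, Module.Basis.toMatrix_apply, this]
    rw [h1]
    have := (t.basisAt b hy.2).invertibleToMatrix (hE.toBasisAt hy.1)
    exact (Matrix.isUnit_det_of_invertible _).ne_zero
  refine ⟨V ∩ t.baseSet, fun i y ↦ t.localFrameCoeff 𝓘(ℝ, Model n) b i y,
    fun i j y ↦ (A y)⁻¹ i j, hWo, ⟨hx, hxt⟩, Set.inter_subset_left,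
    fun i j ↦ FSmoothOn.matrix_inv hA hdet i j, fun i W' hW' hWW Y hY ↦
      contMDiffOn_localFrameCoeff (e := t) b hW' (hWW.trans Set.inter_subset_right) hY i,
    fun i y hy Y hY ↦ mdifferentiableAt_localFrameCoeff (e := t) b hy.2 hY i, fun y hy v i ↦ ?_⟩
  have h1 : (fun i ↦ t.localFrameCoeff 𝓘(ℝ, Model n) b i y v)
      = (A y).mulVec (fun j ↦ hE.coeff j y v) := by
    ext i; rw [key y hy v i]; rfl
  have h2 : (A y)⁻¹.mulVec (fun i ↦ t.localFrameCoeff 𝓘(ℝ, Model n) b i y v)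
      = fun j ↦ hE.coeff j y v := by
    rw [h1, Matrix.mulVec_mulVec, Matrix.nonsing_inv_mul _ (hdet y hy).isUnit, Matrix.one_mulVec]
  exact (congrFun h2 i).symm

theorem IsFrame.coeff_smooth {E : ι → VF n M} {V W : Set M} (hE : IsFrame E V)
    (hV : IsOpen V) (hW : IsOpen W) (hWV : W ⊆ V) {Y : VF n M} (hY : SmoothOn Y W) (i : ι) :
    FSmoothOn n (fun y ↦ hE.coeff i y (Y y)) W := by
  classical
  intro x hx
  obtain ⟨W', s, B, hW', hxW', hWV', hB, hs, -, hc⟩ := hE.exists_coeff_local hV (hWV hx)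
  have h : FSmoothOn n (fun y ↦ hE.coeff i y (Y y)) (W' ∩ W) :=
    (FSmoothOn.sum fun j (_ : j ∈ Finset.univ) ↦ ((hB i j).mono Set.inter_subset_left).mul
      (hs j (W' ∩ W) (hW'.inter hW) Set.inter_subset_left Y
        (hY.mono Set.inter_subset_right))).congr fun y hy ↦ hc y hy.1 _ i
  exact (h.contMDiffAt ((hW'.inter hW).mem_nhds ⟨hxW', hx⟩)).contMDiffWithinAt

theorem IsFrame.coeff_diffAt {E : ι → VF n M} {V : Set M} (hE : IsFrame E V)
    (hV : IsOpen V) {x : M} (hx : x ∈ V) {Y : VF n M} (hY : DiffAt Y x) (i : ι) :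
    FDiffAt n (fun y ↦ hE.coeff i y (Y y)) x := by
  classical
  obtain ⟨W', s, B, hW', hxW', hWV', hB, -, hs, hc⟩ := hE.exists_coeff_local hV hx
  have h : FDiffAt n (fun y ↦ ∑ j, B i j y * s j y (Y y)) x := by
    refine FDiffAt.sum fun j _ ↦ ?_
    exact (FSmoothOn.fdiffAt (hB i j) hW' hxW').mul (hs j x hxW' Y hY)
  exact h.congr_of_eventuallyEq (by
    filter_upwards [hW'.mem_nhds hxW'] with y hy using hc y hy _ i)

theorem IsFrame.sum_coeff {E : ι → VF n M} {V : Set M} (hE : IsFrame E V) {x : M} (hx : x ∈ V)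
    (v : Tan n x) : ∑ i, hE.coeff i x v • E i x = v := by
  simpa using (hE.coeff_sum_eq (FiberBundle.extend (Model n) v) hx).symm

theorem IsFrame.coeff_self [DecidableEq ι] {E : ι → VF n M} {V : Set M} (hE : IsFrame E V)
    {x : M} (hx : x ∈ V) (i j : ι) : hE.coeff i x (E j x) = if j = i then 1 else 0 := by
  have := hE.coeff_apply_of_mem hx (E j) i
  rw [this, ← hE.toBasisAt_coe hx j, Module.Basis.repr_self, Finsupp.single_apply]

theorem IsFrame.diffAt {E : ι → VF n M} {V : Set M} (hE : IsFrame E V) (hV : IsOpen V) {x : M}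
    (hx : x ∈ V) (i : ι) : DiffAt (E i) x := SmoothOn.diffAt (hE.contMDiffOn i) hV hx

/-- A doubly tensorial operation is determined by its values on a frame. -/
theorem tensorial_expand {A : Type*} [AddCommGroup A] [Module ℝ A]
    {Φ : VF n M → VF n M → A} {x : M}
    (h₁ : ∀ Y, DiffAt Y x → TensorialAt 𝓘(ℝ, Model n) (Model n) (Φ · Y) x)
    (h₂ : ∀ X, DiffAt X x → TensorialAt 𝓘(ℝ, Model n) (Model n) (Φ X ·) x)
    {E : ι → VF n M} {V : Set M} (hE : IsFrame E V) (hV : IsOpen V) (hx : x ∈ V)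
    {X Y : VF n M} (hX : DiffAt X x) (hY : DiffAt Y x) :
    Φ X Y = ∑ i, ∑ j, (hE.coeff i x (X x) * hE.coeff j x (Y x)) • Φ (E i) (E j) := by
  have hEd : ∀ i, DiffAt (E i) x := fun i ↦ hE.diffAt hV hx i
  have hcd : ∀ c : ℝ, FDiffAt n (fun _ : M ↦ c) x := fun c ↦ mdifferentiableAt_const
  have hsm : ∀ (c : ℝ) i, DiffAt ((fun _ : M ↦ c) • E i) x := fun c i ↦ (hEd i).smul (hcd c)
  have hS : ∀ c : ι → ℝ, DiffAt (fun y ↦ ∑ i, ((fun _ : M ↦ c i) • E i) y) x :=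
    fun c ↦ DiffAt.sum fun i _ ↦ hsm _ i
  -- Only values at `x` matter, so both fields may be replaced by combinations of the frame with
  -- coefficients frozen at `x`.
  rw [TensorialAt.pointwise₂ h₁ h₂ hX (hS fun i ↦ hE.coeff i x (X x)) hY
    (hS fun i ↦ hE.coeff i x (Y x)) (by simpa using (hE.sum_coeff hx (X x)).symm)
    (by simpa using (hE.sum_coeff hx (Y x)).symm)]
  rw [(h₁ _ (hS _)).sum _ fun i _ ↦ hsm _ i]
  refine Finset.sum_congr rfl fun i _ ↦ ?_
  rw [(h₁ _ (hS _)).smul (hcd _) (hEd i), (h₂ _ (hEd i)).sum _ fun j _ ↦ hsm _ j, Finset.smul_sum]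
  refine Finset.sum_congr rfl fun j _ ↦ ?_
  rw [(h₂ _ (hEd i)).smul (hcd _) (hEd j), smul_smul]

end Calculus

/-! ### Brackets, one-forms and connections in a frame. -/

section Calculus

variable {n : ℕ} {M : Type*} [TopologicalSpace M] [ChartedSpace (Model n) M]
  [IsManifold 𝓘(ℝ, Model n) ∞ M]

instance instFiniteDimensionalTan (x : M) : FiniteDimensional ℝ (Tan n x) :=
  inferInstanceAs (FiniteDimensional ℝ (Model n))

instance instT2SpaceTan (x : M) : T2Space (Tan n x) :=
  inferInstanceAs (T2Space (Model n))

theorem finrank_tan (x : M) : Module.finrank ℝ (Tan n x) = 4 * n + 3 :=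
  (finrank_euclideanSpace_fin : Module.finrank ℝ (Model n) = 4 * n + 3)

/-! ### Derivatives and brackets -/

theorem SmoothOn.bracket {X Y : VF n M} {V : Set M} (hV : IsOpen V) (hX : SmoothOn X V)
    (hY : SmoothOn Y V) : SmoothOn (bracket X Y) V := by
  intro x hx
  have : IsManifold 𝓘(ℝ, Model n) (((⊤ : ℕ∞) : ℕ∞ω) + 1) M :=
    inferInstanceAs (IsManifold 𝓘(ℝ, Model n) ∞ M)
  have : IsManifold 𝓘(ℝ, Model n) (minSmoothness ℝ 2) M := by
    rw [minSmoothness_of_isRCLikeNormedField]; infer_instance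
  exact (ContMDiffAt.mlieBracket_vectorField (m := ⊤) (n := ⊤)
    (ContMDiffOn.contMDiffAt hX (hV.mem_nhds hx)) (ContMDiffOn.contMDiffAt hY (hV.mem_nhds hx))
    (by rw [minSmoothness_of_isRCLikeNormedField]; exact le_rfl)).contMDiffWithinAt

theorem bracket_smul_left {X Y : VF n M} {f : M → ℝ} {x : M} (hf : FDiffAt n f x)
    (hX : DiffAt X x) : bracket (f • X) Y x
      = -(mvfderiv 𝓘(ℝ, Model n) f x (Y x)) • X x + f x • bracket X Y x :=
  VectorField.mlieBracket_smul_left hf hX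

theorem bracket_smul_right {X Y : VF n M} {f : M → ℝ} {x : M} (hf : FDiffAt n f x)
    (hY : DiffAt Y x) : bracket X (f • Y) x
      = (mvfderiv 𝓘(ℝ, Model n) f x (X x)) • Y x + f x • bracket X Y x :=
  VectorField.mlieBracket_smul_right hf hY

theorem bracket_swap (X Y : VF n M) (x : M) : bracket X Y x = - bracket Y X x :=
  VectorField.mlieBracket_swap_apply

theorem bracket_add_left {X X' Y : VF n M} {x : M} (hX : DiffAt X x) (hX' : DiffAt X' x) :
    bracket (X + X') Y x = bracket X Y x + bracket X' Y x :=
  VectorField.mlieBracket_add_left hX hX'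

theorem bracket_add_right {X Y Y' : VF n M} {x : M} (hY : DiffAt Y x) (hY' : DiffAt Y' x) :
    bracket X (Y + Y') x = bracket X Y x + bracket X Y' x :=
  VectorField.mlieBracket_add_right hY hY'

theorem mvfderiv_congr {f g : M → ℝ} {x : M} (h : f =ᶠ[𝓝 x] g) :
    mvfderiv 𝓘(ℝ, Model n) f x = mvfderiv 𝓘(ℝ, Model n) g x := by
  have h1 := h.self_of_nhds
  have h2 : mfderiv 𝓘(ℝ, Model n) 𝓘(ℝ, ℝ) f x = mfderiv 𝓘(ℝ, Model n) 𝓘(ℝ, ℝ) g x := h.mfderiv_eq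
  ext v
  exact congrArg (fun L : Model n →L[ℝ] ℝ ↦ L v) h2

theorem mvfderiv_eq_zero_of_eventually_const {f : M → ℝ} {c : ℝ} {x : M}
    (h : ∀ᶠ y in 𝓝 x, f y = c) : mvfderiv 𝓘(ℝ, Model n) f x = 0 := by
  rw [mvfderiv_congr (g := fun _ ↦ c) h, mvfderiv_const]

theorem mvfderiv_mul_apply {f g : M → ℝ} {x : M} (hf : FDiffAt n f x) (hg : FDiffAt n g x)
    (w : Tan n x) : mvfderiv 𝓘(ℝ, Model n) (fun y ↦ f y * g y) x w
      = f x * mvfderiv 𝓘(ℝ, Model n) g x w + g x * mvfderiv 𝓘(ℝ, Model n) f x w := by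
  rw [mvfderiv_fun_mul hf hg]; rfl

theorem mvfderiv_add_apply {f g : M → ℝ} {x : M} (hf : FDiffAt n f x) (hg : FDiffAt n g x)
    (w : Tan n x) : mvfderiv 𝓘(ℝ, Model n) (fun y ↦ f y + g y) x w
      = mvfderiv 𝓘(ℝ, Model n) f x w + mvfderiv 𝓘(ℝ, Model n) g x w := by
  rw [mvfderiv_fun_add hf hg]; rfl

/-- The derivative is read off from brackets: `[X, fE] - f[X, E] = (Xf) E` for a frame vector `E`,
and brackets and frame coefficients of smooth fields are smooth. -/
theorem FSmoothOn.mvfderiv {f : M → ℝ} {X : VF n M} {V : Set M} (hV : IsOpen V)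
    (hf : FSmoothOn n f V) (hX : SmoothOn X V) :
    FSmoothOn n (fun x ↦ mvfderiv 𝓘(ℝ, Model n) f x (X x)) V := by
  intro x hx
  obtain ⟨W, E, hW, hxW, hE⟩ := exists_isFrame (n := n) x
  have hVW : IsOpen (V ∩ W) := hV.inter hW
  have hX' := hX.mono (Set.inter_subset_left (t := W))
  have hf' : FSmoothOn n f (V ∩ W) := hf.mono Set.inter_subset_left
  have hE0 : SmoothOn (E 0) (V ∩ W) := (hE.contMDiffOn 0).mono Set.inter_subset_right
  have h1 := SmoothOn.bracket hVW hX' (SmoothOn.smul hf' hE0)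
  have h2 := SmoothOn.smul hf' (SmoothOn.bracket hVW hX' hE0)
  have h3 := hE.coeff_smooth hW hVW Set.inter_subset_right (h1.sub h2) 0
  refine ((h3.congr fun y hy ↦ ?_).contMDiffAt (hVW.mem_nhds ⟨hx, hxW⟩)).contMDiffWithinAt
  have := bracket_smul_right (X := X) (hf'.fdiffAt hVW hy) (hE0.diffAt hVW hy)
  change _ = hE.coeff 0 y (QCR.bracket X (f • E 0) y - _)
  rw [this, add_sub_cancel_right, map_smul, hE.coeff_self hy.2]
  simp

/-! ### One-forms -/

theorem SmoothFormOn.smooth {θ : Π x : M, Tan n x →L[ℝ] ℝ} {U V : Set M} (hθ : SmoothFormOn θ U)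
    (hV : IsOpen V) (hVU : V ⊆ U) {X : VF n M} (hX : SmoothOn X V) :
    FSmoothOn n (fun x ↦ θ x (X x)) V := hθ V hV hVU X hX

/-- Smoothness of a form is tested on smooth fields only; expansion in a smooth frame carries it
over to fields that are merely differentiable at the point. -/
theorem SmoothFormOn.fdiffAt {θ : Π x : M, Tan n x →L[ℝ] ℝ} {U : Set M} (hθ : SmoothFormOn θ U)
    (hU : IsOpen U) {x : M} (hx : x ∈ U) {X : VF n M} (hX : DiffAt X x) :
    FDiffAt n (fun x ↦ θ x (X x)) x := by
  obtain ⟨W, E, hW, hxW, hE⟩ := exists_isFrame (n := n) x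
  have h : FDiffAt n (fun y ↦ ∑ i, hE.coeff i y (X y) * θ y (E i y)) x :=
    FDiffAt.sum fun i _ ↦ (hE.coeff_diffAt hW hxW hX i).mul
      (FSmoothOn.fdiffAt (hθ.smooth (hU.inter hW) Set.inter_subset_left
        ((hE.contMDiffOn i).mono Set.inter_subset_right)) (hU.inter hW) ⟨hx, hxW⟩)
  refine h.congr_of_eventuallyEq ?_
  filter_upwards [hW.mem_nhds hxW] with y hy
  conv_lhs => rw [← hE.sum_coeff hy (X y)]
  simp

section dForm

variable {θ : Π x : M, Tan n x →L[ℝ] ℝ} {U : Set M} {x : M}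

theorem dFormField_swap (X Y : VF n M) : dFormField θ X Y x = - dFormField θ Y X x := by
  simp only [dFormField]
  rw [bracket_swap X Y, map_neg]
  ring

theorem dFormField_tensorial_left (hθ : SmoothFormOn θ U) (hU : IsOpen U) (hx : x ∈ U)
    (Y : VF n M) :
    TensorialAt 𝓘(ℝ, Model n) (Model n) (fun X ↦ dFormField θ X Y x) x where
  smul {f X} hf hX := by
    simp only [dFormField, Pi.smul_apply', map_smul, smul_eq_mul]
    rw [mvfderiv_mul_apply hf (hθ.fdiffAt hU hx hX), bracket_smul_left hf hX]
    simp only [map_add, map_neg, map_smul, smul_eq_mul, neg_smul]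
    ring
  add {X X'} hX hX' := by
    simp only [dFormField, Pi.add_apply, map_add]
    rw [mvfderiv_add_apply (hθ.fdiffAt hU hx hX) (hθ.fdiffAt hU hx hX'), bracket_add_left hX hX',
      map_add]
    ring

theorem dFormField_tensorial_right (hθ : SmoothFormOn θ U) (hU : IsOpen U) (hx : x ∈ U)
    (X : VF n M) :
    TensorialAt 𝓘(ℝ, Model n) (Model n) (fun Y ↦ dFormField θ X Y x) x where
  smul {f Y} hf hY := by
    rw [dFormField_swap, (dFormField_tensorial_left hθ hU hx X).smul hf hY, dFormField_swap X]
    simp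
  add {Y Y'} hY hY' := by
    rw [dFormField_swap, (dFormField_tensorial_left hθ hU hx X).add hY hY', dFormField_swap X,
      dFormField_swap X Y']
    ring

/-- By tensoriality, the extensions of the two vectors chosen in `dForm` may be replaced by any
differentiable ones. -/
theorem dForm_eq (hθ : SmoothFormOn θ U) (hU : IsOpen U) (hx : x ∈ U) {X Y : VF n M}
    (hX : DiffAt X x) (hY : DiffAt Y x) : dForm θ x (X x) (Y x) = dFormField θ X Y x :=
  TensorialAt.pointwise₂ (Φ := fun X Y ↦ dFormField θ X Y x)
    (fun Y _ ↦ dFormField_tensorial_left hθ hU hx Y)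
    (fun X _ ↦ dFormField_tensorial_right hθ hU hx X)
    (diffAt_extend _) hX (diffAt_extend _) hY (by simp) (by simp)

theorem dForm_swap (v w : Tan n x) : dForm θ x v w = - dForm θ x w v := dFormField_swap _ _

theorem exists_dForm_eq (hθ : SmoothFormOn θ U) (hU : IsOpen U) (hx : x ∈ U) :
    ∃ B : Tan n x →ₗ[ℝ] Tan n x →ₗ[ℝ] ℝ, ∀ v w, dForm θ x v w = B v w := by
  let B := TensorialAt.mkHom₂ (fun X Y ↦ dFormField θ X Y x) x
    (fun Y _ ↦ dFormField_tensorial_left hθ hU hx Y)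
    (fun X _ ↦ dFormField_tensorial_right hθ hU hx X)
  exact ⟨LinearMap.mk₂ ℝ (fun v w ↦ B v w) (by simp) (by simp) (by simp) (by simp),
    fun v w ↦ rfl⟩

theorem dForm_smooth (hθ : SmoothFormOn θ U) (hU : IsOpen U) {V : Set M} (hV : IsOpen V)
    (hVU : V ⊆ U) {X Y : VF n M} (hX : SmoothOn X V) (hY : SmoothOn Y V) :
    FSmoothOn n (fun x ↦ dForm θ x (X x) (Y x)) V := by
  have h : FSmoothOn n (fun x ↦ dFormField θ X Y x) V :=
    ((FSmoothOn.mvfderiv hV (hθ.smooth hV hVU hY) hX).sub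
      (FSmoothOn.mvfderiv hV (hθ.smooth hV hVU hX) hY)).sub
      (hθ.smooth hV hVU (SmoothOn.bracket hV hX hY))
  exact h.congr fun x hx ↦ dForm_eq hθ hU (hVU hx) (hX.diffAt hV hx) (hY.diffAt hV hx)

/-- On vector fields in the kernel of `θ` one has `dθ(X, Y) = -θ([X, Y])`. -/
theorem dForm_eq_neg_bracket (hθ : SmoothFormOn θ U) (hU : IsOpen U) (hx : x ∈ U) {X Y : VF n M}
    (hX : DiffAt X x) (hY : DiffAt Y x) (hX0 : ∀ᶠ y in 𝓝 x, θ y (X y) = 0)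
    (hY0 : ∀ᶠ y in 𝓝 x, θ y (Y y) = 0) :
    dForm θ x (X x) (Y x) = - θ x (bracket X Y x) := by
  rw [dForm_eq hθ hU hx hX hY, dFormField, mvfderiv_eq_zero_of_eventually_const hX0,
    mvfderiv_eq_zero_of_eventually_const hY0]
  simp

end dForm

/-! ### Connections -/

section Connection

variable {ι : Type*} [Fintype ι]

/-- In a trivialization a linear map is the sum of the rank one maps determined by its values on a
basis, so smoothness can be tested on one frame. -/
theorem contMDiffAt_hom_of_frame {E : ι → VF n M} {V : Set M} (hE : IsFrame E V) (hV : IsOpen V)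
    {A : Π x : M, Tan n x →L[ℝ] Tan n x} (hA : ∀ i, SmoothOn (fun x ↦ A x (E i x)) V) {x : M}
    (hx : x ∈ V) :
    ContMDiffAt 𝓘(ℝ, Model n) (𝓘(ℝ, Model n).prod 𝓘(ℝ, Model n →L[ℝ] Model n)) ∞
      (fun y ↦ (⟨y, A y⟩ : Bundle.TotalSpace (Model n →L[ℝ] Model n)
        fun y : M ↦ TangentSpace 𝓘(ℝ, Model n) y →L[ℝ] TangentSpace 𝓘(ℝ, Model n) y)) x := by
  rw [contMDiffAt_hom_bundle]
  refine ⟨contMDiffAt_id, ?_⟩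
  let t := trivializationAt (Model n) (TangentSpace 𝓘(ℝ, Model n) : M → Type _) x
  have hxt : x ∈ t.baseSet := FiberBundle.mem_baseSet_trivializationAt _ _ x
  let b := (EuclideanSpace.basisFun (Fin (4 * n + 3)) ℝ).toBasis
  let Lc : Fin (4 * n + 3) → (Model n →L[ℝ] (Model n →L[ℝ] Model n)) := fun i ↦
    ContinuousLinearMap.smulRightL ℝ (Model n) (Model n) (LinearMap.toContinuousLinearMap (b.coord i))
  have hdec : ∀ T : Model n →L[ℝ] Model n, T = ∑ i, Lc i (T (b i)) := by
    intro T
    ext1 v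
    conv_lhs => rw [← b.sum_repr v]
    rw [map_sum]
    simp [Lc]
  have hV' : IsOpen (V ∩ t.baseSet) := hV.inter t.open_baseSet
  have hloc : ∀ i, SmoothOn (fun y ↦ A y (t.localFrame b i y)) (V ∩ t.baseSet) := by
    intro i
    have h1 : SmoothOn (t.localFrame b i) (V ∩ t.baseSet) :=
      SmoothOn.mono (t.contMDiffOn_localFrame_baseSet _ b i) Set.inter_subset_right
    refine SmoothOn.congr (SmoothOn.sum (s := Finset.univ) fun j _ ↦
      SmoothOn.smul (hE.coeff_smooth hV hV' Set.inter_subset_left h1 j)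
        ((hA j).mono Set.inter_subset_left)) fun y hy ↦ ?_
    conv_lhs => rw [← hE.sum_coeff hy.1 (t.localFrame b i y)]
    simp
  have hco : ∀ i, ContMDiffAt 𝓘(ℝ, Model n) 𝓘(ℝ, Model n) ∞
      (fun y ↦ (t ⟨y, A y (t.localFrame b i y)⟩).2) x := fun i ↦
    (t.contMDiffAt_section_iff hxt).1 (ContMDiffOn.contMDiffAt (hloc i) (hV'.mem_nhds ⟨hx, hxt⟩))
  have hsum : ContMDiffAt 𝓘(ℝ, Model n) 𝓘(ℝ, Model n →L[ℝ] Model n) ∞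
      (fun y ↦ ∑ i, Lc i (t ⟨y, A y (t.localFrame b i y)⟩).2) x :=
    contMDiffAt_finsetSum fun i _ ↦ (Lc i).contMDiff.contMDiffAt.comp x (hco i)
  refine hsum.congr_of_eventuallyEq ?_
  filter_upwards [t.open_baseSet.mem_nhds hxt] with y hy
  rw [hdec (ContinuousLinearMap.inCoordinates _ _ _ _ _ _ _ _ _)]
  refine Finset.sum_congr rfl fun i _ ↦ ?_
  rw [ContinuousLinearMap.inCoordinates_eq (hx := hy) (hy := hy),
    t.localFrame_apply_of_mem_baseSet b hy]
  rfl

/-- The connection with Christoffel symbols `Γ` with respect to a frame: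
`∇_{E_i} E_j = ∑_k Γ_{ij}^k E_k`. -/
def frameConnection {E : ι → VF n M} {V : Set M} (hE : IsFrame E V) (Γ : ι → ι → ι → M → ℝ) :
    ConnectionMap n M := fun Y x ↦
  ∑ k, (mvfderiv 𝓘(ℝ, Model n) (fun y ↦ hE.coeff k y (Y y)) x +
    ∑ i, ∑ j, (Γ i j k x * hE.coeff j x (Y x)) •
      LinearMap.toContinuousLinearMap (hE.coeff i x)).smulRight (E k x)

theorem frameConnection_apply {E : ι → VF n M} {V : Set M} (hE : IsFrame E V)
    (Γ : ι → ι → ι → M → ℝ) (Y : VF n M) (x : M) (w : Tan n x) :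
    frameConnection hE Γ Y x w = ∑ k, (mvfderiv 𝓘(ℝ, Model n) (fun y ↦ hE.coeff k y (Y y)) x w +
      ∑ i, ∑ j, Γ i j k x * hE.coeff j x (Y x) * hE.coeff i x w) • E k x := by
  simp [frameConnection]

theorem frameConnection_isCovariantDerivativeOn {E : ι → VF n M} {V : Set M} (hE : IsFrame E V)
    (hV : IsOpen V) (Γ : ι → ι → ι → M → ℝ) :
    IsCovariantDerivativeOn (Model n) (frameConnection hE Γ) V where
  add {Y Y' x} hY hY' hx := by
    ext1 w
    rw [add_apply]
    simp only [frameConnection_apply, Pi.add_apply, map_add]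
    rw [← Finset.sum_add_distrib]
    refine Finset.sum_congr rfl fun k _ ↦ ?_
    rw [mvfderiv_add_apply (hE.coeff_diffAt hV hx hY k) (hE.coeff_diffAt hV hx hY' k), ← add_smul]
    congr 1
    simp only [mul_add, add_mul, Finset.sum_add_distrib]
    ring
  leibniz {Y f x} hY hf hx := by
    ext1 w
    have hY1 : (ContinuousLinearMap.smulRight (mvfderiv 𝓘(ℝ, Model n) f x) (Y x)) w
        = ∑ k, (mvfderiv 𝓘(ℝ, Model n) f x w * hE.coeff k x (Y x)) • E k x := by
      conv_lhs => rw [← hE.sum_coeff hx (Y x)]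
      simp [Finset.smul_sum, smul_smul]
    rw [add_apply, hY1, smul_apply]
    simp only [frameConnection_apply, Pi.smul_apply', map_smul, smul_eq_mul]
    rw [Finset.smul_sum, ← Finset.sum_add_distrib]
    refine Finset.sum_congr rfl fun k _ ↦ ?_
    rw [mvfderiv_mul_apply hf (hE.coeff_diffAt hV hx hY k), smul_smul, ← add_smul]
    congr 1
    have : ∀ i j, Γ i j k x * (f x * hE.coeff j x (Y x)) * hE.coeff i x w
        = f x * (Γ i j k x * hE.coeff j x (Y x) * hE.coeff i x w) := fun i j ↦ by ring
    simp only [this, ← Finset.mul_sum]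
    ring

theorem frameConnection_smooth {E : ι → VF n M} {V W : Set M} (hE : IsFrame E V)
    (hV : IsOpen V) (hW : IsOpen W) (hWV : W ⊆ V) {Γ : ι → ι → ι → M → ℝ}
    (hΓ : ∀ i j k, FSmoothOn n (Γ i j k) V) :
    ContMDiffCovariantDerivativeOn (Model n) ∞ (frameConnection hE Γ) W where
  contMDiff {Y} hY := by
    intro x hx
    refine (contMDiffAt_hom_of_frame (hE.mono hWV) hW (A := fun x ↦ frameConnection hE Γ Y x)
      (fun i ↦ ?_) hx).contMDiffWithinAt
    simp only [frameConnection_apply]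
    have hY' : SmoothOn Y W := hY
    have hc : ∀ j, FSmoothOn n (fun y ↦ hE.coeff j y (Y y)) W := fun j ↦
      hE.coeff_smooth hV hW hWV hY' j
    have hEW : ∀ j, SmoothOn (E j) W := fun j ↦ SmoothOn.mono (hE.contMDiffOn j) hWV
    refine SmoothOn.sum fun k _ ↦ SmoothOn.smul (FSmoothOn.add
      (FSmoothOn.mvfderiv hW (hc k) (hEW i)) (FSmoothOn.sum fun p _ ↦
        FSmoothOn.sum fun q _ ↦ ?_)) (hEW k)
    exact (((hΓ p q k).mono hWV).mul (hc q)).mul (hE.coeff_smooth hV hW hWV (hEW i) p)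

theorem frameConnection_frame [DecidableEq ι] {E : ι → VF n M} {V : Set M} (hE : IsFrame E V)
    (hV : IsOpen V) (Γ : ι → ι → ι → M → ℝ) {x : M} (hx : x ∈ V) (i j : ι) :
    frameConnection hE Γ (E j) x (E i x) = ∑ k, Γ i j k x • E k x := by
  rw [frameConnection_apply]
  refine Finset.sum_congr rfl fun k _ ↦ ?_
  rw [mvfderiv_eq_zero_of_eventually_const (c := if j = k then 1 else 0)]
  · simp [hE.coeff_self hx]
  · filter_upwards [hV.mem_nhds hx] with y hy using hE.coeff_self hy k j

theorem IsCovariantDerivativeOn.sum_smul {D : ConnectionMap n M} {V : Set M}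
    (hD : IsCovariantDerivativeOn (Model n) D V) {x : M} (hx : x ∈ V) {f : ι → M → ℝ}
    {E : ι → VF n M} (hf : ∀ i, FDiffAt n (f i) x) (hE : ∀ i, DiffAt (E i) x) (w : Tan n x) :
    D (fun y ↦ ∑ i, f i y • E i y) x w
      = ∑ i, (f i x • D (E i) x w + mvfderiv 𝓘(ℝ, Model n) (f i) x w • E i x) := by
  classical
  have key : ∀ s : Finset ι, D (fun y ↦ ∑ i ∈ s, (f i • E i) y) x w
      = ∑ i ∈ s, (f i x • D (E i) x w + mvfderiv 𝓘(ℝ, Model n) (f i) x w • E i x) := by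
    intro s
    induction s using Finset.induction_on with
    | empty =>
      have := hD.zero hx
      simp only [Finset.sum_empty]
      exact congrArg (fun L : Tan n x →L[ℝ] Tan n x ↦ L w) this
    | insert a s ha ih =>
      simp only [Finset.sum_insert ha]
      rw [← ih, show (fun y ↦ (f a • E a) y + ∑ i ∈ s, (f i • E i) y)
        = (f a • E a) + (fun y ↦ ∑ i ∈ s, (f i • E i) y) from rfl,
        hD.add ((hE a).smul (hf a)) (DiffAt.sum fun i _ ↦ (hE i).smul (hf i)) hx,
        hD.leibniz (hE a) (hf a) hx]
      simp
  exact key Finset.univ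

/-- A covariant derivative expressed in a frame. -/
theorem connection_expand {D : ConnectionMap n M} {V : Set M}
    (hD : IsCovariantDerivativeOn (Model n) D V) {E : ι → VF n M} (hE : IsFrame E V)
    (hV : IsOpen V) {x : M} (hx : x ∈ V) {Y : VF n M} (hY : DiffAt Y x) (w : Tan n x) :
    D Y x w = ∑ j, (hE.coeff j x (Y x) • D (E j) x w
      + mvfderiv 𝓘(ℝ, Model n) (fun y ↦ hE.coeff j y (Y y)) x w • E j x) := by
  have hc := fun j ↦ hE.coeff_diffAt hV hx hY j
  have hEd := fun j ↦ hE.diffAt hV hx j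
  rw [← IsCovariantDerivativeOn.sum_smul hD hx hc hEd, hD.congr_of_eventuallyEq hY
    (DiffAt.sum fun i _ ↦ DiffAt.smul (hc i) (hEd i)) (hV.mem_nhds hx)
    (σ' := fun y ↦ ∑ j, hE.coeff j y (Y y) • E j y)]
  filter_upwards [hV.mem_nhds hx] with y hy using (hE.sum_coeff hy (Y y)).symm

/-- Two covariant derivatives that coincide on the vectors of a frame coincide. -/
theorem connection_eq_of_frame {D D' : ConnectionMap n M} {V : Set M}
    (hD : IsCovariantDerivativeOn (Model n) D V) (hD' : IsCovariantDerivativeOn (Model n) D' V)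
    {E : ι → VF n M} (hE : IsFrame E V) (hV : IsOpen V) {x : M} (hx : x ∈ V)
    (h : ∀ i j, D (E j) x (E i x) = D' (E j) x (E i x)) {Y : VF n M} (hY : DiffAt Y x) :
    D Y x = D' Y x := by
  ext1 w
  rw [connection_expand hD hE hV hx hY, connection_expand hD' hE hV hx hY]
  refine Finset.sum_congr rfl fun j _ ↦ ?_
  rw [← hE.sum_coeff hx w]
  simp only [map_sum, map_smul, h]

/-- The derivative of `f` produced by the Leibniz rule cancels the one produced by the bracket. -/
theorem torsion_tensorial_left {D : ConnectionMap n M} {V : Set M}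
    (hD : IsCovariantDerivativeOn (Model n) D V) {x : M} (hx : x ∈ V) (Y : VF n M) :
    TensorialAt 𝓘(ℝ, Model n) (Model n) (fun X ↦ torsion D X Y x) x where
  smul {f X} hf hX := by
    simp only [torsion, Pi.smul_apply']
    rw [bracket_smul_left hf hX, hD.leibniz hX hf hx]
    simp
    module
  add {X X'} hX hX' := by
    simp only [torsion, Pi.add_apply]
    rw [bracket_add_left hX hX', hD.add hX hX' hx]
    simp
    module

theorem torsion_tensorial_right {D : ConnectionMap n M} {V : Set M}
    (hD : IsCovariantDerivativeOn (Model n) D V) {x : M} (hx : x ∈ V) (X : VF n M) :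
    TensorialAt 𝓘(ℝ, Model n) (Model n) (fun Y ↦ torsion D X Y x) x where
  smul {f Y} hf hY := by
    simp only [torsion, Pi.smul_apply']
    rw [bracket_smul_right hf hY, hD.leibniz hY hf hx]
    simp
    module
  add {Y Y'} hY hY' := by
    simp only [torsion, Pi.add_apply]
    rw [bracket_add_right hY hY', hD.add hY hY' hx]
    simp
    module

theorem torsion_expand {D : ConnectionMap n M} {V : Set M}
    (hD : IsCovariantDerivativeOn (Model n) D V) {E : ι → VF n M} (hE : IsFrame E V)
    (hV : IsOpen V) {x : M} (hx : x ∈ V) {X Y : VF n M} (hX : DiffAt X x) (hY : DiffAt Y x) :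
    torsion D X Y x = ∑ i, ∑ j, (hE.coeff i x (X x) * hE.coeff j x (Y x)) •
      torsion D (E i) (E j) x :=
  tensorial_expand (Φ := fun X Y ↦ torsion D X Y x)
    (fun _ _ ↦ torsion_tensorial_left hD hx _) (fun _ _ ↦ torsion_tensorial_right hD hx _)
    hE hV hx hX hY

end Connection

end Calculus

/-! ### Pointwise algebra of a hyper pseudohermitian structure. -/

section Structure

variable {n : ℕ} {M : Type*} [TopologicalSpace M] [ChartedSpace (Model n) M]
  [IsManifold 𝓘(ℝ, Model n) ∞ M]

/-- A hyper pseudohermitian structure with positive definite Levi form on the open set `U`. -/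
structure IsPseudohermitian (U : Set M) (H : Triple n M) (θ : Fin 3 → Π x : M, Tan n x →L[ℝ] ℝ) :
    Prop where
  isOpen : IsOpen U
  hyper : IsHyperCR U H
  compatible : IsCompatible U H θ
  pos : ∀ x ∈ U, ∀ v ∈ H.core x, v ≠ 0 → 0 < levi H θ x v v

/-- `T` is an admissible triple of vector fields on `V` with `θ_a(T_b) = δ_{ab}`. -/
structure IsNormalizedTriple (V : Set M) (H : Triple n M)
    (θ : Fin 3 → Π x : M, Tan n x →L[ℝ] ℝ) (T : Fin 3 → VF n M) : Prop where
  smooth : ∀ a, SmoothOn (T a) V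
  dual : ∀ x ∈ V, ∀ a b, θ a x (T b x) = if a = b then 1 else 0
  act : ∀ x ∈ V, ∀ a, H.J a x (T (a + 1) x) = T (a + 2) x

theorem exists_smooth_extension {x : M} (v : Tan n x) :
    ∃ (V : Set M) (X : VF n M), IsOpen V ∧ x ∈ V ∧ SmoothOn X V ∧ X x = v := by
  obtain ⟨V, E, hV, hx, hE⟩ := exists_isFrame (n := n) x
  refine ⟨V, fun y ↦ ∑ i, hE.coeff i x v • E i y, hV, hx, ?_, hE.sum_coeff hx v⟩
  exact SmoothOn.sum fun i _ ↦ SmoothOn.smul (FSmoothOn.const _) (hE.contMDiffOn i)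

theorem IsSection.mono {P : Π x : M, Submodule ℝ (Tan n x)} {X : VF n M} {V W : Set M}
    (h : IsSection P X V) (hW : W ⊆ V) : IsSection P X W :=
  ⟨h.1.mono hW, fun x hx ↦ h.2 x (hW hx)⟩

theorem IsSection.sub {P : Π x : M, Submodule ℝ (Tan n x)} {X Y : VF n M} {V : Set M}
    (hX : IsSection P X V) (hY : IsSection P Y V) : IsSection P (fun x ↦ X x - Y x) V :=
  ⟨hX.1.sub hY.1, fun x hx ↦ (P x).sub_mem (hX.2 x hx) (hY.2 x hx)⟩

theorem IsSection.smul {P : Π x : M, Submodule ℝ (Tan n x)} {X : VF n M} {f : M → ℝ} {V : Set M}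
    (hf : FSmoothOn n f V) (hX : IsSection P X V) : IsSection P (fun x ↦ f x • X x) V :=
  ⟨SmoothOn.smul hf hX.1, fun x hx ↦ (P x).smul_mem _ (hX.2 x hx)⟩

theorem IsSection.sum {P : Π x : M, Submodule ℝ (Tan n x)} {ι : Type*} {s : Finset ι}
    {X : ι → VF n M} {V : Set M} (hX : ∀ i ∈ s, IsSection P (X i) V) :
    IsSection P (fun x ↦ ∑ i ∈ s, X i x) V :=
  ⟨SmoothOn.sum fun i hi ↦ (hX i hi).1, fun x hx ↦ (P x).sum_mem fun i hi ↦ (hX i hi).2 x hx⟩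

namespace IsPseudohermitian

variable {U : Set M} {H : Triple n M} {θ : Fin 3 → Π x : M, Tan n x →L[ℝ] ℝ}
  (h : IsPseudohermitian U H θ) {x : M}

include h

theorem mono {V : Set M} (hV : IsOpen V) (hVU : V ⊆ U) : IsPseudohermitian V H θ := by
  have hcr : ∀ {Q : Π x : M, Submodule ℝ (Tan n x)} {J : Π x : M, Tan n x →ₗ[ℝ] Tan n x},
      IsAlmostCR U Q J → IsAlmostCR V Q J := fun {Q J} h ↦
    { subbundle := fun x hx ↦ by
        obtain ⟨W, hW, hxW, hWU, X, hX, hX'⟩ := h.subbundle x (hVU hx)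
        exact ⟨W ∩ V, hW.inter hV, ⟨hxW, hx⟩, Set.inter_subset_right, X,
          fun i ↦ (hX i).mono Set.inter_subset_left, fun y hy ↦ hX' y hy.1⟩
      maps := fun x hx ↦ h.maps x (hVU hx)
      sq := fun x hx ↦ h.sq x (hVU hx)
      smooth := fun W hW hWV ↦ h.smooth W hW (hWV.trans hVU) }
  exact
  { isOpen := hV
    hyper :=
      { first := hcr h.hyper.first
        second := hcr h.hyper.second
        transversal := fun x hx ↦ h.hyper.transversal x (hVU hx)
        anticomm := fun x hx ↦ h.hyper.anticomm x (hVU hx)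
        third_Q := fun x hx ↦ h.hyper.third_Q x (hVU hx)
        third_J_left := fun x hx ↦ h.hyper.third_J_left x (hVU hx)
        third_J_right := fun x hx ↦ h.hyper.third_J_right x (hVU hx)
        integrable₁ := fun W hW hWV ↦ h.hyper.integrable₁ W hW (hWV.trans hVU)
        integrable₂ := fun W hW hWV ↦ h.hyper.integrable₂ W hW (hWV.trans hVU) }
    compatible :=
      { smooth := fun a W hW hWV ↦ h.compatible.smooth a W hW (hWV.trans hVU)
        ker := fun x hx ↦ h.compatible.ker x (hVU hx)
        comp := fun x hx ↦ h.compatible.comp x (hVU hx) }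
    pos := fun x hx ↦ h.pos x (hVU hx) }

/-! #### Algebra on the core -/

theorem mem_Q_iff (hx : x ∈ U) {a : Fin 3} {v : Tan n x} : v ∈ H.Q a x ↔ θ a x v = 0 :=
  (h.compatible.ker x hx a v).symm

theorem mem_core_iff (hx : x ∈ U) {v : Tan n x} : v ∈ H.core x ↔ ∀ a, θ a x v = 0 := by
  simp [Triple.core, h.mem_Q_iff hx]

theorem theta_core (hx : x ∈ U) {v : Tan n x} (hv : v ∈ H.core x) (a : Fin 3) : θ a x v = 0 :=
  (h.mem_core_iff hx).1 hv a

theorem core_le (hx : x ∈ U) {v : Tan n x} (hv : v ∈ H.core x) (a : Fin 3) : v ∈ H.Q a x :=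
  (h.mem_Q_iff hx).2 (h.theta_core hx hv a)

/-- The identity `θ_2 ∘ I_0 = θ_1` on `Q_0`, applied to `v` and to `I_0 v`, controls the two
components of `θ(I_0 v)` other than `θ_0`. -/
theorem J0_mem (hx : x ∈ U) {v : Tan n x} (hv : v ∈ H.core x) : H.J 0 x v ∈ H.core x := by
  have hv' := fun a ↦ h.theta_core hx hv a
  have h0 : H.J 0 x v ∈ H.Q 0 x := h.hyper.first.maps x hx v (h.core_le hx hv 0)
  have h1 := h.compatible.comp x hx 0 v (h.core_le hx hv 0)
  have h2 := h.compatible.comp x hx 0 _ h0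
  rw [h.hyper.first.sq x hx v (h.core_le hx hv 0), map_neg] at h2
  rw [h.mem_core_iff hx]
  intro a
  fin_cases a
  · exact (h.mem_Q_iff hx).1 h0
  · exact h2.symm.trans (by simp [hv'])
  · exact h1.trans (hv' 1)

theorem J1_mem (hx : x ∈ U) {v : Tan n x} (hv : v ∈ H.core x) : H.J 1 x v ∈ H.core x := by
  have hv' := fun a ↦ h.theta_core hx hv a
  have h0 : H.J 1 x v ∈ H.Q 1 x := h.hyper.second.maps x hx v (h.core_le hx hv 1)
  have h1 := h.compatible.comp x hx 1 v (h.core_le hx hv 1)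
  have h2 := h.compatible.comp x hx 1 _ h0
  rw [h.hyper.second.sq x hx v (h.core_le hx hv 1), map_neg] at h2
  rw [h.mem_core_iff hx]
  intro a
  fin_cases a
  · exact h1.trans (hv' 2)
  · exact (h.mem_Q_iff hx).1 h0
  · exact h2.symm.trans (by simp [hv'])

theorem J00 (hx : x ∈ U) {v : Tan n x} (hv : v ∈ H.core x) : H.J 0 x (H.J 0 x v) = -v :=
  h.hyper.first.sq x hx v (h.core_le hx hv 0)

theorem J11 (hx : x ∈ U) {v : Tan n x} (hv : v ∈ H.core x) : H.J 1 x (H.J 1 x v) = -v :=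
  h.hyper.second.sq x hx v (h.core_le hx hv 1)

theorem core_le_inf (hx : x ∈ U) : H.core x ≤ H.Q 0 x ⊓ H.Q 1 x :=
  fun _ hv ↦ ⟨h.core_le hx hv 0, h.core_le hx hv 1⟩

/-- On the core `v = I_0(-I_0 v)`, so the clause defining `I_2` on `I_0(Q_0 ∩ Q_1)` applies to every
core vector. -/
theorem J10 (hx : x ∈ U) {v : Tan n x} (hv : v ∈ H.core x) :
    H.J 1 x (H.J 0 x v) = -H.J 2 x v := by
  have h1 := h.hyper.third_J_left x hx v ⟨-H.J 0 x v,
    Submodule.neg_mem _ (h.core_le_inf hx (h.J0_mem hx hv)), by simp [h.J00 hx hv]⟩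
  rw [h1, neg_neg]

theorem J01 (hx : x ∈ U) {v : Tan n x} (hv : v ∈ H.core x) :
    H.J 0 x (H.J 1 x v) = H.J 2 x v :=
  (h.hyper.third_J_right x hx v ⟨-H.J 1 x v,
    Submodule.neg_mem _ (h.core_le_inf hx (h.J1_mem hx hv)), by simp [h.J11 hx hv]⟩).symm

theorem J_mem (hx : x ∈ U) {v : Tan n x} (hv : v ∈ H.core x) (a : Fin 3) :
    H.J a x v ∈ H.core x := by
  fin_cases a
  · exact h.J0_mem hx hv
  · exact h.J1_mem hx hv
  · change H.J 2 x v ∈ _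
    rw [← h.J01 hx hv]
    exact h.J0_mem hx (h.J1_mem hx hv)

theorem J12 (hx : x ∈ U) {v : Tan n x} (hv : v ∈ H.core x) :
    H.J 1 x (H.J 2 x v) = H.J 0 x v := by
  have := h.J10 hx (h.J1_mem hx hv)
  rw [h.J01 hx hv, ← h.J01 hx (h.J1_mem hx hv), h.J11 hx hv] at this
  simpa using this

theorem J02 (hx : x ∈ U) {v : Tan n x} (hv : v ∈ H.core x) :
    H.J 0 x (H.J 2 x v) = -H.J 1 x v := by
  rw [← h.J01 hx hv, h.J00 hx (h.J1_mem hx hv)]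

theorem J20 (hx : x ∈ U) {v : Tan n x} (hv : v ∈ H.core x) :
    H.J 2 x (H.J 0 x v) = H.J 1 x v := by
  rw [← h.J01 hx (h.J0_mem hx hv), h.J10 hx hv, map_neg, h.J02 hx hv, neg_neg]

theorem J21 (hx : x ∈ U) {v : Tan n x} (hv : v ∈ H.core x) :
    H.J 2 x (H.J 1 x v) = -H.J 0 x v := by
  rw [← h.J01 hx (h.J1_mem hx hv), h.J11 hx hv, map_neg]

theorem J22 (hx : x ∈ U) {v : Tan n x} (hv : v ∈ H.core x) :
    H.J 2 x (H.J 2 x v) = -v := by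
  rw [← h.J01 hx (h.J_mem hx hv 2), h.J12 hx hv, h.J00 hx hv]

theorem J_sq (hx : x ∈ U) {v : Tan n x} (hv : v ∈ H.core x) (a : Fin 3) :
    H.J a x (H.J a x v) = -v := by
  fin_cases a
  exacts [h.J00 hx hv, h.J11 hx hv, h.J22 hx hv]

theorem J_succ (hx : x ∈ U) {v : Tan n x} (hv : v ∈ H.core x) (a : Fin 3) :
    H.J a x (H.J (a + 1) x v) = H.J (a + 2) x v := by
  fin_cases a
  exacts [h.J01 hx hv, h.J12 hx hv, h.J20 hx hv]

theorem act_section {V : Set M} (hV : IsOpen V) (hVU : V ⊆ U) {X : VF n M}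
    (hX : IsSection H.core X V) (a : Fin 3) : IsSection H.core (H.act a X) V := by
  have h0 : ∀ Y : VF n M, IsSection H.core Y V → IsSection H.core (H.act 0 Y) V := fun Y hY ↦
    ⟨h.hyper.first.smooth V hV hVU Y ⟨hY.1, fun x hx ↦ h.core_le (hVU hx) (hY.2 x hx) 0⟩,
      fun x hx ↦ h.J0_mem (hVU hx) (hY.2 x hx)⟩
  have h1 : ∀ Y : VF n M, IsSection H.core Y V → IsSection H.core (H.act 1 Y) V := fun Y hY ↦
    ⟨h.hyper.second.smooth V hV hVU Y ⟨hY.1, fun x hx ↦ h.core_le (hVU hx) (hY.2 x hx) 1⟩,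
      fun x hx ↦ h.J1_mem (hVU hx) (hY.2 x hx)⟩
  fin_cases a
  · exact h0 X hX
  · exact h1 X hX
  · have h2 := h0 _ (h1 X hX)
    refine ⟨h2.1.congr fun x hx ↦ (h.J01 (hVU hx) (hX.2 x hx)).symm,
      fun x hx ↦ h.J_mem (hVU hx) (hX.2 x hx) 2⟩

/-! #### Admissible triples -/

/-- Transversality provides `v` in `Q_0` outside `Q_1`. On `Q_0` the map `I_0` acts on the pair
`(θ_1, θ_2)` as a quarter turn, so `v` and `I_0 v` reach every value of this pair. -/
theorem exists_theta_two (hx : x ∈ U) :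
    ∃ u : Tan n x, θ 0 x u = 0 ∧ θ 1 x u = 0 ∧ θ 2 x u = 1 := by
  have hQ1 : H.Q 1 x ≠ ⊤ := by
    obtain ⟨W, -, hxW, -, X, -, hX⟩ := h.hyper.second.subbundle x hx
    intro htop
    have h1 := (hX x hxW).2
    have h2 := finrank_range_le_card (R := ℝ) (fun i ↦ X i x)
    rw [Set.finrank, h1, htop, finrank_top, finrank_tan] at h2
    simp at h2
  obtain ⟨v, hv0, hv1⟩ : ∃ v : Tan n x, θ 0 x v = 0 ∧ θ 1 x v ≠ 0 := by
    by_contra! hc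
    have : H.Q 0 x ≤ H.Q 1 x := fun v hv ↦
      (h.mem_Q_iff hx).2 (hc v ((h.mem_Q_iff hx).1 hv))
    exact hQ1 (by rw [← h.hyper.transversal x hx, sup_eq_right.2 this])
  have hvQ : v ∈ H.Q 0 x := (h.mem_Q_iff hx).2 hv0
  have h0 : H.J 0 x v ∈ H.Q 0 x := h.hyper.first.maps x hx v hvQ
  have h1 : θ 2 x (H.J 0 x v) = θ 1 x v := h.compatible.comp x hx 0 v hvQ
  have h2 : θ 2 x (H.J 0 x (H.J 0 x v)) = θ 1 x (H.J 0 x v) := h.compatible.comp x hx 0 _ h0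
  rw [h.hyper.first.sq x hx v hvQ, map_neg] at h2
  have h3 : θ 0 x (H.J 0 x v) = 0 := (h.mem_Q_iff hx).1 h0
  have hne : θ 1 x v ^ 2 + θ 2 x v ^ 2 ≠ 0 := by positivity
  -- The pairs `(θ_1, θ_2)` of `I_0 v` and `v` are `(-θ_2 v, θ_1 v)` and `(θ_1 v, θ_2 v)`; this
  -- combination solves for `(0, 1)`.
  refine ⟨(θ 1 x v ^ 2 + θ 2 x v ^ 2)⁻¹ • (θ 1 x v • H.J 0 x v + θ 2 x v • v), ?_, ?_, ?_⟩
  · simp [h3, hv0]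
  · simp [← h2]; ring
  · simp only [map_smul, map_add, h1, smul_eq_mul]
    field_simp

/-- One field `Z` with `θ(Z) = (0, 0, 1)` generates the whole triple `(I_1 Z, -I_0 Z, Z)`, so only
`Z` has to be constructed smoothly. -/
theorem exists_normalized (hx : x ∈ U) :
    ∃ (V : Set M) (T : Fin 3 → VF n M), IsOpen V ∧ x ∈ V ∧ V ⊆ U ∧
      IsNormalizedTriple V H θ T := by
  obtain ⟨u, hu0, hu1, hu2⟩ := h.exists_theta_two hx
  have key : ∀ y ∈ U, ∀ w : Tan n y, θ 0 y w = 0 → θ 1 y w = 0 → θ 2 y w = 1 →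
      (∀ a b, θ a y ((![H.J 1 y w, - H.J 0 y w, w] : Fin 3 → Tan n y) b) = if a = b then 1 else 0) ∧
      ∀ a, H.J a y ((![H.J 1 y w, - H.J 0 y w, w] : Fin 3 → Tan n y) (a + 1))
        = (![H.J 1 y w, - H.J 0 y w, w] : Fin 3 → Tan n y) (a + 2) := by
    intro y hy w hw0 hw1 hw2
    have hwQ0 : w ∈ H.Q 0 y := (h.mem_Q_iff hy).2 hw0
    have hwQ1 : w ∈ H.Q 1 y := (h.mem_Q_iff hy).2 hw1
    have m0 := h.hyper.first.maps y hy w hwQ0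
    have m1 := h.hyper.second.maps y hy w hwQ1
    have s0 := h.hyper.first.sq y hy w hwQ0
    have s1 := h.hyper.second.sq y hy w hwQ1
    have c0 : θ 2 y (H.J 0 y w) = θ 1 y w := h.compatible.comp y hy 0 w hwQ0
    have c0' : θ 2 y (H.J 0 y (H.J 0 y w)) = θ 1 y (H.J 0 y w) := h.compatible.comp y hy 0 _ m0
    have c1 : θ 0 y (H.J 1 y w) = θ 2 y w := h.compatible.comp y hy 1 w hwQ1
    have c1' : θ 0 y (H.J 1 y (H.J 1 y w)) = θ 2 y (H.J 1 y w) := h.compatible.comp y hy 1 _ m1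
    rw [s0, map_neg, hw2] at c0'
    rw [s1, map_neg, hw0] at c1'
    have d0 := (h.mem_Q_iff hy).1 m0
    have d1 := (h.mem_Q_iff hy).1 m1
    have j2 : H.J 2 y (H.J 1 y w) = H.J 0 y (H.J 1 y (H.J 1 y w)) :=
      h.hyper.third_J_right y hy _ ⟨w, ⟨hwQ0, hwQ1⟩, rfl⟩
    rw [s1, map_neg] at j2
    constructor
    · intro a b
      fin_cases a <;> fin_cases b <;> simp [c0, ← c0', c1, ← c1', d0, d1, hw0, hw1, hw2]
    · intro a
      fin_cases a
      · change H.J 0 y (- H.J 0 y w) = w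
        rw [map_neg, s0, neg_neg]
      · rfl
      · exact j2
  obtain ⟨hdual, -⟩ := key x hx u hu0 hu1 hu2
  choose V' X hV' hxV' hX hXx using fun b ↦ exists_smooth_extension
    ((![H.J 1 x u, - H.J 0 x u, u] : Fin 3 → Tan n x) b)
  have hWo : IsOpen (U ∩ ⋂ b, V' b) := h.isOpen.inter (isOpen_iInter_of_finite hV')
  have hX' : ∀ b, SmoothOn (X b) (U ∩ ⋂ b, V' b) := fun b ↦ (hX b).mono fun y hy ↦
    Set.mem_iInter.1 hy.2 b
  let A : M → Matrix (Fin 3) (Fin 3) ℝ := fun y ↦ Matrix.of fun a b ↦ θ a y (X b y)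
  have hA : ∀ a b, FSmoothOn n (fun y ↦ A y a b) (U ∩ ⋂ b, V' b) := fun a b ↦
    (h.compatible.smooth a).smooth hWo Set.inter_subset_left (hX' b)
  have hAx : A x = 1 := by
    ext a b
    simp only [A, Matrix.of_apply, hXx, hdual, Matrix.one_apply]
  have hxW : x ∈ U ∩ ⋂ b, V' b := ⟨hx, Set.mem_iInter.2 hxV'⟩
  obtain ⟨V, hV, hVo, hxV, hdet⟩ : ∃ V ⊆ U ∩ ⋂ b, V' b, IsOpen V ∧ x ∈ V ∧
      ∀ y ∈ V, (A y).det ≠ 0 := by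
    have hc := (continuousOn_det hA).continuousAt (hWo.mem_nhds hxW)
    have h1 : ∀ᶠ y in 𝓝 x, (A y).det ≠ 0 := hc.eventually_ne (by simp [hAx])
    obtain ⟨V, hV1, hV2, hV3⟩ := mem_nhds_iff.1 (Filter.inter_mem h1 (hWo.mem_nhds hxW))
    exact ⟨V, fun y hy ↦ (hV1 hy).2, hV2, hV3, fun y hy ↦ (hV1 hy).1⟩
  have hVU : V ⊆ U := fun y hy ↦ (hV hy).1
  -- The last column of `A⁻¹` gives the combination of the `X_c` with `θ_a(Z) = δ_{a2}`.
  let Z : VF n M := fun y ↦ ∑ c, (A y)⁻¹ c 2 • X c y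
  have hZ : SmoothOn Z V := SmoothOn.sum fun c _ ↦ SmoothOn.smul
    (FSmoothOn.matrix_inv (fun a b ↦ (hA a b).mono hV) hdet c 2) ((hX' c).mono hV)
  have hθZ : ∀ y ∈ V, ∀ a, θ a y (Z y) = if a = 2 then 1 else 0 := by
    intro y hy a
    have := congrFun (congrFun (Matrix.mul_nonsing_inv (A y) (hdet y hy).isUnit) a) 2
    rw [Matrix.mul_apply, Matrix.one_apply] at this
    rw [← this]
    simp [Z, A, mul_comm]
  have hkey := fun y hy ↦ key y (hVU hy) (Z y) (by simp [hθZ y hy]) (by simp [hθZ y hy])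
    (by simp [hθZ y hy])
  refine ⟨V, ![fun y ↦ H.J 1 y (Z y), fun y ↦ - H.J 0 y (Z y), Z], hVo, hxV, hVU, ?_, ?_, ?_⟩
  · intro a
    fin_cases a
    · exact h.hyper.second.smooth V hVo hVU Z ⟨hZ, fun y hy ↦
        (h.mem_Q_iff (hVU hy)).2 (by simp [hθZ y hy])⟩
    · exact (h.hyper.first.smooth V hVo hVU Z ⟨hZ, fun y hy ↦
        (h.mem_Q_iff (hVU hy)).2 (by simp [hθZ y hy])⟩).neg
    · exact hZ
  · intro y hy a b
    rw [← (hkey y hy).1 a b]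
    fin_cases b <;> rfl
  · intro y hy a
    have := (hkey y hy).2 a
    fin_cases a <;> exact this

end IsPseudohermitian

namespace IsNormalizedTriple

variable {U V : Set M} {H : Triple n M} {θ : Fin 3 → Π x : M, Tan n x →L[ℝ] ℝ}
  {T : Fin 3 → VF n M} {x : M}

theorem mono {W : Set M} (hT : IsNormalizedTriple V H θ T) (hW : W ⊆ V) :
    IsNormalizedTriple W H θ T where
  smooth a := (hT.smooth a).mono hW
  dual x hx := hT.dual x (hW hx)
  act x hx := hT.act x (hW hx)

theorem admissible (hT : IsNormalizedTriple V H θ T) (h : IsPseudohermitian U H θ)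
    (hVU : V ⊆ U) : IsAdmissibleTriple V H T := by
  refine ⟨hT.smooth, fun x hx a ↦ ⟨fun hc ↦ ?_, ?_, ?_, hT.act x hx a⟩⟩
  · have := h.theta_core (hVU hx) hc a
    simp [hT.dual x hx] at this
  · rw [h.mem_Q_iff (hVU hx), hT.dual x hx]
    simp
  · rw [h.mem_Q_iff (hVU hx), hT.dual x hx]
    simp

theorem sub_mem_core (hT : IsNormalizedTriple V H θ T) (h : IsPseudohermitian U H θ)
    (hVU : V ⊆ U) (hx : x ∈ V) (v : Tan n x) : v - ∑ a, θ a x v • T a x ∈ H.core x := by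
  rw [h.mem_core_iff (hVU hx)]
  intro a
  simp [hT.dual x hx]

end IsNormalizedTriple

namespace IsPseudohermitian

variable {U : Set M} {H : Triple n M} {θ : Fin 3 → Π x : M, Tan n x →L[ℝ] ℝ}
  (h : IsPseudohermitian U H θ) {x : M}

include h

/-- The values of a compatible form on an admissible triple of vectors. -/
theorem theta_admissible (hx : x ∈ U) {t : Fin 3 → Tan n x} (ht : H.IsAdmissibleAt x t) :
    θ 0 x (t 0) ≠ 0 ∧ ∀ a b, θ a x (t b) = if a = b then θ 0 x (t 0) else 0 := by
  have h1 : ∀ a, θ (a + 1) x (t a) = 0 := fun a ↦ (h.mem_Q_iff hx).1 (ht a).2.1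
  have h2 : ∀ a, θ (a + 2) x (t a) = 0 := fun a ↦ (h.mem_Q_iff hx).1 (ht a).2.2.1
  have h3 : ∀ a : Fin 3, θ (a + 2) x (t (a + 2)) = θ (a + 1) x (t (a + 1)) := by
    intro a
    rw [← (ht a).2.2.2]
    refine h.compatible.comp x hx a _ ((h.mem_Q_iff hx).2 ?_)
    have := h2 (a + 1)
    rwa [show a + 1 + 2 = a by fin_cases a <;> rfl] at this
  have e2 : θ 2 x (t 2) = θ 0 x (t 0) := (h3 1).symm
  have e1 : θ 1 x (t 1) = θ 0 x (t 0) := (h3 0).symm.trans e2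
  have hall : ∀ a b, θ a x (t b) = if a = b then θ 0 x (t 0) else 0 := by
    intro a b
    fin_cases a <;> fin_cases b
    exacts [rfl, h2 1, h1 2, h1 0, e1, h2 2, h2 0, h1 1, e2]
  refine ⟨fun h0 ↦ (ht 0).1 ((h.mem_core_iff hx).2 fun a ↦ ?_), hall⟩
  rw [hall, h0, ite_self]

/-- By `theta_admissible` the matrix `θ_a(T_b)` is a nowhere vanishing multiple of the identity, and
dividing by this factor does not affect the span. -/
theorem exists_normalized_of_admissible {V : Set M} (hV : IsOpen V) (hVU : V ⊆ U)
    {P : Π x : M, Submodule ℝ (Tan n x)} (hP : IsAdmissiblePlaneField V H P) :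
    ∃ T, IsNormalizedTriple V H θ T ∧
      ∀ x ∈ V, P x = Submodule.span ℝ (Set.range fun a ↦ T a x) := by
  obtain ⟨T, ⟨hTs, hT⟩, hP⟩ := hP
  have hf : FSmoothOn n (fun x ↦ θ 0 x (T 0 x)) V :=
    (h.compatible.smooth 0).smooth hV hVU (hTs 0)
  have h0 := fun x hx ↦ (h.theta_admissible (hVU hx) (hT x hx)).1
  have h1 := fun x hx ↦ (h.theta_admissible (hVU hx) (hT x hx)).2
  refine ⟨fun a x ↦ (θ 0 x (T 0 x))⁻¹ • T a x, ⟨fun a ↦ SmoothOn.smul (hf.inv h0) (hTs a), ?_, ?_⟩,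
    fun x hx ↦ ?_⟩
  · intro x hx a b
    rw [map_smul, h1 x hx a b, smul_eq_mul, mul_ite, mul_zero, inv_mul_cancel₀ (h0 x hx)]
  · intro x hx a
    rw [map_smul, (hT x hx a).2.2.2]
  · rw [hP x hx]
    apply le_antisymm <;> rw [Submodule.span_le] <;> rintro _ ⟨a, rfl⟩
    · have : T a x = θ 0 x (T 0 x) • (θ 0 x (T 0 x))⁻¹ • T a x := by
        rw [smul_inv_smul₀ (h0 x hx)]
      change T a x ∈ _
      rw [this]
      exact Submodule.smul_mem _ _ (Submodule.subset_span ⟨a, rfl⟩)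
    · exact Submodule.smul_mem _ _ (Submodule.subset_span ⟨a, rfl⟩)

/-- An arbitrary smooth extension is projected to the core along a normalized triple. -/
theorem exists_core_section (hx : x ∈ U) {v : Tan n x} (hv : v ∈ H.core x) :
    ∃ (V : Set M) (X : VF n M), IsOpen V ∧ x ∈ V ∧ V ⊆ U ∧ IsSection H.core X V ∧ X x = v := by
  obtain ⟨V, T, hV, hxV, hVU, hT⟩ := h.exists_normalized hx
  obtain ⟨W, X, hW, hxW, hX, hXx⟩ := exists_smooth_extension v
  have hVW := hV.inter hW
  refine ⟨V ∩ W, fun y ↦ X y - ∑ a, θ a y (X y) • T a y, hVW, ⟨hxV, hxW⟩,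
    fun y hy ↦ hVU hy.1, ⟨?_, fun y hy ↦ hT.sub_mem_core h hVU hy.1 _⟩, ?_⟩
  · have hX' := hX.mono (Set.inter_subset_right (s := V))
    exact hX'.sub (SmoothOn.sum fun a _ ↦ SmoothOn.smul ((h.compatible.smooth a).smooth hVW
      (fun y hy ↦ hVU hy.1) hX') ((hT.smooth a).mono Set.inter_subset_left))
  · simp [hXx, h.theta_core hx hv]

/-! #### The Levi form -/

/-- On core sections `dθ_a(X, Y) = -θ_a([X, Y])`, and the first integrability condition puts `[X, Y]
- [I_a X, I_a Y]` into `ker θ_a`. -/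
theorem dForm_J (hx : x ∈ U) {v w : Tan n x} (hv : v ∈ H.core x) (hw : w ∈ H.core x)
    (a : Fin 3) : dForm (θ a) x (H.J a x v) (H.J a x w) = dForm (θ a) x v w := by
  obtain ⟨V, X, hV, hxV, hVU, hX, rfl⟩ := h.exists_core_section hx hv
  obtain ⟨W, Y, hW, hxW, hWU, hY, rfl⟩ := h.exists_core_section hx hw
  have hVW := hV.inter hW
  have hVWU : V ∩ W ⊆ U := fun y hy ↦ hVU hy.1
  have hX := hX.mono (Set.inter_subset_left (t := W))
  have hY := hY.mono (Set.inter_subset_right (s := V))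
  have hxVW : x ∈ V ∩ W := ⟨hxV, hxW⟩
  have e : ∀ {X Y : VF n M}, IsSection H.core X (V ∩ W) → IsSection H.core Y (V ∩ W) →
      dForm (θ a) x (X x) (Y x) = - θ a x (bracket X Y x) := fun hX hY ↦
    dForm_eq_neg_bracket (h.compatible.smooth a) h.isOpen hx (hX.1.diffAt hVW hxVW)
      (hY.1.diffAt hVW hxVW)
      (Filter.eventually_of_mem (hVW.mem_nhds hxVW) fun y hy ↦ h.theta_core (hVWU hy) (hX.2 y hy) a)
      (Filter.eventually_of_mem (hVW.mem_nhds hxVW) fun y hy ↦ h.theta_core (hVWU hy) (hY.2 y hy) a)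
  have h1 := e hX hY
  have h2 := e (h.act_section hVW hVWU hX a) (h.act_section hVW hVWU hY a)
  have h3 := (h.mem_Q_iff hx).1 (h.hyper.integrable₁ _ hVW hVWU X Y hX hY a x hxVW)
  rw [map_sub] at h3
  simp only [Triple.act] at h2 h3
  rw [h1, h2]
  linarith

/-- The relation between `dθ_b` and `dθ_c` coming from the integrability of `I_a`. -/
theorem dForm_J_succ (hx : x ∈ U) {v w : Tan n x} (hv : v ∈ H.core x) (hw : w ∈ H.core x)
    (a : Fin 3) :
    dForm (θ (a + 1)) x v w - dForm (θ (a + 1)) x (H.J a x v) (H.J a x w)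
      = dForm (θ (a + 2)) x v (H.J a x w) + dForm (θ (a + 2)) x (H.J a x v) w := by
  obtain ⟨V, X, hV, hxV, hVU, hX, rfl⟩ := h.exists_core_section hx hv
  obtain ⟨W, Y, hW, hxW, hWU, hY, rfl⟩ := h.exists_core_section hx hw
  have hVW := hV.inter hW
  have hVWU : V ∩ W ⊆ U := fun y hy ↦ hVU hy.1
  have hX := hX.mono (Set.inter_subset_left (t := W))
  have hY := hY.mono (Set.inter_subset_right (s := V))
  have hxVW : x ∈ V ∩ W := ⟨hxV, hxW⟩
  have e : ∀ {X Y : VF n M} (b : Fin 3), IsSection H.core X (V ∩ W) →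
      IsSection H.core Y (V ∩ W) →
      dForm (θ b) x (X x) (Y x) = - θ b x (bracket X Y x) := fun b hX hY ↦
    dForm_eq_neg_bracket (h.compatible.smooth b) h.isOpen hx (hX.1.diffAt hVW hxVW)
      (hY.1.diffAt hVW hxVW)
      (Filter.eventually_of_mem (hVW.mem_nhds hxVW) fun y hy ↦ h.theta_core (hVWU hy) (hX.2 y hy) b)
      (Filter.eventually_of_mem (hVW.mem_nhds hxVW) fun y hy ↦ h.theta_core (hVWU hy) (hY.2 y hy) b)
  have hJX := h.act_section hVW hVWU hX a
  have hJY := h.act_section hVW hVWU hY a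
  have h1 := e (a + 1) hX hY
  have h2 := e (a + 1) hJX hJY
  have h3 := e (a + 2) hX hJY
  have h4 := e (a + 2) hJX hY
  -- The first integrability condition puts the bracket difference into `Q_a`, where `θ_{a+2} ∘ I_a
  -- = θ_{a+1}`; the second condition is then evaluated with `θ_{a+2}`.
  have h5 := h.compatible.comp x hx a _ (h.hyper.integrable₁ _ hVW hVWU X Y hX hY a x hxVW)
  have h6 := h.theta_core hx (h.hyper.integrable₂ _ hVW hVWU X Y hX hY a x hxVW) (a + 2)
  rw [map_sub, map_sub] at h6
  rw [h5, map_sub] at h6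
  simp only [Triple.act] at h2 h3 h4 h6
  rw [h1, h2, h3, h4]
  linarith

theorem exists_levi_eq (hx : x ∈ U) :
    ∃ L : Tan n x →ₗ[ℝ] Tan n x →ₗ[ℝ] ℝ, ∀ v w, levi H θ x v w = L v w := by
  obtain ⟨B, hB⟩ := exists_dForm_eq (h.compatible.smooth 0) h.isOpen hx
  refine ⟨LinearMap.mk₂ ℝ (fun v w ↦ (1 / 2) * (B v (H.J 0 x w) + B (H.J 1 x v) (H.J 2 x w)))
    ?_ ?_ ?_ ?_, fun v w ↦ by simp [levi, hB]⟩ <;> intros <;> simp <;> ring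

/-- Each of the two summands is symmetric separately, by the `I_0`-invariance and skewness of
`dθ_0`. -/
theorem levi_symm (hx : x ∈ U) {v w : Tan n x} (hv : v ∈ H.core x) (hw : w ∈ H.core x) :
    levi H θ x v w = levi H θ x w v := by
  obtain ⟨B, hB⟩ := exists_dForm_eq (h.compatible.smooth 0) h.isOpen hx
  have e1 := h.dForm_J hx hw (h.J_mem hx hv 0) 0
  have e2 := h.dForm_J hx (h.J_mem hx hw 1) (h.J_mem hx hv 2) 0
  rw [h.J00 hx hv] at e1
  rw [h.J01 hx hw, h.J02 hx hv] at e2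
  have s1 := dForm_swap (θ := θ 0) (H.J 0 x w) v
  have s2 := dForm_swap (θ := θ 0) (H.J 2 x w) (H.J 1 x v)
  simp only [levi]
  rw [← e1, ← e2]
  simp only [hB, map_neg] at *
  rw [s1, s2]
  ring

/-- `I_0` preserves each summand of the Levi form, `I_1` exchanges the two summands, and `I_2 = I_0
I_1`. -/
theorem levi_J (hx : x ∈ U) {v w : Tan n x} (hv : v ∈ H.core x) (hw : w ∈ H.core x)
    (a : Fin 3) : levi H θ x (H.J a x v) (H.J a x w) = levi H θ x v w := by
  obtain ⟨B, hB⟩ := exists_dForm_eq (h.compatible.smooth 0) h.isOpen hx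
  have h0 : ∀ {v w : Tan n x}, v ∈ H.core x → w ∈ H.core x →
      levi H θ x (H.J 0 x v) (H.J 0 x w) = levi H θ x v w := by
    intro v w hv hw
    have e1 := h.dForm_J hx hv (h.J_mem hx hw 0) 0
    have e2 := h.dForm_J hx (h.J_mem hx hv 2) (h.J_mem hx hw 1) 0
    rw [h.J02 hx hv, h.J01 hx hw] at e2
    simp only [levi]
    rw [h.J10 hx hv, h.J20 hx hw, e1]
    simp only [hB, map_neg, LinearMap.neg_apply] at *
    rw [← e2, neg_neg]
  have h1 : ∀ {v w : Tan n x}, v ∈ H.core x → w ∈ H.core x →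
      levi H θ x (H.J 1 x v) (H.J 1 x w) = levi H θ x v w := by
    intro v w hv hw
    simp only [levi]
    rw [h.J01 hx hw, h.J11 hx hv, h.J21 hx hw]
    simp only [hB, map_neg, LinearMap.neg_apply] at *
    ring
  fin_cases a
  · exact h0 hv hw
  · exact h1 hv hw
  · change levi H θ x (H.J 2 x v) (H.J 2 x w) = _
    rw [← h.J01 hx hv, ← h.J01 hx hw, h0 (h.J_mem hx hv 1) (h.J_mem hx hw 1), h1 hv hw]

theorem levi_smooth {V : Set M} (hV : IsOpen V) (hVU : V ⊆ U) {X Y : VF n M}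
    (hX : IsSection H.core X V) (hY : IsSection H.core Y V) :
    FSmoothOn n (fun x ↦ levi H θ x (X x) (Y x)) V :=
  (FSmoothOn.const _).mul ((dForm_smooth (h.compatible.smooth 0) h.isOpen hV hVU hX.1
    (h.act_section hV hVU hY 0).1).add (dForm_smooth (h.compatible.smooth 0) h.isOpen hV hVU
    (h.act_section hV hVU hX 1).1 (h.act_section hV hVU hY 2).1))

end IsPseudohermitian

end Structure

/-! ### Adapted orthonormal frames and moving frames. -/

section Frames

variable {n : ℕ} {M : Type*} [TopologicalSpace M] [ChartedSpace (Model n) M]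
  [IsManifold 𝓘(ℝ, Model n) ∞ M]

/-- The action of the quaternions `1, i, j, k` on the core. -/
def Triple.quat (H : Triple n M) (x : M) (i : Fin 4) : Tan n x →ₗ[ℝ] Tan n x :=
  (![LinearMap.id, H.J 0 x, H.J 1 x, H.J 2 x] : Fin 4 → Tan n x →ₗ[ℝ] Tan n x) i

namespace IsPseudohermitian

variable {U : Set M} {H : Triple n M} {θ : Fin 3 → Π x : M, Tan n x →L[ℝ] ℝ}
  (h : IsPseudohermitian U H θ) {x : M}

include h

theorem quat_mem (hx : x ∈ U) {v : Tan n x} (hv : v ∈ H.core x) (i : Fin 4) :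
    H.quat x i v ∈ H.core x := by
  fin_cases i
  exacts [hv, h.J_mem hx hv 0, h.J_mem hx hv 1, h.J_mem hx hv 2]

theorem quat_section {V : Set M} (hV : IsOpen V) (hVU : V ⊆ U) {X : VF n M}
    (hX : IsSection H.core X V) (i : Fin 4) : IsSection H.core (fun x ↦ H.quat x i (X x)) V := by
  fin_cases i
  exacts [hX, h.act_section hV hVU hX 0, h.act_section hV hVU hX 1, h.act_section hV hVU hX 2]

theorem levi_J_left (hx : x ∈ U) {v w : Tan n x} (hv : v ∈ H.core x) (hw : w ∈ H.core x)
    (a : Fin 3) : levi H θ x (H.J a x v) w = - levi H θ x v (H.J a x w) := by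
  obtain ⟨L, hL⟩ := h.exists_levi_eq hx
  rw [← h.levi_J hx (h.J_mem hx hv a) hw a, h.J_sq hx hv a]
  simp [hL]

theorem levi_J_self (hx : x ∈ U) {v : Tan n x} (hv : v ∈ H.core x) (a : Fin 3) :
    levi H θ x v (H.J a x v) = 0 := by
  have h1 := h.levi_J_left hx hv hv a
  rw [h.levi_symm hx (h.J_mem hx hv a) hv] at h1
  linarith

/-- The sign is immaterial for orthogonality; what counts is that distinct units multiply to a
multiple of an imaginary unit. -/
theorem exists_quat_mul (hx : x ∈ U) (i j : Fin 4) :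
    ∃ (s : ℝ) (m : Fin 4), (i ≠ j → m ≠ 0) ∧
      ∀ w ∈ H.core x, H.quat x i (H.quat x j w) = s • H.quat x m w := by
  have e : ∀ (s : ℝ) (m : Fin 4), (i ≠ j → m ≠ 0) →
      (∀ w ∈ H.core x, H.quat x i (H.quat x j w) = s • H.quat x m w) →
      ∃ (s : ℝ) (m : Fin 4), (i ≠ j → m ≠ 0) ∧
      ∀ w ∈ H.core x, H.quat x i (H.quat x j w) = s • H.quat x m w :=
    fun s m h1 h2 ↦ ⟨s, m, h1, h2⟩
  fin_cases i <;> fin_cases j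
  · exact e 1 0 (by simp) fun w hw ↦ by simp [Triple.quat]
  · exact e 1 1 (by simp) fun w hw ↦ by simp [Triple.quat]
  · exact e 1 2 (by simp) fun w hw ↦ by simp [Triple.quat]
  · exact e 1 3 (by simp) fun w hw ↦ by simp [Triple.quat]
  · exact e 1 1 (by simp) fun w hw ↦ by simp [Triple.quat]
  · exact e (-1) 0 (by simp) fun w hw ↦ by simp [Triple.quat, h.J00 hx hw]
  · exact e 1 3 (by simp) fun w hw ↦ by simp [Triple.quat, h.J01 hx hw]
  · exact e (-1) 2 (by simp) fun w hw ↦ by simp [Triple.quat, h.J02 hx hw]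
  · exact e 1 2 (by simp) fun w hw ↦ by simp [Triple.quat]
  · exact e (-1) 3 (by simp) fun w hw ↦ by simp [Triple.quat, h.J10 hx hw]
  · exact e (-1) 0 (by simp) fun w hw ↦ by simp [Triple.quat, h.J11 hx hw]
  · exact e 1 1 (by simp) fun w hw ↦ by simp [Triple.quat, h.J12 hx hw]
  · exact e 1 3 (by simp) fun w hw ↦ by simp [Triple.quat]
  · exact e 1 2 (by simp) fun w hw ↦ by simp [Triple.quat, h.J20 hx hw]
  · exact e (-1) 1 (by simp) fun w hw ↦ by simp [Triple.quat, h.J21 hx hw]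
  · exact e (-1) 0 (by simp) fun w hw ↦ by simp [Triple.quat, h.J22 hx hw]

theorem exists_levi_quat (hx : x ∈ U) (i : Fin 4) :
    ∃ s : ℝ, ∀ v ∈ H.core x, ∀ w ∈ H.core x,
      levi H θ x (H.quat x i v) w = s * levi H θ x v (H.quat x i w) := by
  fin_cases i
  · exact ⟨1, fun v _ w _ ↦ by simp [Triple.quat]⟩
  · exact ⟨-1, fun v hv w hw ↦ by simp [Triple.quat, h.levi_J_left hx hv hw]⟩
  · exact ⟨-1, fun v hv w hw ↦ by simp [Triple.quat, h.levi_J_left hx hv hw]⟩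
  · exact ⟨-1, fun v hv w hw ↦ by simp [Triple.quat, h.levi_J_left hx hv hw]⟩

/-- Quaternionic orthogonality. -/
theorem levi_quat_quat_eq_zero (hx : x ∈ U) {v w : Tan n x} (hv : v ∈ H.core x)
    (hw : w ∈ H.core x) (h0 : ∀ i, levi H θ x v (H.quat x i w) = 0) (i j : Fin 4) :
    levi H θ x (H.quat x i v) (H.quat x j w) = 0 := by
  obtain ⟨L, hL⟩ := h.exists_levi_eq hx
  obtain ⟨s, hs⟩ := h.exists_levi_quat hx i
  obtain ⟨t, m, -, hm⟩ := h.exists_quat_mul hx i j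
  rw [hs v hv _ (h.quat_mem hx hw j), hm w hw, hL, map_smul, ← hL, h0, smul_zero, mul_zero]

theorem levi_quat_self (hx : x ∈ U) {v : Tan n x} (hv : v ∈ H.core x)
    (h1 : levi H θ x v v = 1) (i j : Fin 4) :
    levi H θ x (H.quat x i v) (H.quat x j v) = if i = j then 1 else 0 := by
  obtain ⟨L, hL⟩ := h.exists_levi_eq hx
  split_ifs with hij
  · subst hij
    rw [← h1]
    fin_cases i
    exacts [rfl, h.levi_J hx hv hv 0, h.levi_J hx hv hv 1, h.levi_J hx hv hv 2]
  · obtain ⟨s, hs⟩ := h.exists_levi_quat hx i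
    obtain ⟨t, m, hm0, hm⟩ := h.exists_quat_mul hx i j
    have h0 : levi H θ x v (H.quat x m v) = 0 := by
      have := hm0 hij
      fin_cases m
      exacts [absurd rfl this, h.levi_J_self hx hv 0, h.levi_J_self hx hv 1, h.levi_J_self hx hv 2]
    rw [hs v hv _ (h.quat_mem hx hv j), hm v hv, hL, map_smul, ← hL, h0, smul_zero, mul_zero]

theorem finrank_core (hx : x ∈ U) : Module.finrank ℝ (H.core x) = 4 * n := by
  obtain ⟨V, T, -, hxV, -, hT⟩ := h.exists_normalized hx
  let Φ : Tan n x →ₗ[ℝ] (Fin 3 → ℝ) := LinearMap.pi fun a ↦ (θ a x).toLinearMap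
  have hker : LinearMap.ker Φ = H.core x := by
    ext v
    rw [h.mem_core_iff hx, LinearMap.mem_ker]
    exact funext_iff
  have hsurj : LinearMap.range Φ = ⊤ := by
    rw [LinearMap.range_eq_top]
    intro c
    refine ⟨∑ a, c a • T a x, ?_⟩
    ext b
    simp [Φ, hT.dual x hxV]
  have := Φ.finrank_range_add_finrank_ker
  rw [hker, hsurj, finrank_top, finrank_tan] at this
  simp at this
  omega

/-- Quaternionic Gram-Schmidt: a vector orthogonal to the quaternionic span of the previous ones has
all its quaternionic multiples orthogonal to them, and `v, I_0 v, I_1 v, I_2 v` are mutually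
orthogonal automatically. -/
theorem exists_orthonormal (hx : x ∈ U) (m : ℕ) (hm : m ≤ n) :
    ∃ (V : Set M) (f : Fin m → VF n M), IsOpen V ∧ x ∈ V ∧ V ⊆ U ∧
      (∀ k, IsSection H.core (f k) V) ∧ ∀ y ∈ V, ∀ k l i j,
        levi H θ y (H.quat y i (f k y)) (H.quat y j (f l y)) = if k = l ∧ i = j then 1 else 0 := by
  induction m with
  | zero => exact ⟨U, Fin.elim0, h.isOpen, hx, subset_rfl, fun k ↦ k.elim0, fun _ _ k ↦ k.elim0⟩
  | succ m ih =>
    obtain ⟨V, f, hV, hxV, hVU, hf, hort⟩ := ih (by omega)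
    -- Dimension count: the `4m` vectors built so far cannot span the core, whose dimension is `4n >
    -- 4m`.
    obtain ⟨v, hv, hvs⟩ : ∃ v ∈ H.core x,
        v ∉ Submodule.span ℝ (Set.range fun p : Fin m × Fin 4 ↦ H.quat x p.2 (f p.1 x)) := by
      by_contra! hc
      have h1 := Submodule.finrank_mono (show H.core x ≤ _ from hc)
      have h2 := finrank_range_le_card (R := ℝ)
        (fun p : Fin m × Fin 4 ↦ H.quat x p.2 (f p.1 x))
      rw [Set.finrank] at h2
      rw [h.finrank_core hx] at h1
      simp at h2
      omega
    obtain ⟨W, X, hW, hxW, hWU, hX, rfl⟩ := h.exists_core_section hx hv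
    have hVW := hV.inter hW
    have hVWU : V ∩ W ⊆ U := fun y hy ↦ hVU hy.1
    have hXs := hX.mono (Set.inter_subset_right (s := V))
    have hfq : ∀ k i, IsSection H.core (fun y ↦ H.quat y i (f k y)) (V ∩ W) := fun k i ↦
      h.quat_section hVW hVWU ((hf k).mono Set.inter_subset_left) i
    let Y : VF n M := fun y ↦ X y - ∑ p : Fin m × Fin 4,
      levi H θ y (X y) (H.quat y p.2 (f p.1 y)) • H.quat y p.2 (f p.1 y)
    have hY : IsSection H.core Y (V ∩ W) := hXs.sub (IsSection.sum fun p _ ↦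
      IsSection.smul (h.levi_smooth hVW hVWU hXs (hfq p.1 p.2)) (hfq p.1 p.2))
    have hY0 : ∀ y ∈ V ∩ W, ∀ k i, levi H θ y (Y y) (H.quat y i (f k y)) = 0 := by
      intro y hy k i
      obtain ⟨L, hL⟩ := h.exists_levi_eq (hVWU hy)
      have hort' : ∀ k l i j, L (H.quat y i (f k y)) (H.quat y j (f l y))
          = if k = l ∧ i = j then 1 else 0 := fun k l i j ↦ by rw [← hL, hort y hy.1]
      simp only [hL, Y, map_sub, map_sum, map_smul, LinearMap.sub_apply, LinearMap.sum_apply,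
        LinearMap.smul_apply, hort', smul_eq_mul]
      rw [Finset.sum_eq_single (k, i)]
      · simp
      · rintro ⟨k', i'⟩ - hne
        rw [if_neg (by simpa using hne), mul_zero]
      · simp
    have hYx : Y x ≠ 0 := by
      intro h0
      refine hvs ?_
      rw [sub_eq_zero.1 h0]
      exact Submodule.sum_mem _ fun p _ ↦ Submodule.smul_mem _ _ (Submodule.subset_span ⟨p, rfl⟩)
    have hg := h.levi_smooth hVW hVWU hY hY
    obtain ⟨V', hV', hV'o, hxV', hpos⟩ : ∃ V' ⊆ V ∩ W, IsOpen V' ∧ x ∈ V' ∧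
        ∀ y ∈ V', 0 < levi H θ y (Y y) (Y y) := by
      have hc := hg.continuousOn.continuousAt (hVW.mem_nhds ⟨hxV, hxW⟩)
      have h1 : ∀ᶠ y in 𝓝 x, 0 < levi H θ y (Y y) (Y y) :=
        hc.eventually_const_lt (h.pos x hx _ (hY.2 x ⟨hxV, hxW⟩) hYx)
      obtain ⟨V', hV1, hV2, hV3⟩ := mem_nhds_iff.1
        (Filter.inter_mem h1 (hVW.mem_nhds ⟨hxV, hxW⟩))
      exact ⟨V', fun y hy ↦ (hV1 hy).2, hV2, hV3, fun y hy ↦ (hV1 hy).1⟩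
    have hsq : FSmoothOn n (fun y ↦ (Real.sqrt (levi H θ y (Y y) (Y y)))⁻¹) V' :=
      FSmoothOn.inv (FSmoothOn.comp (hg.mono hV') fun y hy ↦
        (Real.contDiffAt_sqrt (hpos y hy).ne')) fun y hy ↦ (Real.sqrt_pos.2 (hpos y hy)).ne'
    let F : VF n M := fun y ↦ (Real.sqrt (levi H θ y (Y y) (Y y)))⁻¹ • Y y
    have hF : IsSection H.core F V' := IsSection.smul hsq (hY.mono hV')
    have hFF : ∀ y ∈ V', levi H θ y (F y) (F y) = 1 := by
      intro y hy
      obtain ⟨L, hL⟩ := h.exists_levi_eq (hVWU (hV' hy))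
      have hp := hpos y hy
      simp only [F, hL, map_smul, LinearMap.smul_apply, smul_eq_mul] at hp ⊢
      rw [← mul_assoc, ← mul_inv, Real.mul_self_sqrt hp.le, inv_mul_cancel₀ hp.ne']
    have hFf : ∀ y ∈ V', ∀ k i, levi H θ y (F y) (H.quat y i (f k y)) = 0 := by
      intro y hy k i
      obtain ⟨L, hL⟩ := h.exists_levi_eq (hVWU (hV' hy))
      have := hY0 y (hV' hy) k i
      simp only [hL] at this
      simp [F, hL, this]
    refine ⟨V', Fin.snoc (α := fun _ ↦ VF n M) f F, hV'o, hxV', hV'.trans hVWU, ?_, ?_⟩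
    · intro k
      refine Fin.lastCases ?_ (fun k ↦ ?_) k
      · simpa using hF
      · simpa using (hf k).mono (hV'.trans Set.inter_subset_left)
    · intro y hy k l i j
      have hyU := hVWU (hV' hy)
      have hfy : ∀ k, f k y ∈ H.core y := fun k ↦ (hf k).2 y (hV' hy).1
      have hz := fun k i j ↦ h.levi_quat_quat_eq_zero hyU (hF.2 y hy) (hfy k) (hFf y hy k) i j
      refine Fin.lastCases ?_ (fun k ↦ ?_) k <;> refine Fin.lastCases ?_ (fun l ↦ ?_) l
      · simp [h.levi_quat_self hyU (hF.2 y hy) (hFF y hy)]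
      · have hne : Fin.last m ≠ l.castSucc := (Fin.castSucc_lt_last l).ne'
        simp [hz, hne]
      · have hne : k.castSucc ≠ Fin.last m := (Fin.castSucc_lt_last k).ne
        rw [h.levi_symm hyU (h.quat_mem hyU (by simpa using hfy k) _)
          (h.quat_mem hyU (by simpa using hF.2 y hy) _)]
        simp [hz, hne]
      · simp [hort y (hV' hy).1]

theorem exists_adaptedFrame (hx : x ∈ U) : ∃ (V : Set M) (ε : Idx n → VF n M),
    IsOpen V ∧ x ∈ V ∧ V ⊆ U ∧ IsAdaptedFrame V H θ ε := by
  obtain ⟨V, f, hV, hxV, hVU, hf, hort⟩ := h.exists_orthonormal hx n le_rfl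
  refine ⟨V, fun p y ↦ H.quat y p.2 (f p.1 y), hV, hxV, hVU, fun p ↦
    h.quat_section hV hVU (hf p.1) p.2, fun y hy p q ↦ ?_, fun y hy k ↦ ⟨rfl, rfl, rfl⟩⟩
  rw [hort y hy]
  simp [Prod.ext_iff]

end IsPseudohermitian

/-- An adapted orthonormal frame of the core together with a normalized admissible triple. -/
structure IsMovingFrame (V : Set M) (H : Triple n M) (θ : Fin 3 → Π x : M, Tan n x →L[ℝ] ℝ)
    (ε : Idx n → VF n M) (T : Fin 3 → VF n M) : Prop where
  ph : IsPseudohermitian V H θ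
  adapted : IsAdaptedFrame V H θ ε
  normalized : IsNormalizedTriple V H θ T

theorem IsAdaptedFrame.mono {V W : Set M} {H : Triple n M}
    {θ : Fin 3 → Π x : M, Tan n x →L[ℝ] ℝ} {ε : Idx n → VF n M} (hε : IsAdaptedFrame V H θ ε)
    (hW : W ⊆ V) : IsAdaptedFrame W H θ ε where
  isSection p := (hε.isSection p).mono hW
  orthonormal x hx := hε.orthonormal x (hW hx)
  adapted x hx := hε.adapted x (hW hx)

namespace IsMovingFrame

variable {V : Set M} {H : Triple n M} {θ : Fin 3 → Π x : M, Tan n x →L[ℝ] ℝ}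
  {ε : Idx n → VF n M} {T : Fin 3 → VF n M} (F : IsMovingFrame V H θ ε T) {x : M}

include F

theorem mono {W : Set M} (hW : IsOpen W) (hWV : W ⊆ V) : IsMovingFrame W H θ ε T :=
  ⟨F.ph.mono hW hWV, F.adapted.mono hWV, F.normalized.mono hWV⟩

theorem theta_eps (hx : x ∈ V) (a : Fin 3) (p : Idx n) : θ a x (ε p x) = 0 :=
  F.ph.theta_core hx ((F.adapted.isSection p).2 x hx) a

/-- The forms `θ_a` detect the coefficients of `T`, and the Levi form then detects those of `ε`; the
count `4n + 3` does the rest. -/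
theorem isFrame : IsFrame (Sum.elim ε T) V where
  linearIndependent {x} hx := by
    obtain ⟨L, hL⟩ := F.ph.exists_levi_eq hx
    have hort : ∀ p q, L (ε p x) (ε q x) = if p = q then 1 else 0 := fun p q ↦ by
      rw [← hL]; exact F.adapted.orthonormal x hx p q
    rw [Fintype.linearIndependent_iff]
    intro c hc
    simp only [Fintype.sum_sum_type, Sum.elim_inl, Sum.elim_inr] at hc
    have h2 : ∀ a, c (Sum.inr a) = 0 := by
      intro a
      have := congrArg (θ a x) hc
      simpa [F.theta_eps hx, F.normalized.dual x hx] using this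
    have h1 : ∀ p, c (Sum.inl p) = 0 := by
      intro p
      simp only [h2, zero_smul, Finset.sum_const_zero, add_zero] at hc
      have := congrArg (fun v ↦ L v (ε p x)) hc
      simpa [hort, LinearMap.sum_apply] using this
    rintro (p | a)
    exacts [h1 p, h2 a]
  generating {x} hx := by
    intro v _
    have hli : LinearIndependent ℝ (fun i : Idx n ⊕ Fin 3 ↦ Sum.elim ε T i x) := by
      obtain ⟨L, hL⟩ := F.ph.exists_levi_eq hx
      have hort : ∀ p q, L (ε p x) (ε q x) = if p = q then 1 else 0 := fun p q ↦ by
        rw [← hL]; exact F.adapted.orthonormal x hx p q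
      rw [Fintype.linearIndependent_iff]
      intro c hc
      simp only [Fintype.sum_sum_type, Sum.elim_inl, Sum.elim_inr] at hc
      have h2 : ∀ a, c (Sum.inr a) = 0 := by
        intro a
        have := congrArg (θ a x) hc
        simpa [F.theta_eps hx, F.normalized.dual x hx] using this
      have h1 : ∀ p, c (Sum.inl p) = 0 := by
        intro p
        simp only [h2, zero_smul, Finset.sum_const_zero, add_zero] at hc
        have := congrArg (fun v ↦ L v (ε p x)) hc
        simpa [hort, LinearMap.sum_apply] using this
      rintro (p | a)
      exacts [h1 p, h2 a]
    rw [hli.span_eq_top_of_card_eq_finrank' (by rw [finrank_tan]; simp; ring)]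
    trivial
  contMDiffOn i := by
    rcases i with p | a
    exacts [(F.adapted.isSection p).1, F.normalized.smooth a]

theorem coeff_inr (hx : x ∈ V) (v : Tan n x) (a : Fin 3) :
    F.isFrame.coeff (Sum.inr a) x v = θ a x v := by
  conv_rhs => rw [← F.isFrame.sum_coeff hx v]
  simp [F.theta_eps hx, F.normalized.dual x hx]

theorem sum_eps (hx : x ∈ V) (v : Tan n x) :
    v = ∑ p, F.isFrame.coeff (Sum.inl p) x v • ε p x + ∑ a, θ a x v • T a x := by
  conv_lhs => rw [← F.isFrame.sum_coeff hx v]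
  simp [F.coeff_inr hx]

theorem coeff_inl_core (hx : x ∈ V) {v : Tan n x} (hv : v ∈ H.core x) (p : Idx n) :
    F.isFrame.coeff (Sum.inl p) x v = levi H θ x v (ε p x) := by
  obtain ⟨L, hL⟩ := F.ph.exists_levi_eq hx
  have hort : ∀ p q, L (ε p x) (ε q x) = if p = q then 1 else 0 := fun p q ↦ by
    rw [← hL]; exact F.adapted.orthonormal x hx p q
  conv_rhs => rw [F.sum_eps hx v]
  simp [hL, F.ph.theta_core hx hv, hort, LinearMap.sum_apply]

theorem core_expand (hx : x ∈ V) {v : Tan n x} (hv : v ∈ H.core x) :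
    v = ∑ p, levi H θ x v (ε p x) • ε p x := by
  conv_lhs => rw [F.sum_eps hx v]
  simp [F.ph.theta_core hx hv, F.coeff_inl_core hx hv]

theorem eps_mem (hx : x ∈ V) (p : Idx n) : ε p x ∈ H.core x := (F.adapted.isSection p).2 x hx

/-- In an adapted frame the complex structures have constant matrices. This reduces everything on
the core to matrix identities. -/
theorem J_eps (hx : x ∈ V) (a : Fin 3) (q : Idx n) :
    H.J a x (ε q x) = ∑ p, frameJ n a p q • ε p x := by
  obtain ⟨k, j⟩ := q
  have hk := F.adapted.adapted x hx k
  have hc := F.eps_mem hx (k, 0)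
  have hsum : ∑ p, frameJ n a p (k, j) • ε p x = ∑ i, quatUnit a i j • ε (k, i) x := by
    rw [Fintype.sum_prod_type, Finset.sum_eq_single k]
    · simp [frameJ]
    · intro l _ hl
      simp [frameJ, hl]
    · simp
  rw [hsum]
  fin_cases a <;> fin_cases j <;>
    simp [Fin.sum_univ_four, quatUnit, hk.1, hk.2.1, hk.2.2, F.ph.J00 hx hc, F.ph.J01 hx hc,
      F.ph.J02 hx hc, F.ph.J10 hx hc, F.ph.J11 hx hc, F.ph.J12 hx hc, F.ph.J20 hx hc,
      F.ph.J21 hx hc, F.ph.J22 hx hc]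

end IsMovingFrame

end Frames

/-! ### The `(sp(n) + sp(1))^⊥`-component and the `E ⊗ H`-component in matrices. -/

section Quaternionic

open Matrix

variable {n : ℕ}

/-! ### Matrices on `ℍⁿ` -/

theorem frameJ_eq (a : Fin 3) : frameJ n a = kroneckerMap (· * ·) (1 : Matrix (Fin n) (Fin n) ℝ)
    (quatUnit a) := by
  ext p q
  simp [frameJ, Matrix.one_apply]

theorem quatUnit_transpose (a : Fin 3) : (quatUnit a)ᵀ = - quatUnit a := by
  ext i j
  fin_cases a <;> fin_cases i <;> fin_cases j <;> simp [quatUnit]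

theorem quatUnit_sq (a : Fin 3) : quatUnit a * quatUnit a = -1 := by
  ext i j
  fin_cases a <;> fin_cases i <;> fin_cases j <;>
    simp [quatUnit, Matrix.mul_apply, Fin.sum_univ_four]

theorem quatUnit_succ (a : Fin 3) : quatUnit a * quatUnit (a + 1) = quatUnit (a + 2) := by
  ext i j
  fin_cases a <;> fin_cases i <;> fin_cases j <;>
    simp [quatUnit, Matrix.mul_apply, Fin.sum_univ_four]

theorem frameJ_transpose (a : Fin 3) : (frameJ n a)ᵀ = - frameJ n a := by
  ext p q
  have := congrFun (congrFun (quatUnit_transpose a) p.2) q.2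
  simp only [Matrix.transpose_apply, Matrix.neg_apply] at this
  simp only [frameJ, Matrix.transpose_apply, Matrix.neg_apply, Matrix.of_apply, this,
    eq_comm (a := q.1)]
  split_ifs <;> simp

theorem frameJ_sq (a : Fin 3) : frameJ n a * frameJ n a = -1 := by
  rw [frameJ_eq, ← Matrix.mul_kronecker_mul, quatUnit_sq]
  ext p q
  simp [Matrix.one_apply, Prod.ext_iff]
  split_ifs <;> simp_all

theorem frameJ_succ (a : Fin 3) : frameJ n a * frameJ n (a + 1) = frameJ n (a + 2) := by
  simp only [frameJ_eq, ← Matrix.mul_kronecker_mul, quatUnit_succ, Matrix.one_mul]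

theorem frameJ_succ' (a : Fin 3) : frameJ n (a + 1) * frameJ n a = - frameJ n (a + 2) := by
  have := congrArg Matrix.transpose (frameJ_succ (n := n) a)
  simpa [Matrix.transpose_mul, frameJ_transpose] using this

local notation "𝕁" => frameJ n

theorem J01 : 𝕁 0 * 𝕁 1 = 𝕁 2 := frameJ_succ 0
theorem J12 : 𝕁 1 * 𝕁 2 = 𝕁 0 := frameJ_succ 1
theorem J20 : 𝕁 2 * 𝕁 0 = 𝕁 1 := frameJ_succ 2
theorem J10 : 𝕁 1 * 𝕁 0 = - 𝕁 2 := frameJ_succ' 0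
theorem J21 : 𝕁 2 * 𝕁 1 = - 𝕁 0 := frameJ_succ' 1
theorem J02 : 𝕁 0 * 𝕁 2 = - 𝕁 1 := frameJ_succ' 2

theorem frameJ_sq_assoc (a : Fin 3) (X : Mat n) : 𝕁 a * (𝕁 a * X) = - X := by
  rw [← Matrix.mul_assoc, frameJ_sq, Matrix.neg_mul, Matrix.one_mul]

theorem trace_frameJ (a : Fin 3) : (𝕁 a).trace = 0 := by
  have := congrArg Matrix.trace (frameJ_transpose (n := n) a)
  rw [Matrix.trace_transpose, Matrix.trace_neg] at this
  linarith

theorem trace_frameJ_mul (a b : Fin 3) :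
    (𝕁 a * 𝕁 b).trace = if a = b then -(4 * n : ℝ) else 0 := by
  have h1 : ∀ a, (𝕁 a * 𝕁 a).trace = -(4 * n : ℝ) := fun a ↦ by
    rw [frameJ_sq, Matrix.trace_neg, Matrix.trace_one]
    simp [mul_comm]
  fin_cases a <;> fin_cases b <;>
    simp [h1, J01, J12, J20, J10, J21, J02, trace_frameJ]

/-- The sum `∑ J_a A J_a`. -/
def sandwich (A : Mat n) : Mat n := ∑ a, 𝕁 a * A * 𝕁 a

/-- The term `a = b` contributes `-J_b`; each of the other two units anticommutes with `J_b` and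
contributes `J_b`. -/
theorem sandwich_frameJ (b : Fin 3) : sandwich (𝕁 b) = 𝕁 b := by
  fin_cases b <;> simp [sandwich, Fin.sum_univ_three, J01, J12, J20, J10, J21, J02, frameJ_sq]

theorem trace_sandwich_mul (A B : Mat n) : (sandwich A * B).trace = (A * sandwich B).trace := by
  simp only [sandwich, Finset.sum_mul, Finset.mul_sum, Matrix.trace_sum]
  refine Finset.sum_congr rfl fun a _ ↦ ?_
  rw [Matrix.mul_assoc, Matrix.mul_assoc, Matrix.trace_mul_comm]
  simp only [Matrix.mul_assoc]

theorem sandwich_of_commute {B : Mat n} (hB : ∀ a, 𝕁 a * B = B * 𝕁 a) :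
    sandwich B = (-3 : ℝ) • B := by
  simp only [sandwich, hB, Matrix.mul_assoc, frameJ_sq, Fin.sum_univ_three]
  simp only [Matrix.mul_neg, Matrix.mul_one]
  module

/-- Writing `J_a` as a product of the other two units and moving one of them around the trace, past
`B`, reverses the sign. -/
theorem trace_mul_frameJ_of_commute {B : Mat n} (hB : ∀ a, 𝕁 a * B = B * 𝕁 a) (a : Fin 3) :
    (B * 𝕁 a).trace = 0 := by
  have h1 : 𝕁 a = 𝕁 (a + 1) * 𝕁 (a + 2) := by
    fin_cases a
    exacts [J12.symm, J20.symm, J01.symm]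
  have h2 : 𝕁 (a + 2) * 𝕁 (a + 1) = - 𝕁 a := by
    fin_cases a
    exacts [J21, J02, J10]
  have h3 : (B * 𝕁 a).trace = (B * - 𝕁 a).trace := by
    conv_lhs => rw [h1, ← Matrix.mul_assoc, ← hB, Matrix.mul_assoc, Matrix.trace_mul_comm,
      Matrix.mul_assoc, h2]
  rw [Matrix.mul_neg, Matrix.trace_neg] at h3
  linarith

/-- The `(sp(n) + sp(1))^⊥`-component of a skew-symmetric matrix. -/
def obsPart (A : Mat n) : Mat n :=
  (3 / 4 : ℝ) • A + (1 / 4 : ℝ) • sandwich A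
    + (4 * n : ℝ)⁻¹ • ∑ a, (A * 𝕁 a).trace • 𝕁 a

theorem obsPart_add (A B : Mat n) : obsPart (A + B) = obsPart A + obsPart B := by
  simp only [obsPart, sandwich, Matrix.mul_add, Matrix.add_mul, Finset.sum_add_distrib,
    Matrix.trace_add, add_smul, smul_add]
  abel

theorem obsPart_smul (c : ℝ) (A : Mat n) : obsPart (c • A) = c • obsPart A := by
  simp only [obsPart, sandwich, Matrix.mul_smul, Matrix.smul_mul, smul_add, Finset.smul_sum,
    Matrix.trace_smul, smul_eq_mul, ← smul_assoc, mul_left_comm c]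
  simp only [mul_comm c]

variable (n) in
/-- `obsPart` as a linear map. -/
def obsLinear : Mat n →ₗ[ℝ] Mat n where
  toFun := obsPart
  map_add' := obsPart_add
  map_smul' := obsPart_smul

/-- Self-adjointness for the trace form: orthogonality of the image to a subspace follows once that
subspace is annihilated. -/
theorem trace_obsPart_mul (A B : Mat n) : (obsPart A * B).trace = (A * obsPart B).trace := by
  simp only [obsPart, Matrix.add_mul, Matrix.mul_add, Matrix.trace_add, Matrix.smul_mul,
    Matrix.mul_smul, Matrix.trace_smul, trace_sandwich_mul, Finset.sum_mul, Finset.mul_sum,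
    Matrix.trace_sum, smul_eq_mul]
  congr 1
  refine Finset.sum_congr rfl fun a _ ↦ ?_
  rw [Matrix.trace_mul_comm (𝕁 a), mul_comm (B * 𝕁 a).trace]

theorem mem_so {A : Mat n} : A ∈ so n ↔ Aᵀ = -A := by
  simp [so, LinearMap.mem_ker, add_eq_zero_iff_eq_neg]

theorem mem_spn {A : Mat n} : A ∈ spn n ↔ Aᵀ = -A ∧ ∀ a, 𝕁 a * A = A * 𝕁 a := by
  simp [spn, mem_so, Submodule.mem_iInf, LinearMap.mem_ker, sub_eq_zero]

theorem mem_spPerp {A : Mat n} :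
    A ∈ spPerp n ↔ Aᵀ = -A ∧ ∀ B ∈ spn n ⊔ sp1 n, (A * B).trace = 0 := by
  simp [spPerp, mem_so, Submodule.mem_iInf, LinearMap.mem_ker]

theorem obsPart_of_mem_spn {B : Mat n} (hB : B ∈ spn n) : obsPart B = 0 := by
  have h := (mem_spn.1 hB).2
  simp only [obsPart, sandwich_of_commute h, trace_mul_frameJ_of_commute h, zero_smul,
    Finset.sum_const_zero, smul_zero]
  module

theorem obsPart_frameJ (hn : n ≠ 0) (b : Fin 3) : obsPart (𝕁 b) = 0 := by
  have hn' : (n : ℝ) ≠ 0 := Nat.cast_ne_zero.2 hn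
  simp only [obsPart, sandwich_frameJ, trace_frameJ_mul, ite_smul, zero_smul,
    Finset.sum_ite_eq, Finset.mem_univ, if_true, smul_smul]
  rw [show (4 * n : ℝ)⁻¹ * -(4 * n) = -1 by field_simp]
  module

theorem obsPart_of_mem_sup (hn : n ≠ 0) {B : Mat n} (hB : B ∈ spn n ⊔ sp1 n) : obsPart B = 0 := by
  have : spn n ⊔ sp1 n ≤ LinearMap.ker (obsLinear n) := by
    refine sup_le (fun B hB ↦ obsPart_of_mem_spn hB) ?_
    rw [sp1, Submodule.span_le]
    rintro _ ⟨b, rfl⟩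
    exact obsPart_frameJ hn b
  exact this hB

/-- A quarter of `A - sandwich A` is the average of `A` over conjugation by `1, J_0, J_1, J_2`,
since `J_a⁻¹ = -J_a`. It is the projection to the commutant of the quaternions and explains the
coefficients `3/4` and `1/4` in `obsPart`. -/
theorem sandwich_commute (A : Mat n) (b : Fin 3) :
    𝕁 b * (A - sandwich A) = (A - sandwich A) * 𝕁 b := by
  have h02 := J02 (n := n)
  have h10 := J10 (n := n)
  have h21 := J21 (n := n)
  fin_cases b <;>
  · simp only [sandwich, Fin.sum_univ_three, Matrix.mul_sub, Matrix.sub_mul, Matrix.mul_add,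
      Matrix.add_mul, Fin.zero_eta, Fin.mk_one, Fin.reduceFinMk]
    simp only [← Matrix.mul_assoc, J01, J12, J20, J10, J21, J02, frameJ_sq]
    simp only [Matrix.mul_assoc, J01, J12, J20, J10, J21, J02, frameJ_sq]
    simp only [Matrix.neg_mul, Matrix.mul_neg, Matrix.one_mul, Matrix.mul_one]
    abel

theorem transpose_sandwich (A : Mat n) : (sandwich A)ᵀ = sandwich Aᵀ := by
  simp [sandwich, Matrix.transpose_sum, Matrix.transpose_mul, frameJ_transpose, Matrix.mul_assoc]

/-- The part removed from `A` is its commutant projection plus its projection to `sp(1)`. The latter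
carries the factor `-1/(4n)` because `tr(J_a J_b) = -4n δ_ab`. -/
theorem isObsPart_obsPart (hn : n ≠ 0) {A : Mat n} (hA : Aᵀ = -A) : IsObsPart A (obsPart A) := by
  have h1 : (obsPart A)ᵀ = - obsPart A := by
    have h2 : sandwich (-A) = - sandwich A := by simp [sandwich]
    simp only [obsPart, Matrix.transpose_add, Matrix.transpose_smul, transpose_sandwich, hA,
      Matrix.transpose_sum, frameJ_transpose, h2, smul_neg, Finset.sum_neg_distrib]
    abel
  refine ⟨mem_spPerp.2 ⟨h1, fun B hB ↦ ?_⟩, ?_⟩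
  · rw [trace_obsPart_mul, obsPart_of_mem_sup hn hB]
    simp
  · have : A - obsPart A = (1 / 4 : ℝ) • (A - sandwich A)
        + (-(4 * n : ℝ)⁻¹) • ∑ a, (A * 𝕁 a).trace • 𝕁 a := by
      simp only [obsPart]
      module
    rw [this]
    refine Submodule.add_mem_sup (Submodule.smul_mem _ _ (mem_spn.2 ⟨?_, sandwich_commute A⟩))
      (Submodule.smul_mem _ _ (Submodule.sum_mem _ fun a _ ↦ Submodule.smul_mem _ _
        (Submodule.subset_span ⟨a, rfl⟩)))
    rw [Matrix.transpose_sub, transpose_sandwich, hA]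
    simp [sandwich]
    abel

theorem IsObsPart.trace_mul {A C D : Mat n} (h : IsObsPart A C) (hD : D ∈ spPerp n) :
    (D * A).trace = (D * C).trace := by
  have := (mem_spPerp.1 hD).2 _ h.2
  rw [Matrix.mul_sub, Matrix.trace_sub] at this
  linarith

/-- Two components differ by an element of `sp(n) + sp(1)` orthogonal to itself, and the trace form
is definite on skew matrices. -/
theorem IsObsPart.eq_obsPart (hn : n ≠ 0) {A C : Mat n} (hA : Aᵀ = -A) (h : IsObsPart A C) :
    C = obsPart A := by
  have h0 := isObsPart_obsPart hn hA
  have h1 : C - obsPart A ∈ spn n ⊔ sp1 n := by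
    have := Submodule.sub_mem _ h0.2 h.2
    rwa [sub_sub_sub_cancel_left] at this
  have h2 : C - obsPart A ∈ spPerp n := Submodule.sub_mem _ h.1 h0.1
  have h3 := (mem_spPerp.1 h2).2 _ h1
  have h4 : ((C - obsPart A)ᵀ * (C - obsPart A)).trace = 0 := by
    rw [(mem_spPerp.1 h2).1, Matrix.neg_mul, Matrix.trace_neg, h3, neg_zero]
  rw [← sub_eq_zero]
  simpa using (Matrix.trace_conjTranspose_mul_self_eq_zero_iff (A := C - obsPart A)).1
    (by rwa [Matrix.conjTranspose_eq_transpose_of_trivial])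

/-- The vector `∑_p X_p e_p`. -/
def contract (X : Idx n → Mat n) : Idx n → ℝ := fun q ↦ ∑ p, X p q p

/-- The obstruction already lies in `(sp(n) + sp(1))^⊥`, so pairing it with `(e_p ∧ v)^⊥` is the
same as pairing it with `e_p ∧ v`. The sum over `p` is twice the dot product of the contraction with
`v`. -/
theorem ehComponentVanishes_iff (hn : n ≠ 0) {τ : Idx n → Mat n} (hτ : ∀ p, (τ p)ᵀ = - τ p) :
    EHComponentVanishes τ ↔ contract (fun p ↦ obsPart (τ p)) = 0 := by
  have hskew : ∀ p, (obsPart (τ p))ᵀ = - obsPart (τ p) := fun p ↦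
    (mem_spPerp.1 (isObsPart_obsPart hn (hτ p)).1).1
  have hw : ∀ (v : Idx n → ℝ) (p : Idx n),
      (vecMulVec (Pi.single p 1) v - vecMulVec v (Pi.single p 1))ᵀ
        = -(vecMulVec (Pi.single p 1) v - vecMulVec v (Pi.single p 1)) := fun v p ↦ by
    simp [Matrix.transpose_sub, Matrix.transpose_vecMulVec]
  have key : ∀ v : Idx n → ℝ, ∑ p, (obsPart (τ p) *
      (vecMulVec (Pi.single p 1) v - vecMulVec v (Pi.single p 1))).trace
        = 2 * (contract (fun p ↦ obsPart (τ p)) ⬝ᵥ v) := by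
    intro v
    have h1 : ∀ p, (obsPart (τ p) *
      (vecMulVec (Pi.single p 1) v - vecMulVec v (Pi.single p 1))).trace
        = 2 * ∑ q, obsPart (τ p) q p * v q := by
      intro p
      have h2 : ∀ q, obsPart (τ p) p q = - obsPart (τ p) q p := fun q ↦
        congrFun (congrFun (hskew p) q) p
      rw [Matrix.mul_sub, Matrix.trace_sub, Matrix.mul_vecMulVec, Matrix.mul_vecMulVec,
        Matrix.trace_vecMulVec, Matrix.trace_vecMulVec]
      simp [dotProduct, Matrix.mulVec, h2, two_mul, Pi.single_apply]
    simp only [h1, dotProduct, contract, Finset.sum_mul, ← Finset.mul_sum]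
    rw [Finset.sum_comm]
  constructor
  · intro h
    have h0 := h (fun p ↦ obsPart (τ p)) (fun p ↦ isObsPart_obsPart hn (hτ p)) _
      ⟨contract (fun p ↦ obsPart (τ p)), fun p ↦ isObsPart_obsPart hn (hw _ p)⟩
    -- Taking `v` to be the contraction itself turns the pairing into twice its squared length.
    rw [Finset.sum_congr rfl fun p _ ↦ ((isObsPart_obsPart hn (hw
      (contract (fun p ↦ obsPart (τ p))) p)).trace_mul (isObsPart_obsPart hn (hτ p)).1).symm,
      key] at h0
    exact dotProduct_self_eq_zero.1 (by linarith)
  · rintro h obs hobs σ ⟨v, hv⟩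
    obtain rfl : obs = fun p ↦ obsPart (τ p) := funext fun p ↦ (hobs p).eq_obsPart hn (hτ p)
    rw [Finset.sum_congr rfl fun p _ ↦ ((hv p).trace_mul (hobs p).1).symm, key, h]
    simp

end Quaternionic

/-! ### Contraction of the first-order change of the connection forms. -/

section Variation

open Matrix

variable {n : ℕ}

theorem contract_add (X Y : Idx n → Mat n) : contract (X + Y) = contract X + contract Y := by
  ext q
  simp [contract, Finset.sum_add_distrib]

theorem contract_smul (c : ℝ) (X : Idx n → Mat n) : contract (c • X) = c • contract X := by
  ext q
  simp [contract, Finset.mul_sum]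

theorem contract_sum {ι : Type*} (s : Finset ι) (X : ι → Idx n → Mat n) :
    contract (∑ i ∈ s, X i) = ∑ i ∈ s, contract (X i) := by
  ext q
  simp only [contract, Finset.sum_apply, Matrix.sum_apply]
  rw [Finset.sum_comm]

/-- The algebraic form of the change of the connection under a change of the three-plane field,
contributed by one of the forms `θ_a`. -/
def variation (W : Mat n) (u : Idx n → ℝ) (p : Idx n) : Mat n :=
  Matrix.of fun r q ↦ (1 / 2) * (W p q * u r - W q r * u p + W r p * u q)

/-- Two rank one matrices and a multiple of `W`: in this form products and traces can be evaluated.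
-/
theorem variation_eq (W : Mat n) (hW : Wᵀ = -W) (u : Idx n → ℝ) (p : Idx n) :
    variation W u p = (1 / 2 : ℝ) • (vecMulVec u (W p) + u p • W + vecMulVec (- W p) u) := by
  have h : ∀ i j, W i j = - W j i := fun i j ↦ congrFun (congrFun hW j) i
  ext r q
  simp [variation, vecMulVec_apply]
  rw [h q r, h r p]
  ring

theorem contract_sandwich_variation (W : Mat n) (hW : Wᵀ = -W) (u : Idx n → ℝ) (A B : Mat n) :
    contract (fun p ↦ A * variation W u p * B)
      = (1 / 2 : ℝ) • ((W * B).trace • (A *ᵥ u) + (A * W * B) *ᵥ u + (A * W * Bᵀ) *ᵥ u) := by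
  have h : ∀ i j, W i j = - W j i := fun i j ↦ congrFun (congrFun hW j) i
  have e : ∀ p, A * variation W u p * B = (1 / 2 : ℝ) • (vecMulVec (A *ᵥ u) (W p ᵥ* B)
      + u p • (A * W * B) + vecMulVec (A *ᵥ (- W p)) (u ᵥ* B)) := by
    intro p
    rw [variation_eq W hW]
    simp only [Matrix.mul_smul, Matrix.smul_mul, Matrix.mul_add, Matrix.add_mul,
      Matrix.mul_vecMulVec, Matrix.vecMulVec_mul]
  have h3 : (A * W * Bᵀ) *ᵥ u = A *ᵥ (W *ᵥ (u ᵥ* B)) := by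
    rw [← Matrix.mulVec_transpose, Matrix.mulVec_mulVec, Matrix.mulVec_mulVec]
  rw [h3]
  ext q
  simp only [contract, e, Matrix.smul_apply, Matrix.add_apply, vecMulVec_apply, Pi.smul_apply,
    Pi.add_apply, smul_eq_mul, ← Finset.mul_sum, Finset.sum_add_distrib]
  congr 2
  · congr 1
    · rw [mul_comm]
      rfl
    · simp [Matrix.mulVec, dotProduct, mul_comm]
  · simp only [Matrix.mulVec, dotProduct, Finset.sum_mul, Pi.neg_apply, Finset.mul_sum]
    rw [Finset.sum_comm]
    refine Finset.sum_congr rfl fun i _ ↦ Finset.sum_congr rfl fun p _ ↦ ?_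
    rw [h i p]
    ring

theorem contract_trace_variation (W : Mat n) (hW : Wᵀ = -W) (u : Idx n → ℝ) {J : Mat n}
    (hJ : Jᵀ = -J) : contract (fun p ↦ (variation W u p * J).trace • J)
      = (J * W * J) *ᵥ u + ((1 / 2) * (W * J).trace) • (J *ᵥ u) := by
  have e : ∀ p, (variation W u p * J).trace
      = ((W * J) *ᵥ u) p + (1 / 2) * (W * J).trace * u p := by
    intro p
    rw [variation_eq W hW]
    simp only [Matrix.smul_mul, Matrix.add_mul, Matrix.trace_smul, Matrix.trace_add,
      Matrix.vecMulVec_mul, Matrix.trace_vecMulVec, smul_eq_mul]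
    have h1 : u ⬝ᵥ W p ᵥ* J = ((W * J) *ᵥ u) p := by
      rw [dotProduct_comm, ← Matrix.dotProduct_mulVec, ← Matrix.mulVec_mulVec]
      rfl
    have h2 : -W p ⬝ᵥ u ᵥ* J = ((W * J) *ᵥ u) p := by
      rw [← Matrix.mulVec_transpose, hJ, neg_dotProduct, Matrix.neg_mulVec, dotProduct_neg,
        neg_neg, ← Matrix.mulVec_mulVec]
      rfl
    rw [h1, h2]
    ring
  ext q
  simp only [contract, e, Matrix.smul_apply, smul_eq_mul, Pi.add_apply, Pi.smul_apply, add_mul,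
    Finset.sum_add_distrib, Matrix.mul_assoc]
  rw [← Matrix.mulVec_mulVec u J]
  congr 1
  · simp only [Matrix.mulVec, dotProduct, mul_comm (J q _)]
  · simp only [Matrix.mulVec, dotProduct, Finset.mul_sum]
    exact Finset.sum_congr rfl fun i _ ↦ by ring

/-- The three summands of `obsPart` are contracted separately. The identity term uses `tr W = 0`; in
the sandwich term the contributions `J W J` and `J W Jᵀ` cancel, leaving only traces. -/
theorem contract_obsPart_variation (W : Mat n) (hW : Wᵀ = -W) (u : Idx n → ℝ) :
    contract (fun p ↦ obsPart (variation W u p))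
      = (3 / 4 : ℝ) • (W *ᵥ u) + (4 * n : ℝ)⁻¹ • (sandwich W *ᵥ u)
        + ∑ b, ((1 / 8 + (1 / 2) * (4 * n : ℝ)⁻¹) * (W * frameJ n b).trace) • (frameJ n b *ᵥ u) := by
  have h0 : W.trace = 0 := by
    have := congrArg Matrix.trace hW
    rw [Matrix.trace_transpose, Matrix.trace_neg] at this
    linarith
  have e : (fun p ↦ obsPart (variation W u p))
      = (3 / 4 : ℝ) • (fun p ↦ 1 * variation W u p * 1)
        + (1 / 4 : ℝ) • (∑ b, fun p ↦ frameJ n b * variation W u p * frameJ n b)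
        + (4 * n : ℝ)⁻¹ • (∑ b, fun p ↦ (variation W u p * frameJ n b).trace • frameJ n b) := by
    funext p
    simp [obsPart, sandwich]
  rw [e, contract_add, contract_add, contract_smul, contract_smul, contract_smul, contract_sum,
    contract_sum, contract_sandwich_variation W hW]
  simp only [contract_sandwich_variation W hW,
    contract_trace_variation W hW _ (frameJ_transpose _), frameJ_transpose, sandwich,
    Matrix.add_mulVec, Matrix.mul_neg, Matrix.neg_mulVec, Matrix.mul_one,
    Matrix.one_mul, Matrix.transpose_one, h0, Fin.sum_univ_three]
  module

/-- The change of the contraction of the obstruction under a change of the three-plane field. -/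
theorem contract_obsPart_sum_variation (hn : n ≠ 0) (W : Fin 3 → Mat n)
    (hW : ∀ a, (W a)ᵀ = - W a)
    (hB : ∀ a b, frameJ n b * (W a + frameJ n a) = (W a + frameJ n a) * frameJ n b)
    (v : Idx n → ℝ) :
    contract (fun p ↦ obsPart (∑ a, variation (W a) (frameJ n a *ᵥ v) p))
      = -(3 * (n - 1) / (4 * n) : ℝ) •
        ((2 * (n : ℝ) + 4) • v - ∑ a, (W a * frameJ n a) *ᵥ v) := by
  have hn' : (n : ℝ) ≠ 0 := Nat.cast_ne_zero.2 hn
  have e : (fun p ↦ obsPart (∑ a, variation (W a) (frameJ n a *ᵥ v) p))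
      = ∑ a, fun p ↦ obsPart (variation (W a) (frameJ n a *ᵥ v) p) := by
    funext p
    rw [Finset.sum_apply]
    exact map_sum (obsLinear n) _ _
  -- `W_a + J_a` commutes with the quaternions, so its trace against `J_b` vanishes and that of
  -- `W_a` is opposite to that of `J_a`.
  have htr : ∀ a b, (W a * frameJ n b).trace = if a = b then (4 * n : ℝ) else 0 := by
    intro a b
    have h1 := trace_mul_frameJ_of_commute (hB a) b
    rw [Matrix.add_mul, Matrix.trace_add, trace_frameJ_mul] at h1
    split_ifs at h1 ⊢ <;> linarith
  -- The sandwich acts as `-3` on the commuting matrix `W_a + J_a` and as `1` on `J_a`.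
  have hs : ∀ a, sandwich (W a) = (-3 : ℝ) • W a - (4 : ℝ) • frameJ n a := by
    intro a
    have h1 := sandwich_of_commute (hB a)
    have h2 : sandwich (W a + frameJ n a) = sandwich (W a) + frameJ n a := by
      conv_rhs => rw [← sandwich_frameJ a]
      simp only [sandwich, Matrix.mul_add, Matrix.add_mul, Finset.sum_add_distrib]
    rw [h2] at h1
    rw [eq_sub_of_add_eq h1]
    module
  have key : ∀ a, contract (fun p ↦ obsPart (variation (W a) (frameJ n a *ᵥ v) p))
      = (3 / 4 - 3 * (4 * n : ℝ)⁻¹) • ((W a * frameJ n a) *ᵥ v)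
        + (4 * (4 * n : ℝ)⁻¹ - (1 / 8 + (1 / 2) * (4 * n : ℝ)⁻¹) * (4 * n)) • v := by
    intro a
    rw [contract_obsPart_variation _ (hW a)]
    simp only [htr, hs, mul_ite, mul_zero, ite_smul, zero_smul, Finset.sum_ite_eq,
      Finset.mem_univ, if_true, Matrix.mulVec_mulVec, Matrix.sub_mul, Matrix.smul_mul, frameJ_sq,
      Matrix.sub_mulVec, Matrix.smul_mulVec, Matrix.neg_mulVec, Matrix.one_mulVec]
    module
  rw [e, contract_sum]
  simp only [key, Finset.sum_add_distrib, Fin.sum_univ_three]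
  -- Summed over `a`, the coefficient of `v` is `3(1/n - n/2 - 1/2) = -(3(n-1)/(4n)) (2n+4)`: the
  -- same factor as in front of `∑ W_a J_a`. This is how the form `h` arises.
  match_scalars
  all_goals field_simp
  all_goals ring

end Variation

/-! ### The matrices of `dθ_a` and of `h` in an adapted frame. -/

section DForm

open Matrix

variable {n : ℕ} {M : Type*} [TopologicalSpace M] [ChartedSpace (Model n) M]
  [IsManifold 𝓘(ℝ, Model n) ∞ M]

/-- The matrix of the restriction of `dθ_a` to the core. -/
def dMatrix (θ : Fin 3 → Π x : M, Tan n x →L[ℝ] ℝ) (ε : Idx n → VF n M) (a : Fin 3) (x : M) :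
    Mat n :=
  Matrix.of fun p q ↦ dForm (θ a) x (ε p x) (ε q x)

/-- The three hypotheses encode the `I_a`-invariance of `dθ_a`, the relation between `dθ_b` and
`dθ_c`, and orthonormality for the Levi form. Since the units generate each other, for each `a` it
suffices to know two of the three commutation relations; the one with `J_a` is the first hypothesis.
-/
theorem commute_frameJ_of_relations {W : Fin 3 → Mat n}
    (h1 : ∀ a, frameJ n a * W a * frameJ n a = - W a)
    (h2 : ∀ a, W (a + 1) + frameJ n a * W (a + 1) * frameJ n a
      = W (a + 2) * frameJ n a - frameJ n a * W (a + 2))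
    (h3 : W 0 * frameJ n 0 - frameJ n 1 * W 0 * frameJ n 2 = (2 : ℝ) • 1) (a b : Fin 3) :
    frameJ n b * (W a + frameJ n a) = (W a + frameJ n a) * frameJ n b := by
  have c0 : ∀ a, frameJ n a * (W a + frameJ n a) = (W a + frameJ n a) * frameJ n a := by
    intro a
    have h4 := congrArg (frameJ n a * ·) (h1 a)
    simp only [Matrix.mul_assoc, frameJ_sq_assoc, Matrix.mul_neg] at h4
    rw [Matrix.mul_add, Matrix.add_mul, ← neg_inj.1 h4]
  -- The Levi normalization determines the commutator of `W_0` with `J_1`, since the Levi form is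
  -- built from `θ_0`.
  have e1 : frameJ n 1 * W 0 - W 0 * frameJ n 1 = (2 : ℝ) • frameJ n 2 := by
    have h4 := congrArg (fun X ↦ frameJ n 1 * (X * frameJ n 0)) h3
    simp only [Matrix.sub_mul, Matrix.mul_sub, Matrix.mul_assoc, frameJ_sq_assoc, frameJ_sq, J20,
      J10, Matrix.mul_neg, Matrix.mul_one, Matrix.smul_mul, Matrix.mul_smul, Matrix.one_mul] at h4
    linear_combination (norm := module) -h4
  have c01 : frameJ n 1 * (W 0 + frameJ n 0) = (W 0 + frameJ n 0) * frameJ n 1 := by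
    rw [Matrix.mul_add, Matrix.add_mul, J10, J01]
    linear_combination (norm := module) e1
  have c02 : frameJ n 2 * (W 0 + frameJ n 0) = (W 0 + frameJ n 0) * frameJ n 2 := by
    rw [← J01, Matrix.mul_assoc, c01, ← Matrix.mul_assoc, c0, Matrix.mul_assoc]
  -- The second relation carries the information about `W_0` over to `W_2`, with `a = 1`, and below
  -- to `W_1`, with `a = 2`.
  have e2 : frameJ n 1 * W 2 - W 2 * frameJ n 1 = -(2 : ℝ) • frameJ n 0 := by
    have h4 : W 2 + frameJ n 1 * W 2 * frameJ n 1 = W 0 * frameJ n 1 - frameJ n 1 * W 0 := h2 1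
    have h5 := congrArg (frameJ n 1 * ·) (h4.trans ((neg_sub _ _).symm.trans (congrArg Neg.neg e1)))
    simp only [Matrix.mul_add, Matrix.mul_assoc, frameJ_sq_assoc, Matrix.mul_neg, Matrix.mul_smul,
      J12] at h5
    linear_combination (norm := module) h5
  have c21 : frameJ n 1 * (W 2 + frameJ n 2) = (W 2 + frameJ n 2) * frameJ n 1 := by
    rw [Matrix.mul_add, Matrix.add_mul, J12, J21]
    linear_combination (norm := module) e2
  have c20 : frameJ n 0 * (W 2 + frameJ n 2) = (W 2 + frameJ n 2) * frameJ n 0 := by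
    rw [← J12, Matrix.mul_assoc, c0, ← Matrix.mul_assoc, c21, Matrix.mul_assoc]
  have e3 : frameJ n 2 * W 1 - W 1 * frameJ n 2 = (2 : ℝ) • frameJ n 0 := by
    have h4 : W 0 + frameJ n 2 * W 0 * frameJ n 2 = W 1 * frameJ n 2 - frameJ n 2 * W 1 := h2 2
    have h5 := congrArg (· * frameJ n 2) c02
    simp only [Matrix.mul_add, Matrix.add_mul, Matrix.mul_assoc, frameJ_sq, J02, J20,
      Matrix.mul_neg, Matrix.neg_mul, Matrix.mul_one, J12] at h5
    rw [← Matrix.mul_assoc] at h5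
    linear_combination (norm := module) h4 - h5
  have c12 : frameJ n 2 * (W 1 + frameJ n 1) = (W 1 + frameJ n 1) * frameJ n 2 := by
    rw [Matrix.mul_add, Matrix.add_mul, J12, J21]
    linear_combination (norm := module) e3
  have c10 : frameJ n 0 * (W 1 + frameJ n 1) = (W 1 + frameJ n 1) * frameJ n 0 := by
    rw [← J12, Matrix.mul_assoc, c12, ← Matrix.mul_assoc, c0, Matrix.mul_assoc]
  fin_cases a <;> fin_cases b
  exacts [c0 0, c01, c02, c10, c0 1, c12, c20, c21, c0 2]

namespace IsMovingFrame

variable {V : Set M} {H : Triple n M} {θ : Fin 3 → Π x : M, Tan n x →L[ℝ] ℝ}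
  {ε : Idx n → VF n M} {T : Fin 3 → VF n M} (F : IsMovingFrame V H θ ε T) {x : M}

include F

theorem dMatrix_transpose (a : Fin 3) : (dMatrix θ ε a x)ᵀ = - dMatrix θ ε a x := by
  ext p q
  exact dForm_swap _ _

theorem dForm_eps_J (hx : x ∈ V) (a c : Fin 3) (p q : Idx n) :
    dForm (θ a) x (ε p x) (H.J c x (ε q x)) = (dMatrix θ ε a x * frameJ n c) p q := by
  obtain ⟨B, hB⟩ := exists_dForm_eq (F.ph.compatible.smooth a) F.ph.isOpen hx
  simp [F.J_eps hx, hB, dMatrix, Matrix.mul_apply, mul_comm]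

theorem dForm_J_eps (hx : x ∈ V) (a b : Fin 3) (p q : Idx n) :
    dForm (θ a) x (H.J b x (ε p x)) (ε q x) = - (frameJ n b * dMatrix θ ε a x) p q := by
  rw [dForm_swap, F.dForm_eps_J hx]
  have := congrArg Matrix.transpose (rfl : dMatrix θ ε a x * frameJ n b = _)
  rw [← Matrix.transpose_apply (_ * _), Matrix.transpose_mul, frameJ_transpose,
    F.dMatrix_transpose, neg_mul_neg]

theorem dForm_J_J (hx : x ∈ V) (a b c : Fin 3) (p q : Idx n) :
    dForm (θ a) x (H.J b x (ε p x)) (H.J c x (ε q x))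
      = - (frameJ n b * dMatrix θ ε a x * frameJ n c) p q := by
  obtain ⟨B, hB⟩ := exists_dForm_eq (F.ph.compatible.smooth a) F.ph.isOpen hx
  have h1 := F.dForm_J_eps hx a b p
  rw [F.J_eps hx c, hB, map_sum, Matrix.mul_apply, ← Finset.sum_neg_distrib]
  refine Finset.sum_congr rfl fun r _ ↦ ?_
  rw [map_smul, ← hB, h1, smul_eq_mul]
  ring

theorem levi_eps (hx : x ∈ V) (p q : Idx n) :
    levi H θ x (ε p x) (ε q x) = (1 : Mat n) p q := by
  rw [F.adapted.orthonormal x hx, Matrix.one_apply]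

/-- Equivalently, `dθ_a` and `-g(·, I_a ·)` differ by a form invariant under all three complex
structures. Although the Levi form is defined by `θ_0` alone, this holds for every `a`. -/
theorem dMatrix_commute (hx : x ∈ V) (a b : Fin 3) :
    frameJ n b * (dMatrix θ ε a x + frameJ n a) = (dMatrix θ ε a x + frameJ n a) * frameJ n b := by
  refine commute_frameJ_of_relations (W := fun a ↦ dMatrix θ ε a x) (fun a ↦ ?_) (fun a ↦ ?_) ?_ a b
  · ext p q
    have h1 := F.ph.dForm_J hx (F.eps_mem hx p) (F.eps_mem hx q) a
    rw [F.dForm_J_J hx] at h1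
    simp only [Matrix.neg_apply, dMatrix, Matrix.of_apply] at h1 ⊢
    linarith
  · ext p q
    have h1 := F.ph.dForm_J_succ hx (F.eps_mem hx p) (F.eps_mem hx q) a
    rw [F.dForm_J_J hx, F.dForm_eps_J hx, F.dForm_J_eps hx] at h1
    simp only [Matrix.sub_apply, Matrix.add_apply]
    rw [show dMatrix θ ε (a + 1) x p q = dForm (θ (a + 1)) x (ε p x) (ε q x) from rfl]
    linarith
  · ext p q
    have h1 := F.levi_eps hx p q
    rw [levi, F.dForm_J_J hx, F.dForm_eps_J hx] at h1
    simp only [Matrix.sub_apply, Matrix.smul_apply, smul_eq_mul]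
    linarith

/-- The matrix of the form `h`. -/
theorem ultraForm_eps (hx : x ∈ V) (p q : Idx n) :
    ultraForm H θ x (ε p x) (ε q x)
      = ((2 * (n : ℝ) + 4) • (1 : Mat n) - ∑ a, dMatrix θ ε a x * frameJ n a) p q := by
  rw [ultraForm, F.levi_eps hx]
  simp only [F.dForm_eps_J hx, Matrix.sub_apply, Matrix.smul_apply, Matrix.sum_apply, smul_eq_mul]

theorem ultraForm_sum (hx : x ∈ V) (v : Idx n → ℝ) :
    ultraForm H θ x (∑ p, v p • ε p x) (∑ p, v p • ε p x)
      = v ⬝ᵥ (((2 * (n : ℝ) + 4) • (1 : Mat n) - ∑ a, dMatrix θ ε a x * frameJ n a) *ᵥ v) := by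
  obtain ⟨L, hL⟩ := F.ph.exists_levi_eq hx
  choose B hB using fun a ↦ exists_dForm_eq (F.ph.compatible.smooth a) F.ph.isOpen hx
  obtain ⟨G, hG⟩ : ∃ G : Tan n x →ₗ[ℝ] Tan n x →ₗ[ℝ] ℝ, ∀ v w, ultraForm H θ x v w = G v w :=
    ⟨(2 * (n : ℝ) + 4) • L - ∑ a, (B a).compl₂ (H.J a x), fun v w ↦ by
      simp [ultraForm, hL, hB, LinearMap.sum_apply]⟩
  have h1 := F.ultraForm_eps hx
  simp only [dotProduct, Matrix.mulVec, ← h1]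
  simp only [hG, map_sum, map_smul, LinearMap.sum_apply, LinearMap.smul_apply, smul_eq_mul,
    Finset.mul_sum]
  rw [Finset.sum_comm]
  exact Finset.sum_congr rfl fun p _ ↦ Finset.sum_congr rfl fun q _ ↦ by ring

/-- A null vector of the matrix of `h` would be a vector on which `h` vanishes, contrary to
definiteness of either sign. -/
theorem eq_zero_of_ultraForm (hx : x ∈ V)
    (hU : (∀ v ∈ H.core x, v ≠ 0 → 0 < ultraForm H θ x v v) ∨
      ∀ v ∈ H.core x, v ≠ 0 → ultraForm H θ x v v < 0) {v : Idx n → ℝ}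
    (hv : ((2 * (n : ℝ) + 4) • (1 : Mat n) - ∑ a, dMatrix θ ε a x * frameJ n a) *ᵥ v = 0) :
    v = 0 := by
  have h1 := F.ultraForm_sum hx v
  rw [hv, dotProduct_zero] at h1
  have hmem : ∑ p, v p • ε p x ∈ H.core x :=
    Submodule.sum_mem _ fun p _ ↦ Submodule.smul_mem _ _ (F.eps_mem hx p)
  have h2 : ∑ p, v p • ε p x = 0 := by
    by_contra hne
    rcases hU with hU | hU <;> linarith [hU _ hmem hne]
  obtain ⟨L, hL⟩ := F.ph.exists_levi_eq hx
  ext q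
  have h3 := congrArg (fun w ↦ L w (ε q x)) h2
  simpa [LinearMap.sum_apply, ← hL, F.adapted.orthonormal x hx] using h3

theorem det_ultraForm_ne_zero (hx : x ∈ V)
    (hU : (∀ v ∈ H.core x, v ≠ 0 → 0 < ultraForm H θ x v v) ∨
      ∀ v ∈ H.core x, v ≠ 0 → ultraForm H θ x v v < 0) :
    ((2 * (n : ℝ) + 4) • (1 : Mat n) - ∑ a, dMatrix θ ε a x * frameJ n a).det ≠ 0 := by
  intro h0
  obtain ⟨v, hv, hv0⟩ := Matrix.exists_mulVec_eq_zero_iff.2 h0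
  exact hv (F.eq_zero_of_ultraForm hx hU hv0)

end IsMovingFrame

end DForm

/-! ### Uniqueness of the associated connection: its Christoffel symbols. -/

section Associated

variable {n : ℕ} {M : Type*} [TopologicalSpace M] [ChartedSpace (Model n) M]
  [IsManifold 𝓘(ℝ, Model n) ∞ M]

section Symbols

variable {ι : Type*} [Fintype ι]

/-- The structure functions of a frame: `[E_i, E_j] = ∑_k c_{ij}^k E_k`. -/
def structureFn {E : ι → VF n M} {V : Set M} (hE : IsFrame E V) (i j k : ι) (x : M) : ℝ :=
  hE.coeff k x (bracket (E i) (E j) x)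

theorem structureFn_smooth {E : ι → VF n M} {V : Set M} (hE : IsFrame E V) (hV : IsOpen V)
    (i j k : ι) : FSmoothOn n (structureFn hE i j k) V :=
  hE.coeff_smooth hV hV subset_rfl (SmoothOn.bracket hV (hE.contMDiffOn i) (hE.contMDiffOn j)) k

theorem structureFn_swap {E : ι → VF n M} {V : Set M} (hE : IsFrame E V) (i j k : ι) (x : M) :
    structureFn hE j i k x = - structureFn hE i j k x := by
  rw [structureFn, bracket_swap, map_neg, structureFn]

theorem coeff_sum_smul [DecidableEq ι] {E : ι → VF n M} {V : Set M} (hE : IsFrame E V) {x : M}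
    (hx : x ∈ V) (f : ι → ℝ) (k : ι) : hE.coeff k x (∑ j, f j • E j x) = f k := by
  simp [hE.coeff_self hx]

theorem coeff_connection [DecidableEq ι] {D : ConnectionMap n M} {V : Set M}
    (hD : IsCovariantDerivativeOn (Model n) D V) {E : ι → VF n M} (hE : IsFrame E V)
    (hV : IsOpen V) {x : M} (hx : x ∈ V) {Y : VF n M} (hY : DiffAt Y x) (w : Tan n x) (k : ι) :
    hE.coeff k x (D Y x w) = mvfderiv 𝓘(ℝ, Model n) (fun y ↦ hE.coeff k y (Y y)) x w
      + ∑ i, ∑ j, hE.coeff i x w * hE.coeff j x (Y x) * hE.coeff k x (D (E j) x (E i x)) := by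
  rw [connection_expand hD hE hV hx hY w]
  have h1 : ∀ j, hE.coeff k x (D (E j) x w)
      = ∑ i, hE.coeff i x w * hE.coeff k x (D (E j) x (E i x)) := by
    intro j
    conv_lhs => rw [← hE.sum_coeff hx w]
    simp
  simp only [Finset.sum_add_distrib, map_add, coeff_sum_smul hE hx]
  rw [add_comm, Finset.sum_comm]
  congr 1
  simp only [map_sum, map_smul, h1, smul_eq_mul, Finset.mul_sum]
  exact Finset.sum_congr rfl fun j _ ↦ Finset.sum_congr rfl fun i _ ↦ by ring

theorem coeff_torsion [DecidableEq ι] {D : ConnectionMap n M} {V : Set M}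
    (hD : IsCovariantDerivativeOn (Model n) D V) {E : ι → VF n M} (hE : IsFrame E V)
    (hV : IsOpen V) {x : M} (hx : x ∈ V) {X Y : VF n M} (hX : DiffAt X x) (hY : DiffAt Y x)
    (k : ι) : hE.coeff k x (torsion D X Y x)
      = ∑ i, ∑ j, hE.coeff i x (X x) * hE.coeff j x (Y x) * (hE.coeff k x (D (E j) x (E i x))
        - hE.coeff k x (D (E i) x (E j x)) - structureFn hE i j k x) := by
  rw [torsion_expand hD hE hV hx hX hY]
  simp [torsion, structureFn]

end Symbols

/-- The Christoffel symbols of the associated connection in terms of the structure functions. -/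
def assocSymbol {α β : Type*} (c : α ⊕ β → α ⊕ β → α ⊕ β → ℝ) (i j k : α ⊕ β) : ℝ :=
  if j.isLeft = k.isLeft then
    if i.isLeft = j.isLeft then (1 / 2) * (c i j k - c j k i + c k i j)
    else (1 / 2) * (c i j k - c i k j)
  else 0

section AssocSymbol

variable {α β : Type*} {c : α ⊕ β → α ⊕ β → α ⊕ β → ℝ} (hc : ∀ i j k, c j i k = - c i j k)

include hc

theorem assocSymbol_skew (i j k : α ⊕ β) : assocSymbol c i k j = - assocSymbol c i j k := by
  have h1 := hc i j k
  have h2 := hc i k j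
  have h3 := hc j k i
  simp only [assocSymbol]
  split_ifs <;> simp_all <;> linarith

/-- Within one summand the symbol is Koszul's expression for an orthonormal frame, which is
torsion-free by construction. -/
theorem assocSymbol_torsion {i j k : α ⊕ β} (hij : i.isLeft = j.isLeft)
    (hjk : j.isLeft = k.isLeft) : assocSymbol c i j k - assocSymbol c j i k = c i j k := by
  have h1 := hc i j k
  have h2 := hc i k j
  have h3 := hc j k i
  simp only [assocSymbol, hij, hjk, if_pos]
  linarith

/-- In the mixed case symmetry of the torsion says that symbol minus bracket coefficient is
symmetric in `j, k`. As the symbol is skew there, it must be the skew part of the bracket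
coefficient. -/
theorem assocSymbol_symm {i j k : α ⊕ β} (hij : i.isLeft ≠ j.isLeft)
    (hjk : j.isLeft = k.isLeft) :
    assocSymbol c i j k - c i j k = assocSymbol c i k j - c i k j := by
  simp only [assocSymbol, hjk, if_true]
  rw [hjk] at hij
  simp only [hij, if_false]
  ring

end AssocSymbol

namespace IsMovingFrame

variable {U V : Set M} {H : Triple n M} {θ : Fin 3 → Π x : M, Tan n x →L[ℝ] ℝ}
  {ε : Idx n → VF n M} {T : Fin 3 → VF n M} (F : IsMovingFrame V H θ ε T) {x : M}
  {P : Π x : M, Submodule ℝ (Tan n x)} {D : ConnectionMap n M}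

include F

theorem mem_core_iff (hx : x ∈ V) {v : Tan n x} :
    v ∈ H.core x ↔ ∀ a, F.isFrame.coeff (Sum.inr a) x v = 0 := by
  simp only [F.coeff_inr hx, F.ph.mem_core_iff hx]

theorem mem_span_iff (hx : x ∈ V) {v : Tan n x} :
    v ∈ Submodule.span ℝ (Set.range fun a ↦ T a x) ↔
      ∀ p, F.isFrame.coeff (Sum.inl p) x v = 0 := by
  constructor
  · intro hv p
    have : Submodule.span ℝ (Set.range fun a ↦ T a x)
        ≤ LinearMap.ker (F.isFrame.coeff (Sum.inl p) x) := by
      rw [Submodule.span_le]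
      rintro _ ⟨a, rfl⟩
      have := F.isFrame.coeff_self hx (Sum.inl p) (Sum.inr a)
      simpa using this
    exact this hv
  · intro h
    rw [F.sum_eps hx v]
    simp only [h, zero_smul, Finset.sum_const_zero, zero_add]
    exact Submodule.sum_mem _ fun a _ ↦ Submodule.smul_mem _ _ (Submodule.subset_span ⟨a, rfl⟩)

theorem sum_eps_mem (hx : x ∈ V) (f : Idx n → ℝ) : ∑ p, f p • ε p x ∈ H.core x :=
  Submodule.sum_mem _ fun p _ ↦ Submodule.smul_mem _ _ (F.eps_mem hx p)

omit F in
theorem sum_T_mem (f : Fin 3 → ℝ) :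
    ∑ a, f a • T a x ∈ Submodule.span ℝ (Set.range fun a ↦ T a x) :=
  Submodule.sum_mem _ fun a _ ↦ Submodule.smul_mem _ _ (Submodule.subset_span ⟨a, rfl⟩)

theorem isCompl (hx : x ∈ V) :
    IsCompl (H.core x) (Submodule.span ℝ (Set.range fun a ↦ T a x)) := by
  constructor
  · rw [Submodule.disjoint_def]
    intro v hv hv'
    rw [F.sum_eps hx v]
    simp [(F.mem_span_iff hx).1 hv', F.ph.theta_core hx hv]
  · rw [codisjoint_iff, Submodule.eq_top_iff']
    intro v
    rw [F.sum_eps hx v]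
    exact Submodule.add_mem_sup (F.sum_eps_mem hx _) (sum_T_mem _)

theorem component_core (hx : x ∈ V) (hP : P x = Submodule.span ℝ (Set.range fun a ↦ T a x))
    (v : Tan n x) :
    component (H.core x) (P x) v = ∑ p, F.isFrame.coeff (Sum.inl p) x v • ε p x := by
  have h := F.isCompl hx
  rw [← hP] at h
  rw [component, dif_pos h]
  conv_lhs => rw [F.sum_eps hx v]
  rw [map_add, Submodule.projectionOnto_apply_of_mem_left h (F.sum_eps_mem hx _),
    (Submodule.projectionOnto_apply_eq_zero_iff h).2 (by rw [hP]; exact sum_T_mem _), add_zero]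

theorem component_perp (hx : x ∈ V) (hP : P x = Submodule.span ℝ (Set.range fun a ↦ T a x))
    (v : Tan n x) : component (P x) (H.core x) v = ∑ a, θ a x v • T a x := by
  have h := (F.isCompl hx).symm
  rw [← hP] at h
  rw [component, dif_pos h]
  conv_lhs => rw [F.sum_eps hx v]
  rw [map_add, Submodule.projectionOnto_apply_of_mem_left h (x := ∑ a, θ a x v • T a x)
    (by rw [hP]; exact sum_T_mem _),
    (Submodule.projectionOnto_apply_eq_zero_iff h).2 (F.sum_eps_mem hx _), zero_add]

theorem levi_sum (hx : x ∈ V) (f g : Idx n → ℝ) :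
    levi H θ x (∑ p, f p • ε p x) (∑ p, g p • ε p x) = ∑ p, f p * g p := by
  obtain ⟨L, hL⟩ := F.ph.exists_levi_eq hx
  have hort : ∀ p q, L (ε p x) (ε q x) = if p = q then 1 else 0 := fun p q ↦ by
    rw [← hL]; exact F.adapted.orthonormal x hx p q
  simp [hL, LinearMap.sum_apply, hort, mul_comm]

theorem levi_eq_sum (hx : x ∈ V) {v w : Tan n x} (hv : v ∈ H.core x) (hw : w ∈ H.core x) :
    levi H θ x v w
      = ∑ p, F.isFrame.coeff (Sum.inl p) x v * F.isFrame.coeff (Sum.inl p) x w := by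
  rw [← F.levi_sum hx]
  conv_lhs => rw [F.sum_eps hx v, F.sum_eps hx w]
  simp [F.ph.theta_core hx hv, F.ph.theta_core hx hw]

theorem leviExt_eq (hx : x ∈ V) (hP : P x = Submodule.span ℝ (Set.range fun a ↦ T a x))
    (v w : Tan n x) : leviExt H θ P x v w
      = ∑ p, F.isFrame.coeff (Sum.inl p) x v * F.isFrame.coeff (Sum.inl p) x w := by
  rw [leviExt, F.component_core hx hP, F.component_core hx hP, F.levi_sum hx]

theorem coeff_component_core (hx : x ∈ V)
    (hP : P x = Submodule.span ℝ (Set.range fun a ↦ T a x)) (v : Tan n x) (p : Idx n) :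
    F.isFrame.coeff (Sum.inl p) x (component (H.core x) (P x) v)
      = F.isFrame.coeff (Sum.inl p) x v := by
  rw [F.component_core hx hP]
  have := fun q ↦ F.isFrame.coeff_self hx (Sum.inl p) (Sum.inl q)
  simp only [Sum.elim_inl] at this
  simp [this]

theorem perpForm_eq (hx : x ∈ V) (v w : Tan n x) : perpForm θ x v w
    = ∑ a, F.isFrame.coeff (Sum.inr a) x v * F.isFrame.coeff (Sum.inr a) x w := by
  simp only [perpForm, F.coeff_inr hx]

theorem coeff_component_perp (hx : x ∈ V)
    (hP : P x = Submodule.span ℝ (Set.range fun a ↦ T a x)) (v : Tan n x) (a : Fin 3) :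
    F.isFrame.coeff (Sum.inr a) x (component (P x) (H.core x) v)
      = F.isFrame.coeff (Sum.inr a) x v := by
  rw [F.coeff_inr hx, F.coeff_inr hx, F.component_perp hx hP]
  simp [F.normalized.dual x hx]

theorem T_section (hP : ∀ x ∈ V, P x = Submodule.span ℝ (Set.range fun a ↦ T a x)) (a : Fin 3) :
    IsSection P (T a) V :=
  ⟨F.normalized.smooth a, fun x hx ↦ by rw [hP x hx]; exact Submodule.subset_span ⟨a, rfl⟩⟩

/-- The Christoffel symbols of the associated connection. -/
theorem coeff_associated (hVU : V ⊆ U)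
    (hP : ∀ x ∈ V, P x = Submodule.span ℝ (Set.range fun a ↦ T a x))
    (hD : IsAssociatedConnection U H θ P D) (hx : x ∈ V) (i j k : Idx n ⊕ Fin 3) :
    F.isFrame.coeff k x (D (Sum.elim ε T j) x (Sum.elim ε T i x))
      = assocSymbol (fun i j k ↦ structureFn F.isFrame i j k x) i j k := by
  have hV := F.ph.isOpen
  have hε := F.adapted.isSection
  have hT := F.T_section hP
  have hεc := fun p ↦ F.eps_mem hx p
  have hcε : ∀ y ∈ V, ∀ k p, F.isFrame.coeff k y (ε p y) = if Sum.inl p = k then 1 else 0 :=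
    fun y hy k p ↦ F.isFrame.coeff_self hy k (Sum.inl p)
  have hcT : ∀ y ∈ V, ∀ k a, F.isFrame.coeff k y (T a y) = if Sum.inr a = k then 1 else 0 :=
    fun y hy k a ↦ F.isFrame.coeff_self hy k (Sum.inr a)
  have mix1 : ∀ p a w, F.isFrame.coeff (Sum.inr a) x (D (ε p) x w) = 0 := fun p a w ↦
    (F.mem_core_iff hx).1 (hD.preserves_core V hV hVU _ (hε p) x hx w) a
  have mix2 : ∀ a p w, F.isFrame.coeff (Sum.inl p) x (D (T a) x w) = 0 := fun a p w ↦ by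
    have := hD.preserves_perp V hV hVU _ (hT a) x hx w
    rw [hP x hx] at this
    exact (F.mem_span_iff hx).1 this p
  -- The products of frame vectors are constant, so parallelism of `g` becomes skewness of the
  -- connection form.
  have skew1 : ∀ p q w, F.isFrame.coeff (Sum.inl q) x (D (ε p) x w)
      = - F.isFrame.coeff (Sum.inl p) x (D (ε q) x w) := by
    intro p q w
    have h1 := hD.parallel_levi V hV hVU _ _ (hε p).1 (hε q).1 x hx w
    rw [mvfderiv_eq_zero_of_eventually_const (c := if p = q then 1 else 0), F.leviExt_eq hx (hP x hx),
      F.leviExt_eq hx (hP x hx)] at h1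
    · simp [hcε x hx] at h1
      linarith
    · filter_upwards [hV.mem_nhds hx] with y hy
      rw [F.leviExt_eq hy (hP y hy)]
      simp [hcε y hy]
  have skew2 : ∀ p q w, F.isFrame.coeff (Sum.inr q) x (D (T p) x w)
      = - F.isFrame.coeff (Sum.inr p) x (D (T q) x w) := by
    intro p q w
    have h1 := hD.parallel_perp V hV hVU _ _ (hT p).1 (hT q).1 x hx w
    rw [mvfderiv_eq_zero_of_eventually_const (c := if p = q then 1 else 0), F.perpForm_eq hx,
      F.perpForm_eq hx] at h1
    · simp [hcT x hx] at h1
      linarith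
    · filter_upwards [hV.mem_nhds hx] with y hy
      rw [F.perpForm_eq hy]
      simp [hcT y hy]
  have tor1 : ∀ p q r, F.isFrame.coeff (Sum.inl r) x (D (ε q) x (ε p x))
      - F.isFrame.coeff (Sum.inl r) x (D (ε p) x (ε q x))
      = structureFn F.isFrame (Sum.inl p) (Sum.inl q) (Sum.inl r) x := by
    intro p q r
    have h1 := hD.torsion_core V hV hVU _ _ (hε p) (hε q) x hx
    have h2 := F.coeff_component_core hx (hP x hx) (torsion D (ε p) (ε q) x) r
    rw [h1, torsion, map_zero, map_sub, map_sub] at h2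
    exact (sub_eq_zero.1 h2.symm)
  have tor2 : ∀ p q r, F.isFrame.coeff (Sum.inr r) x (D (T q) x (T p x))
      - F.isFrame.coeff (Sum.inr r) x (D (T p) x (T q x))
      = structureFn F.isFrame (Sum.inr p) (Sum.inr q) (Sum.inr r) x := by
    intro p q r
    have h1 := hD.torsion_perp V hV hVU _ _ (hT p) (hT q) x hx
    have h2 := F.coeff_component_perp hx (hP x hx) (torsion D (T p) (T q) x) r
    rw [h1, torsion, map_zero, map_sub, map_sub] at h2
    exact (sub_eq_zero.1 h2.symm)
  have hmem : ∀ v, component (H.core x) (P x) v ∈ H.core x := fun v ↦ by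
    rw [F.component_core hx (hP x hx)]
    exact F.sum_eps_mem hx _
  have sym1 : ∀ a p q, F.isFrame.coeff (Sum.inl q) x (D (ε p) x (T a x))
      - structureFn F.isFrame (Sum.inr a) (Sum.inl p) (Sum.inl q) x
      = F.isFrame.coeff (Sum.inl p) x (D (ε q) x (T a x))
      - structureFn F.isFrame (Sum.inr a) (Sum.inl q) (Sum.inl p) x := by
    intro a p q
    have h1 := hD.torsion_symm_core V hV hVU _ _ _ (hT a) (hε p) (hε q) x hx
    rw [F.levi_eq_sum hx (hmem _) (hεc q), F.levi_eq_sum hx (hεc p) (hmem _)] at h1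
    simp only [F.coeff_component_core hx (hP x hx), hcε x hx, torsion, map_sub, mix2] at h1
    simpa [structureFn] using h1
  -- Here the torsion arguments come in the order `(A, X)`: since `∇_A X` stays in `Q`, only `-∇_X A
  -- - [A, X]` contributes, the negative of the expression compared in this claim.
  have sym2 : ∀ p a b, F.isFrame.coeff (Sum.inr b) x (D (T a) x (ε p x))
      - structureFn F.isFrame (Sum.inl p) (Sum.inr a) (Sum.inr b) x
      = F.isFrame.coeff (Sum.inr a) x (D (T b) x (ε p x))
      - structureFn F.isFrame (Sum.inl p) (Sum.inr b) (Sum.inr a) x := by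
    intro p a b
    have h1 := hD.torsion_symm_perp V hV hVU _ _ _ (hε p) (hT a) (hT b) x hx
    rw [F.perpForm_eq hx, F.perpForm_eq hx] at h1
    simp only [F.coeff_component_perp hx (hP x hx), hcT x hx, torsion, map_sub, mix1] at h1
    have h2 := structureFn_swap F.isFrame (Sum.inl p) (Sum.inr a) (Sum.inr b) x
    have h3 := structureFn_swap F.isFrame (Sum.inl p) (Sum.inr b) (Sum.inr a) x
    simp [structureFn] at h1 h2 h3 ⊢
    linarith
  rcases i with p | p <;> rcases j with q | q <;> rcases k with r | r <;>
    simp only [Sum.elim_inl, Sum.elim_inr, mix1, mix2, assocSymbol, Sum.isLeft_inl, Sum.isLeft_inr,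
      if_true, if_false, reduceCtorEq]
  -- Koszul's trick: the three cyclic torsion identities combined with skewness isolate one symbol.
  · linarith [tor1 p q r, tor1 q r p, tor1 r p q, skew1 p q (ε r x), skew1 q r (ε p x),
      skew1 r p (ε q x)]
  · linarith [sym2 p q r, skew2 q r (ε p x)]
  · linarith [sym1 p q r, skew1 q r (T p x)]
  · linarith [tor2 p q r, tor2 q r p, tor2 r p q, skew2 p q (T r x), skew2 q r (T p x),
      skew2 r p (T q x)]

end IsMovingFrame

end Associated

/-! ### Existence of the associated connection of a moving frame. -/

section Existence

variable {n : ℕ} {M : Type*} [TopologicalSpace M] [ChartedSpace (Model n) M]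
  [IsManifold 𝓘(ℝ, Model n) ∞ M]

/-- The infinitesimal form of the fact that orthogonal matrices preserve the dot product; the terms
for `(p, q)` and `(q, p)` cancel. -/
theorem sum_skew_eq_zero {κ : Type*} [Fintype κ] {B : κ → κ → ℝ} (hB : ∀ p q, B q p = - B p q)
    (Y Z : κ → ℝ) : ∑ p, ((∑ q, Y q * B q p) * Z p + Y p * ∑ q, Z q * B q p) = 0 := by
  simp only [Finset.sum_add_distrib, Finset.sum_mul, Finset.mul_sum]
  rw [Finset.sum_comm, ← Finset.sum_add_distrib]
  refine Finset.sum_eq_zero fun p _ ↦ ?_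
  rw [← Finset.sum_add_distrib]
  refine Finset.sum_eq_zero fun q _ ↦ ?_
  rw [hB p q]
  ring

theorem sum_symm_eq {α κ : Type*} [Fintype α] [Fintype κ] {S : α → κ → κ → ℝ}
    (hS : ∀ a p q, S a p q = S a q p) (A : α → ℝ) (X Y : κ → ℝ) :
    ∑ q, (∑ a, ∑ p, A a * X p * S a p q) * Y q = ∑ q, X q * ∑ a, ∑ p, A a * Y p * S a p q := by
  simp only [Finset.sum_mul, Finset.mul_sum]
  rw [Finset.sum_comm, Finset.sum_comm (s := (Finset.univ : Finset κ)) (t := (Finset.univ : Finset α))]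
  refine Finset.sum_congr rfl fun a _ ↦ ?_
  rw [Finset.sum_comm]
  refine Finset.sum_congr rfl fun p _ ↦ Finset.sum_congr rfl fun q _ ↦ ?_
  rw [hS]
  ring

namespace IsMovingFrame

variable {U V : Set M} {H : Triple n M} {θ : Fin 3 → Π x : M, Tan n x →L[ℝ] ℝ}
  {ε : Idx n → VF n M} {T : Fin 3 → VF n M} (F : IsMovingFrame V H θ ε T) {x : M}
  {P : Π x : M, Submodule ℝ (Tan n x)} {D : ConnectionMap n M}

/-- The Christoffel symbols of the connection associated with the span of `T`. -/
def symbol (i j k : Idx n ⊕ Fin 3) (x : M) : ℝ :=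
  assocSymbol (fun i j k ↦ structureFn F.isFrame i j k x) i j k

/-- The connection associated with the span of `T`. -/
def connection : ConnectionMap n M := frameConnection F.isFrame F.symbol

theorem symbol_smooth (i j k : Idx n ⊕ Fin 3) : FSmoothOn n (F.symbol i j k) V := by
  have h := structureFn_smooth F.isFrame F.ph.isOpen
  simp only [FSmoothOn]
  unfold symbol assocSymbol
  split_ifs
  · exact (FSmoothOn.const _).mul (((h i j k).sub (h j k i)).add (h k i j))
  · exact (FSmoothOn.const _).mul ((h i j k).sub (h i k j))
  · exact FSmoothOn.const 0

theorem symbol_skew (i j k : Idx n ⊕ Fin 3) (x : M) : F.symbol i k j x = - F.symbol i j k x :=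
  assocSymbol_skew (fun i j k ↦ structureFn_swap F.isFrame i j k x) i j k

theorem symbol_symm {i j k : Idx n ⊕ Fin 3} (x : M) (hij : i.isLeft ≠ j.isLeft)
    (hjk : j.isLeft = k.isLeft) : F.symbol i j k x - structureFn F.isFrame i j k x
      = F.symbol i k j x - structureFn F.isFrame i k j x :=
  assocSymbol_symm (fun i j k ↦ structureFn_swap F.isFrame i j k x) hij hjk

theorem symbol_torsion {i j k : Idx n ⊕ Fin 3} (x : M) (hij : i.isLeft = j.isLeft)
    (hjk : j.isLeft = k.isLeft) : F.symbol i j k x - F.symbol j i k x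
      = structureFn F.isFrame i j k x :=
  assocSymbol_torsion (fun i j k ↦ structureFn_swap F.isFrame i j k x) hij hjk

theorem symbol_inl_inr (i : Idx n ⊕ Fin 3) (p : Idx n) (a : Fin 3) (x : M) :
    F.symbol i (Sum.inl p) (Sum.inr a) x = 0 := by
  simp [symbol, assocSymbol]

theorem symbol_inr_inl (i : Idx n ⊕ Fin 3) (p : Idx n) (a : Fin 3) (x : M) :
    F.symbol i (Sum.inr a) (Sum.inl p) x = 0 := by
  simp [symbol, assocSymbol]

theorem connection_isCovariantDerivativeOn :
    IsCovariantDerivativeOn (Model n) F.connection V :=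
  frameConnection_isCovariantDerivativeOn F.isFrame F.ph.isOpen _

theorem coeff_connection_frame (hx : x ∈ V) (i j k : Idx n ⊕ Fin 3) :
    F.isFrame.coeff k x (F.connection (Sum.elim ε T j) x (Sum.elim ε T i x))
      = F.symbol i j k x := by
  rw [connection, frameConnection_frame F.isFrame F.ph.isOpen _ hx, coeff_sum_smul F.isFrame hx]

theorem coeff_connection (hx : x ∈ V) {Y : VF n M} (hY : DiffAt Y x) (w : Tan n x)
    (k : Idx n ⊕ Fin 3) : F.isFrame.coeff k x (F.connection Y x w)
      = mvfderiv 𝓘(ℝ, Model n) (fun y ↦ F.isFrame.coeff k y (Y y)) x w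
        + ∑ j, F.isFrame.coeff j x (Y x) * ∑ i, F.isFrame.coeff i x w * F.symbol i j k x := by
  rw [QCR.coeff_connection F.connection_isCovariantDerivativeOn F.isFrame F.ph.isOpen hx hY,
    Finset.sum_comm]
  simp only [F.coeff_connection_frame hx, Finset.mul_sum]
  congr 1
  exact Finset.sum_congr rfl fun j _ ↦ Finset.sum_congr rfl fun i _ ↦ by ring

theorem coeff_torsion (hx : x ∈ V) {X Y : VF n M} (hX : DiffAt X x) (hY : DiffAt Y x)
    (k : Idx n ⊕ Fin 3) : F.isFrame.coeff k x (torsion F.connection X Y x)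
      = ∑ i, ∑ j, F.isFrame.coeff i x (X x) * F.isFrame.coeff j x (Y x) *
        (F.symbol i j k x - F.symbol j i k x - structureFn F.isFrame i j k x) := by
  rw [QCR.coeff_torsion F.connection_isCovariantDerivativeOn F.isFrame F.ph.isOpen hx hX hY]
  simp only [F.coeff_connection_frame hx]

/-- All conditions are checked on arbitrary sections through their frame coefficients: vanishing
mixed symbols give preservation, skew symbols give parallelism, and the identities for `assocSymbol`
give the torsion conditions. -/
theorem isAssociatedConnection_connection {W : Set M} (hW : IsOpen W) (hWV : W ⊆ V)
    (hP : ∀ x ∈ V, P x = Submodule.span ℝ (Set.range fun a ↦ T a x)) :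
    IsAssociatedConnection W H θ P F.connection := by
  have hmP : ∀ x ∈ V, ∀ v, v ∈ P x ↔ ∀ p, F.isFrame.coeff (Sum.inl p) x v = 0 := fun x hx v ↦ by
    rw [hP x hx, F.mem_span_iff hx]
  have hc : ∀ {V' : Set M}, IsOpen V' → V' ⊆ W → ∀ {x : M}, x ∈ V' → ∀ {Y : VF n M},
      SmoothOn Y V' → ∀ k, FDiffAt n (fun y ↦ F.isFrame.coeff k y (Y y)) x :=
    fun {V'} hV' hV'W {x} hx {Y} hY k ↦
      F.isFrame.coeff_diffAt F.ph.isOpen (hWV (hV'W hx)) (hY.diffAt hV' hx) k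
  have hmem : ∀ x ∈ V, ∀ v, component (H.core x) (P x) v ∈ H.core x := fun x hx v ↦ by
    rw [F.component_core hx (hP x hx)]
    exact F.sum_eps_mem hx _
  constructor
  · exact F.connection_isCovariantDerivativeOn.mono hWV
  · exact frameConnection_smooth F.isFrame F.ph.isOpen hW hWV F.symbol_smooth
  · intro V' hV' hV'W Y hY x hx w
    have hxV := hWV (hV'W hx)
    rw [F.mem_core_iff hxV]
    intro a
    rw [F.coeff_connection hxV (hY.1.diffAt hV' hx),
      mvfderiv_eq_zero_of_eventually_const (c := 0)]
    · have := (F.mem_core_iff hxV).1 (hY.2 x hx)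
      simp [Fintype.sum_sum_type, this, F.symbol_inl_inr]
    · filter_upwards [hV'.mem_nhds hx] with y hy
      exact (F.mem_core_iff (hWV (hV'W hy))).1 (hY.2 y hy) a
  · intro V' hV' hV'W Y hY x hx w
    have hxV := hWV (hV'W hx)
    rw [hmP x hxV]
    intro p
    rw [F.coeff_connection hxV (hY.1.diffAt hV' hx),
      mvfderiv_eq_zero_of_eventually_const (c := 0)]
    · have := (hmP x hxV _).1 (hY.2 x hx)
      simp [Fintype.sum_sum_type, this, F.symbol_inr_inl]
    · filter_upwards [hV'.mem_nhds hx] with y hy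
      exact (hmP y (hWV (hV'W hy)) _).1 (hY.2 y hy) p
  · intro V' hV' hV'W Y Z hY hZ x hx w
    have hxV := hWV (hV'W hx)
    have h1 : (fun y ↦ leviExt H θ P y (Y y) (Z y)) =ᶠ[𝓝 x] fun y ↦ ∑ p,
        F.isFrame.coeff (Sum.inl p) y (Y y) * F.isFrame.coeff (Sum.inl p) y (Z y) := by
      filter_upwards [hV'.mem_nhds hx] with y hy
      rw [F.leviExt_eq (hWV (hV'W hy)) (hP y (hWV (hV'W hy)))]
    have hcY := fun k ↦ hc hV' hV'W hx hY k
    have hcZ := fun k ↦ hc hV' hV'W hx hZ k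
    have hYZ : ∀ p ∈ Finset.univ, FDiffAt n (fun y ↦ F.isFrame.coeff (Sum.inl p) y (Y y)
        * F.isFrame.coeff (Sum.inl p) y (Z y)) x := fun p _ ↦ (hcY _).mul (hcZ _)
    rw [mvfderiv_congr h1, mvfderiv_finsetSum hYZ,
      F.leviExt_eq hxV (hP x hxV), F.leviExt_eq hxV (hP x hxV), ← Finset.sum_add_distrib,
      ← sub_eq_zero, ← Finset.sum_sub_distrib, ← neg_eq_zero, ← Finset.sum_neg_distrib]
    -- The derivative terms match by the product rule; what is left is the pairing with the skew
    -- connection form in direction `w`.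
    have key := sum_skew_eq_zero
      (B := fun q p ↦ ∑ i, F.isFrame.coeff i x w * F.symbol i (Sum.inl q) (Sum.inl p) x)
      (fun p q ↦ by simp only [F.symbol_skew _ (Sum.inl p) (Sum.inl q), mul_neg,
        Finset.sum_neg_distrib])
      (fun q ↦ F.isFrame.coeff (Sum.inl q) x (Y x)) (fun q ↦ F.isFrame.coeff (Sum.inl q) x (Z x))
    rw [← key]
    refine Finset.sum_congr rfl fun p _ ↦ ?_
    rw [mvfderiv_mul_apply (hcY _) (hcZ _), F.coeff_connection hxV (hY.diffAt hV' hx),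
      F.coeff_connection hxV (hZ.diffAt hV' hx)]
    simp only [Fintype.sum_sum_type (f := fun j ↦ F.isFrame.coeff j x _ * _), F.symbol_inr_inl,
      mul_zero, Finset.sum_const_zero, add_zero]
    ring
  · intro V' hV' hV'W Y Z hY hZ x hx w
    have hxV := hWV (hV'W hx)
    have h1 : (fun y ↦ perpForm θ y (Y y) (Z y)) =ᶠ[𝓝 x] fun y ↦ ∑ p,
        F.isFrame.coeff (Sum.inr p) y (Y y) * F.isFrame.coeff (Sum.inr p) y (Z y) := by
      filter_upwards [hV'.mem_nhds hx] with y hy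
      rw [F.perpForm_eq (hWV (hV'W hy))]
    have hcY := fun k ↦ hc hV' hV'W hx hY k
    have hcZ := fun k ↦ hc hV' hV'W hx hZ k
    have hYZ : ∀ p ∈ Finset.univ, FDiffAt n (fun y ↦ F.isFrame.coeff (Sum.inr p) y (Y y)
        * F.isFrame.coeff (Sum.inr p) y (Z y)) x := fun p _ ↦ (hcY _).mul (hcZ _)
    rw [mvfderiv_congr h1, mvfderiv_finsetSum hYZ,
      F.perpForm_eq hxV, F.perpForm_eq hxV, ← Finset.sum_add_distrib,
      ← sub_eq_zero, ← Finset.sum_sub_distrib, ← neg_eq_zero, ← Finset.sum_neg_distrib]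
    have key := sum_skew_eq_zero
      (B := fun q p ↦ ∑ i, F.isFrame.coeff i x w * F.symbol i (Sum.inr q) (Sum.inr p) x)
      (fun p q ↦ by simp only [F.symbol_skew _ (Sum.inr p) (Sum.inr q), mul_neg,
        Finset.sum_neg_distrib])
      (fun q ↦ F.isFrame.coeff (Sum.inr q) x (Y x)) (fun q ↦ F.isFrame.coeff (Sum.inr q) x (Z x))
    rw [← key]
    refine Finset.sum_congr rfl fun p _ ↦ ?_
    rw [mvfderiv_mul_apply (hcY _) (hcZ _), F.coeff_connection hxV (hY.diffAt hV' hx),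
      F.coeff_connection hxV (hZ.diffAt hV' hx)]
    simp only [Fintype.sum_sum_type (f := fun j ↦ F.isFrame.coeff j x _ * _), F.symbol_inl_inr,
      mul_zero, Finset.sum_const_zero, zero_add]
    ring
  · intro V' hV' hV'W X Y hX hY x hx
    have hxV := hWV (hV'W hx)
    have hX0 := (F.mem_core_iff hxV).1 (hX.2 x hx)
    have hY0 := (F.mem_core_iff hxV).1 (hY.2 x hx)
    rw [F.component_core hxV (hP x hxV)]
    refine Finset.sum_eq_zero fun r _ ↦ ?_
    rw [F.coeff_torsion hxV (hX.1.diffAt hV' hx) (hY.1.diffAt hV' hx)]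
    have : ∀ p q, F.symbol (Sum.inl p) (Sum.inl q) (Sum.inl r) x
        - F.symbol (Sum.inl q) (Sum.inl p) (Sum.inl r) x
        = structureFn F.isFrame (Sum.inl p) (Sum.inl q) (Sum.inl r) x := fun p q ↦
      F.symbol_torsion x rfl rfl
    simp [Fintype.sum_sum_type, hX0, hY0, this]
  · intro V' hV' hV'W X Y hX hY x hx
    have hxV := hWV (hV'W hx)
    have hX0 := (hmP x hxV _).1 (hX.2 x hx)
    have hY0 := (hmP x hxV _).1 (hY.2 x hx)
    rw [F.component_perp hxV (hP x hxV)]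
    refine Finset.sum_eq_zero fun r _ ↦ ?_
    rw [← F.coeff_inr hxV, F.coeff_torsion hxV (hX.1.diffAt hV' hx) (hY.1.diffAt hV' hx)]
    have : ∀ p q, F.symbol (Sum.inr p) (Sum.inr q) (Sum.inr r) x
        - F.symbol (Sum.inr q) (Sum.inr p) (Sum.inr r) x
        = structureFn F.isFrame (Sum.inr p) (Sum.inr q) (Sum.inr r) x := fun p q ↦
      F.symbol_torsion x rfl rfl
    simp [Fintype.sum_sum_type, hX0, hY0, this]
  · intro V' hV' hV'W A X Y hA hX hY x hx
    have hxV := hWV (hV'W hx)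
    have hA0 := (hmP x hxV _).1 (hA.2 x hx)
    have hX0 := (F.mem_core_iff hxV).1 (hX.2 x hx)
    have hY0 := (F.mem_core_iff hxV).1 (hY.2 x hx)
    rw [F.levi_eq_sum hxV (hmem x hxV _) (hY.2 x hx), F.levi_eq_sum hxV (hX.2 x hx) (hmem x hxV _)]
    simp only [F.coeff_component_core hxV (hP x hxV),
      F.coeff_torsion hxV (hA.1.diffAt hV' hx) (hX.1.diffAt hV' hx),
      F.coeff_torsion hxV (hA.1.diffAt hV' hx) (hY.1.diffAt hV' hx)]
    simp only [Fintype.sum_sum_type, hA0, hX0, hY0, zero_mul, mul_zero, Finset.sum_const_zero,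
      add_zero, zero_add, F.symbol_inr_inl, sub_zero]
    exact sum_symm_eq (S := fun a p q ↦ F.symbol (Sum.inr a) (Sum.inl p) (Sum.inl q) x
        - structureFn F.isFrame (Sum.inr a) (Sum.inl p) (Sum.inl q) x)
      (fun a p q ↦ F.symbol_symm x (by simp) rfl)
      (fun a ↦ F.isFrame.coeff (Sum.inr a) x (A x)) (fun p ↦ F.isFrame.coeff (Sum.inl p) x (X x))
      (fun p ↦ F.isFrame.coeff (Sum.inl p) x (Y x))
  · intro V' hV' hV'W X A B hX hA hB x hx
    have hxV := hWV (hV'W hx)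
    have hA0 := (hmP x hxV _).1 (hA.2 x hx)
    have hB0 := (hmP x hxV _).1 (hB.2 x hx)
    have hX0 := (F.mem_core_iff hxV).1 (hX.2 x hx)
    rw [F.perpForm_eq hxV, F.perpForm_eq hxV]
    simp only [F.coeff_component_perp hxV (hP x hxV),
      F.coeff_torsion hxV (hA.1.diffAt hV' hx) (hX.1.diffAt hV' hx),
      F.coeff_torsion hxV (hB.1.diffAt hV' hx) (hX.1.diffAt hV' hx)]
    simp only [Fintype.sum_sum_type, hA0, hB0, hX0, zero_mul, mul_zero, Finset.sum_const_zero,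
      add_zero, zero_add, F.symbol_inl_inr, zero_sub]
    have key := sum_symm_eq (S := fun p a b ↦ F.symbol (Sum.inl p) (Sum.inr a) (Sum.inr b) x
        - structureFn F.isFrame (Sum.inl p) (Sum.inr a) (Sum.inr b) x)
      (fun p a b ↦ F.symbol_symm x (by simp) rfl)
      (fun p ↦ F.isFrame.coeff (Sum.inl p) x (X x)) (fun a ↦ F.isFrame.coeff (Sum.inr a) x (A x))
      (fun a ↦ F.isFrame.coeff (Sum.inr a) x (B x))
    have e : ∀ (f : Fin 3 → ℝ) (b : Fin 3), ∑ a, ∑ p, f a * F.isFrame.coeff (Sum.inl p) x (X x) *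
        (-F.symbol (Sum.inl p) (Sum.inr a) (Sum.inr b) x
          - structureFn F.isFrame (Sum.inr a) (Sum.inl p) (Sum.inr b) x)
        = - ∑ p, ∑ a, F.isFrame.coeff (Sum.inl p) x (X x) * f a *
        (F.symbol (Sum.inl p) (Sum.inr a) (Sum.inr b) x
          - structureFn F.isFrame (Sum.inl p) (Sum.inr a) (Sum.inr b) x) := by
      intro f b
      rw [Finset.sum_comm, ← Finset.sum_neg_distrib]
      refine Finset.sum_congr rfl fun p _ ↦ ?_
      rw [← Finset.sum_neg_distrib]
      refine Finset.sum_congr rfl fun a _ ↦ ?_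
      rw [structureFn_swap F.isFrame (Sum.inl p) (Sum.inr a)]
      ring
    simp only [e, neg_mul, mul_neg, Finset.sum_neg_distrib, key]

/-- The connection forms of the associated connection on the core. -/
theorem connectionMatrix_eq (hVU : V ⊆ U)
    (hP : ∀ x ∈ V, P x = Submodule.span ℝ (Set.range fun a ↦ T a x))
    (hD : IsAssociatedConnection U H θ P D) (hx : x ∈ V) (p : Idx n) :
    connectionMatrix H θ D ε x (ε p x)
      = Matrix.of fun r q ↦ F.symbol (Sum.inl p) (Sum.inl q) (Sum.inl r) x := by
  ext r q
  rw [connectionMatrix, Matrix.of_apply, Matrix.of_apply, ← F.coeff_inl_core hx]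
  · exact F.coeff_associated hVU hP hD hx (Sum.inl p) (Sum.inl q) (Sum.inl r)
  · exact hD.preserves_core V F.ph.isOpen hVU _ (F.adapted.isSection q) x hx _

theorem eq_connection (hVU : V ⊆ U)
    (hP : ∀ x ∈ V, P x = Submodule.span ℝ (Set.range fun a ↦ T a x))
    (hD : IsAssociatedConnection U H θ P D) (hx : x ∈ V) {Y : VF n M} (hY : DiffAt Y x) :
    D Y x = F.connection Y x := by
  refine connection_eq_of_frame (hD.isConnection.mono hVU) F.connection_isCovariantDerivativeOn
    F.isFrame F.ph.isOpen hx (fun i j ↦ ?_) hY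
  rw [← F.isFrame.sum_coeff hx (D _ _ _), ← F.isFrame.sum_coeff hx (F.connection _ _ _)]
  simp only [F.coeff_associated hVU hP hD hx, F.coeff_connection_frame hx, symbol]

end IsMovingFrame

end Existence

/-! ### The obstruction vector; local existence and uniqueness. -/

section Balanced

open Matrix

variable {n : ℕ} {M : Type*} [TopologicalSpace M] [ChartedSpace (Model n) M]
  [IsManifold 𝓘(ℝ, Model n) ∞ M]

variable {U V W : Set M} {H : Triple n M} {θ : Fin 3 → Π x : M, Tan n x →L[ℝ] ℝ}
  {ε : Idx n → VF n M} {T T' : Fin 3 → VF n M} {x : M}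
  {P : Π x : M, Submodule ℝ (Tan n x)} {D : ConnectionMap n M}

/-- Core vectors are invisible to `θ`, and `I_a I_{a+1} = I_{a+2}` on the core keeps the relations
between the members of the triple. -/
theorem IsNormalizedTriple.add_act (hT : IsNormalizedTriple V H θ T)
    (h : IsPseudohermitian V H θ) {Z : VF n M} (hZ : IsSection H.core Z V) :
    IsNormalizedTriple V H θ (fun a x ↦ T a x + H.J a x (Z x)) where
  smooth a := (hT.smooth a).add (h.act_section h.isOpen subset_rfl hZ a).1
  dual x hx a b := by
    rw [map_add, hT.dual x hx, h.theta_core hx (h.J_mem hx (hZ.2 x hx) b), add_zero]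
  act x hx a := by
    rw [map_add, hT.act x hx, h.J_succ hx (hZ.2 x hx)]

/-- The differences `N_a = T'_a - T_a` lie in the core and satisfy `I_a N_{a+1} = N_{a+2}`.
Consequently all `-I_a N_a` coincide, and `Z` is the one for the last index. -/
theorem IsNormalizedTriple.exists_eq_add_act (hT : IsNormalizedTriple V H θ T)
    (hT' : IsNormalizedTriple V H θ T') (h : IsPseudohermitian V H θ) :
    ∃ Z : VF n M, IsSection H.core Z V ∧ ∀ x ∈ V, ∀ a, T' a x = T a x + H.J a x (Z x) := by
  let N : Fin 3 → VF n M := fun a x ↦ T' a x - T a x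
  have hN : ∀ a, IsSection H.core (N a) V := fun a ↦
    ⟨(hT'.smooth a).sub (hT.smooth a), fun x hx ↦ (h.mem_core_iff hx).2 fun b ↦ by
      simp only [N, map_sub, hT.dual x hx, hT'.dual x hx, sub_self]⟩
  have hact : ∀ x ∈ V, ∀ a, H.J a x (N (a + 1) x) = N (a + 2) x := fun x hx a ↦ by
    simp only [N, map_sub, hT.act x hx, hT'.act x hx]
  have hZ : IsSection H.core (fun x ↦ - H.J 2 x (N 2 x)) V :=
    ⟨(h.act_section h.isOpen subset_rfl (hN 2) 2).1.neg,
      fun x hx ↦ Submodule.neg_mem _ (h.J_mem hx ((hN 2).2 x hx) 2)⟩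
  refine ⟨_, hZ, fun x hx a ↦ ?_⟩
  have hm := fun a ↦ (hN a).2 x hx
  have h2 : H.J 2 x (- H.J 2 x (N 2 x)) = N 2 x := by
    rw [map_neg, h.J22 hx (hm 2), neg_neg]
  have h1 : H.J 1 x (- H.J 2 x (N 2 x)) = N 1 x := by
    have : H.J 0 x (N 1 x) = N 2 x := hact x hx 0
    rw [map_neg, h.J12 hx (hm 2), ← this, h.J00 hx (hm 1), neg_neg]
  have h0 : H.J 0 x (- H.J 2 x (N 2 x)) = N 0 x := by
    have : H.J 1 x (N 2 x) = N 0 x := hact x hx 1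
    rw [map_neg, h.J02 hx (hm 2), neg_neg, this]
  have : T' a x = T a x + N a x := by simp [N]
  rw [this]
  fin_cases a
  exacts [congrArg _ h0.symm, congrArg _ h1.symm, congrArg _ h2.symm]

theorem IsFrame.coeff_mono {ι : Type*} [Fintype ι] [DecidableEq ι] {E : ι → VF n M}
    (hE : IsFrame E V) (hE' : IsFrame E W) (hx : x ∈ V) (hx' : x ∈ W) (i : ι) (v : Tan n x) :
    hE'.coeff i x v = hE.coeff i x v := by
  conv_rhs => rw [← hE'.sum_coeff hx' v]
  rw [coeff_sum_smul hE hx]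

namespace IsMovingFrame

variable (F : IsMovingFrame V H θ ε T)

/-- The connection forms, in the direction of the `p`-th vector of the frame. -/
def symbolMatrix (x : M) (p : Idx n) : Mat n :=
  Matrix.of fun r q ↦ F.symbol (Sum.inl p) (Sum.inl q) (Sum.inl r) x

theorem symbolMatrix_transpose (x : M) (p : Idx n) :
    (F.symbolMatrix x p)ᵀ = - F.symbolMatrix x p := by
  ext r q
  exact F.symbol_skew (Sum.inl p) (Sum.inl q) (Sum.inl r) x

/-- The vector that represents the `E ⊗ H`-component of the obstruction. -/
def obstruction (x : M) : Idx n → ℝ := contract fun p ↦ obsPart (F.symbolMatrix x p)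

theorem obstruction_smooth (q : Idx n) : FSmoothOn n (fun x ↦ F.obstruction x q) V := by
  have h : ∀ p r s, FSmoothOn n (fun x ↦ F.symbolMatrix x p r s) V := fun p r s ↦
    F.symbol_smooth (Sum.inl p) (Sum.inl s) (Sum.inl r)
  simp only [obstruction, contract, obsPart, sandwich, Matrix.add_apply, Matrix.smul_apply,
    Matrix.sum_apply, Matrix.mul_apply, Matrix.trace, Matrix.diag_apply, smul_eq_mul]
  refine FSmoothOn.sum fun p _ ↦ FSmoothOn.add (FSmoothOn.add ((FSmoothOn.const _).mul (h _ _ _))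
    ((FSmoothOn.const _).mul (FSmoothOn.sum fun a _ ↦ FSmoothOn.sum fun r _ ↦
      (FSmoothOn.sum fun s _ ↦ (FSmoothOn.const _).mul (h _ _ _)).mul (FSmoothOn.const _))))
    ((FSmoothOn.const _).mul (FSmoothOn.sum fun a _ ↦ (FSmoothOn.sum fun r _ ↦
      FSmoothOn.sum fun s _ ↦ (h _ _ _).mul (FSmoothOn.const _)).mul (FSmoothOn.const _)))

/-- Frame coefficients at a point do not depend on the open set over which the frame is considered.
-/
theorem obstruction_mono (F' : IsMovingFrame W H θ ε T) (hx : x ∈ V) (hx' : x ∈ W) :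
    F'.obstruction x = F.obstruction x := by
  have h : ∀ i j k, structureFn F'.isFrame i j k x = structureFn F.isFrame i j k x :=
    fun i j k ↦ IsFrame.coeff_mono F.isFrame F'.isFrame hx hx' k _
  simp only [obstruction, symbolMatrix, symbol, h]

theorem ehComponentVanishes_iff_obstruction (hn : n ≠ 0) (hVU : V ⊆ U)
    (hP : ∀ x ∈ V, P x = Submodule.span ℝ (Set.range fun a ↦ T a x))
    (hD : IsAssociatedConnection U H θ P D) (hx : x ∈ V) :
    EHComponentVanishes (fun p ↦ connectionMatrix H θ D ε x (ε p x)) ↔ F.obstruction x = 0 := by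
  simp only [F.connectionMatrix_eq hVU hP hD hx]
  exact ehComponentVanishes_iff hn (F.symbolMatrix_transpose x)

/-- The matrix of the form `h`. -/
def ultraMatrix (θ : Fin 3 → Π x : M, Tan n x →L[ℝ] ℝ) (ε : Idx n → VF n M) (x : M) : Mat n :=
  (2 * (n : ℝ) + 4) • (1 : Mat n) - ∑ a, dMatrix θ ε a x * frameJ n a

include F in
theorem ultraMatrix_smooth (p q : Idx n) : FSmoothOn n (fun x ↦ ultraMatrix θ ε x p q) V := by
  simp only [ultraMatrix, Matrix.sub_apply, Matrix.smul_apply, Matrix.sum_apply, Matrix.mul_apply,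
    smul_eq_mul]
  refine FSmoothOn.sub (FSmoothOn.const _) (FSmoothOn.sum fun a _ ↦ FSmoothOn.sum fun r _ ↦
    FSmoothOn.mul ?_ (FSmoothOn.const _))
  exact dForm_smooth (F.ph.compatible.smooth a) F.ph.isOpen F.ph.isOpen subset_rfl
    (F.adapted.isSection p).1 (F.adapted.isSection r).1

include F in
theorem theta_bracket (hx : x ∈ V) (a : Fin 3) (p q : Idx n) :
    θ a x (bracket (ε p) (ε q) x) = - dMatrix θ ε a x p q := by
  have hV := F.ph.isOpen
  have hε := F.adapted.isSection
  rw [dMatrix, Matrix.of_apply, dForm_eq_neg_bracket (F.ph.compatible.smooth a) hV hx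
    ((hε p).1.diffAt hV hx) ((hε q).1.diffAt hV hx)
    (Filter.eventually_of_mem (hV.mem_nhds hx) fun y hy ↦ F.theta_eps hy a p)
    (Filter.eventually_of_mem (hV.mem_nhds hx) fun y hy ↦ F.theta_eps hy a q), neg_neg]

include F in
theorem J_sum_eps (hx : x ∈ V) (a : Fin 3) (ζ : Idx n → ℝ) :
    H.J a x (∑ q, ζ q • ε q x) = ∑ p, (frameJ n a *ᵥ ζ) p • ε p x := by
  simp only [map_sum, map_smul, F.J_eps hx, Matrix.mulVec, dotProduct, Finset.sum_smul,
    Finset.smul_sum, smul_smul]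
  rw [Finset.sum_comm]
  simp only [mul_comm]

/-- The change of the obstruction under a change of the three-plane field. -/
theorem obstruction_add_act (hn : n ≠ 0) (F' : IsMovingFrame V H θ ε T') (hx : x ∈ V)
    {ζ : Idx n → ℝ} (hT' : ∀ a, T' a x = T a x + H.J a x (∑ p, ζ p • ε p x)) :
    F'.obstruction x = F.obstruction x
      - (3 * (n - 1) / (4 * n) : ℝ) • (ultraMatrix θ ε x *ᵥ ζ) := by
  have hcε : ∀ r q, F'.isFrame.coeff (Sum.inl r) x (ε q x) = if q = r then 1 else 0 := fun r q ↦ by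
    simpa using F'.isFrame.coeff_self hx (Sum.inl r) (Sum.inl q)
  have hcT : ∀ r a, F'.isFrame.coeff (Sum.inl r) x (T' a x) = 0 := fun r a ↦ by
    simpa using F'.isFrame.coeff_self hx (Sum.inl r) (Sum.inr a)
  -- Replacing `T_a` by `T_a + I_a Z` shears the splitting: the core coefficients lose `θ_a(v) I_a
  -- Z`.
  have hcoeff : ∀ v r, F'.isFrame.coeff (Sum.inl r) x v
      = F.isFrame.coeff (Sum.inl r) x v - ∑ a, θ a x v * (frameJ n a *ᵥ ζ) r := by
    intro v r
    have h1 : ∀ a, F'.isFrame.coeff (Sum.inl r) x (T a x) = - (frameJ n a *ᵥ ζ) r := fun a ↦ by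
      have h2 := hcT r a
      rw [hT' a, F.J_sum_eps hx, map_add, map_sum] at h2
      simp only [map_smul, hcε, smul_eq_mul, mul_ite, mul_one, mul_zero, Finset.sum_ite_eq',
        Finset.mem_univ, if_true] at h2
      linarith
    conv_lhs => rw [F.sum_eps hx v]
    simp only [map_add, map_sum, map_smul, h1, hcε, smul_eq_mul, mul_ite, mul_one, mul_zero,
      Finset.sum_ite_eq', Finset.mem_univ, if_true, mul_neg, Finset.sum_neg_distrib]
    ring
  -- Since `θ_a([ε_p, ε_q]) = -dθ_a(ε_p, ε_q)`, the shear adds `dθ_a(ε_p, ε_q) I_a Z` to the bracket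
  -- coefficients.
  have hstr : ∀ p q r, structureFn F'.isFrame (Sum.inl p) (Sum.inl q) (Sum.inl r) x
      = structureFn F.isFrame (Sum.inl p) (Sum.inl q) (Sum.inl r) x
        + ∑ a, dMatrix θ ε a x p q * (frameJ n a *ᵥ ζ) r := by
    intro p q r
    simp only [structureFn, hcoeff, Sum.elim_inl, F.theta_bracket hx, neg_mul,
      Finset.sum_neg_distrib, sub_neg_eq_add]
  -- Koszul's formula turns the change of the brackets into `variation`.
  have hsym : ∀ p, F'.symbolMatrix x p = F.symbolMatrix x p
      + ∑ a, variation (dMatrix θ ε a x) (frameJ n a *ᵥ ζ) p := by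
    intro p
    ext r q
    rw [Matrix.add_apply, Matrix.sum_apply]
    simp only [symbolMatrix, symbol, assocSymbol, variation, Matrix.of_apply, Sum.isLeft_inl,
      if_true, hstr, Fin.sum_univ_three]
    ring
  have hadd : (fun p ↦ obsPart (F'.symbolMatrix x p)) = (fun p ↦ obsPart (F.symbolMatrix x p))
      + fun p ↦ obsPart (∑ a, variation (dMatrix θ ε a x) (frameJ n a *ᵥ ζ) p) := by
    funext p
    rw [hsym, obsPart_add, Pi.add_apply]
  rw [obstruction, hadd, contract_add, contract_obsPart_sum_variation hn _
    (fun a ↦ F.dMatrix_transpose a) (F.dMatrix_commute hx), ← obstruction, neg_smul, ← sub_eq_add_neg,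
    ultraMatrix, Matrix.sub_mulVec, Matrix.smul_mulVec, Matrix.one_mulVec, Matrix.sum_mulVec]

end IsMovingFrame

/-- The form `h` is definite on the core at the points of `U`. -/
def IsDefinite (U : Set M) (H : Triple n M) (θ : Fin 3 → Π x : M, Tan n x →L[ℝ] ℝ) : Prop :=
  ∀ x ∈ U, (∀ v ∈ H.core x, v ≠ 0 → 0 < ultraForm H θ x v v) ∨
    ∀ v ∈ H.core x, v ≠ 0 → ultraForm H θ x v v < 0

theorem IsAdmissiblePlaneField.mono {H : Triple n M}
    {P : Π x : M, Submodule ℝ (Tan n x)} (hP : IsAdmissiblePlaneField U H P) (hVU : V ⊆ U) :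
    IsAdmissiblePlaneField V H P := by
  obtain ⟨T, ⟨hT, hT'⟩, hP⟩ := hP
  exact ⟨T, ⟨fun a ↦ (hT a).mono hVU, fun x hx ↦ hT' x (hVU hx)⟩, fun x hx ↦ hP x (hVU hx)⟩

namespace IsPseudohermitian

variable (h : IsPseudohermitian U H θ) (hdef : IsDefinite U H θ) (hn : 2 ≤ n)

include h hdef hn

/-- Local existence of a three-plane field with vanishing obstruction. -/
theorem exists_balanced (hx : x ∈ U) : ∃ (V : Set M) (ε : Idx n → VF n M) (T : Fin 3 → VF n M)
    (F : IsMovingFrame V H θ ε T), x ∈ V ∧ V ⊆ U ∧ ∀ y ∈ V, F.obstruction y = 0 := by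
  obtain ⟨V₁, ε, hV₁, hxV₁, hV₁U, hε⟩ := h.exists_adaptedFrame hx
  obtain ⟨V₂, T, hV₂, hxV₂, hV₂U, hT⟩ := h.exists_normalized hx
  have hV := hV₁.inter hV₂
  have hVU : V₁ ∩ V₂ ⊆ U := fun y hy ↦ hV₁U hy.1
  let F : IsMovingFrame (V₁ ∩ V₂) H θ ε T := ⟨h.mono hV hVU, hε.mono Set.inter_subset_left,
    hT.mono Set.inter_subset_right⟩
  have hdet : ∀ y ∈ V₁ ∩ V₂, (IsMovingFrame.ultraMatrix θ ε y).det ≠ 0 := fun y hy ↦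
    F.det_ultraForm_ne_zero hy (hdef y (hVU hy))
  -- The constant contains `n - 1`; this is where dimension `7` is excluded.
  let c : ℝ := 3 * (n - 1) / (4 * n)
  have hc : c ≠ 0 := by
    have : (2 : ℝ) ≤ n := by exact_mod_cast hn
    have h1 : (n : ℝ) - 1 > 0 := by linarith
    positivity
  -- The solution of `c · h ζ = obstruction`, smooth because the inverse of a smooth invertible
  -- matrix is smooth.
  let ζ : M → Idx n → ℝ := fun y ↦ c⁻¹ • ((IsMovingFrame.ultraMatrix θ ε y)⁻¹ *ᵥ F.obstruction y)
  have hζ : ∀ p, FSmoothOn n (fun y ↦ ζ y p) (V₁ ∩ V₂) := fun p ↦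
    (FSmoothOn.const _).mul (FSmoothOn.sum fun q _ ↦
      (FSmoothOn.matrix_inv F.ultraMatrix_smooth hdet p q).mul (F.obstruction_smooth q))
  have hZ : IsSection H.core (fun y ↦ ∑ p, ζ y p • ε p y) (V₁ ∩ V₂) :=
    IsSection.sum fun p _ ↦ IsSection.smul (hζ p) (F.adapted.isSection p)
  let F' : IsMovingFrame (V₁ ∩ V₂) H θ ε _ := ⟨F.ph, F.adapted, F.normalized.add_act F.ph hZ⟩
  refine ⟨V₁ ∩ V₂, ε, _, F', ⟨hxV₁, hxV₂⟩, hVU, fun y hy ↦ ?_⟩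
  rw [F.obstruction_add_act (by omega) F' hy (ζ := ζ y) fun a ↦ rfl]
  change _ - c • _ = _
  simp only [ζ]
  rw [Matrix.mulVec_smul, smul_inv_smul₀ hc, Matrix.mulVec_mulVec,
    Matrix.mul_nonsing_inv _ (hdet y hy).isUnit, Matrix.one_mulVec, sub_self]

/-- Local uniqueness of the canonical three-plane field and the canonical connection. -/
theorem agree_of_balanced (F : IsMovingFrame V H θ ε T) (hVU : V ⊆ U)
    (hF : ∀ y ∈ V, F.obstruction y = 0) (hc : IsCanonical U H θ P D) :
    (∀ x ∈ V, P x = Submodule.span ℝ (Set.range fun a ↦ T a x)) ∧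
      ∀ x ∈ V, ∀ Y : VF n M, DiffAt Y x → D Y x = F.connection Y x := by
  obtain ⟨T', hT', hP⟩ := h.exists_normalized_of_admissible F.ph.isOpen hVU
    (hc.admissible.mono hVU)
  obtain ⟨Z, hZ, hTT'⟩ := F.normalized.exists_eq_add_act hT' F.ph
  let F' : IsMovingFrame V H θ ε T' := ⟨F.ph, F.adapted, hT'⟩
  have hZ0 : ∀ x ∈ V, Z x = 0 := by
    intro x hx
    have h1 := F.core_expand hx (hZ.2 x hx)
    -- Both obstructions vanish, so the matrix of `h` annihilates the coordinates of `Z`.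
    have h2 := F.obstruction_add_act (by omega) F' hx (ζ := fun p ↦ levi H θ x (Z x) (ε p x))
      fun a ↦ by rw [← h1, hTT' x hx]
    rw [hF x hx, (F'.ehComponentVanishes_iff_obstruction (by omega) hVU hP hc.associated
      hx).1 (hc.eh V F.ph.isOpen hVU ε F.adapted x hx), zero_sub, eq_comm, neg_eq_zero] at h2
    have hcn : (3 * (n - 1) / (4 * n) : ℝ) ≠ 0 := by
      have : (2 : ℝ) ≤ n := by exact_mod_cast hn
      have h1 : (n : ℝ) - 1 > 0 := by linarith
      positivity
    have h3 := F.eq_zero_of_ultraForm hx (hdef x (hVU hx)) ((smul_eq_zero.1 h2).resolve_left hcn)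
    rw [h1]
    exact Finset.sum_eq_zero fun p _ ↦ by rw [congrFun h3 p]; exact zero_smul _ _
  have hT : ∀ x ∈ V, P x = Submodule.span ℝ (Set.range fun a ↦ T a x) := by
    intro x hx
    rw [hP x hx]
    congr 2
    funext a
    rw [hTT' x hx, hZ0 x hx, map_zero, add_zero]
  exact ⟨hT, fun x hx Y hY ↦ F.eq_connection hVU hT hc.associated hx hY⟩

end IsPseudohermitian

end Balanced

/-! ### Behaviour of the obstruction under rotations and changes of frame. -/

section Rotation

open Matrix

section RotationMatrix

variable {n : ℕ} {s : Fin 3 → Fin 3 → ℝ} {G : Mat n}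

theorem sum_smul_mul_apply (c : Fin 3 → ℝ) (J : Fin 3 → Mat n) (G : Mat n) (q r : Idx n) :
    ((∑ b, c b • J b) * G) q r = ∑ b, ∑ s, c b * (J b q s * G s r) := by
  simp only [Finset.sum_mul, Matrix.sum_apply, Matrix.smul_apply, smul_eq_mul, Matrix.mul_apply]
  rw [Finset.sum_comm]
  simp only [mul_assoc]

/-- Rows of `s` are orthonormal, so a quadratic sum over the three units is independent of the basis
rotated by `s`. This covers the sandwich, the `sp(1)`-projection and `g^⊥`. -/
theorem sum_rotate {A B : Type*} [AddCommGroup A] [Module ℝ A] [AddCommGroup B] [Module ℝ B]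
    (hs : ∀ b c, ∑ a, s b a * s c a = if b = c then 1 else 0) (f : A →ₗ[ℝ] A →ₗ[ℝ] B)
    (v : Fin 3 → A) :
    ∑ a, f (∑ b, s b a • v b) (∑ b, s b a • v b) = ∑ a, f (v a) (v a) := by
  have h1 : ∀ a, f (∑ b, s b a • v b) (∑ b, s b a • v b)
      = ∑ b, ∑ c, (s b a * s c a) • f (v b) (v c) := by
    intro a
    simp only [map_sum, map_smul, LinearMap.sum_apply, LinearMap.smul_apply, Finset.smul_sum,
      smul_smul]
    rw [Finset.sum_comm]
    exact Finset.sum_congr rfl fun b _ ↦ Finset.sum_congr rfl fun c _ ↦ by rw [mul_comm]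
  simp only [h1]
  rw [Finset.sum_comm]
  refine Finset.sum_congr rfl fun b _ ↦ ?_
  rw [Finset.sum_comm]
  simp only [← Finset.sum_smul, hs, ite_smul, one_smul, zero_smul, Finset.sum_ite_eq,
    Finset.mem_univ, if_true]

/-- Conjugation by `G` rotates the units among themselves, and `obsPart` depends only on their span
and its metric. -/
theorem obsPart_rotate (hs : ∀ b c, ∑ a, s b a * s c a = if b = c then 1 else 0)
    (hG : Gᵀ * G = 1) (hJ : ∀ a, G * frameJ n a = (∑ b, s b a • frameJ n b) * G) (X : Mat n) :
    obsPart (Gᵀ * X * G) = Gᵀ * obsPart X * G := by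
  have hG' : G * Gᵀ = 1 := mul_eq_one_comm.1 hG
  have hJ' : ∀ a, frameJ n a * Gᵀ = Gᵀ * ∑ b, s b a • frameJ n b := by
    intro a
    have h1 := congrArg (fun Y ↦ Gᵀ * Y * Gᵀ) (hJ a)
    simp only [← Matrix.mul_assoc, hG, Matrix.one_mul] at h1
    rw [h1, Matrix.mul_assoc _ G, hG', Matrix.mul_one]
  have h1 : sandwich (Gᵀ * X * G) = Gᵀ * sandwich X * G := by
    have key := sum_rotate hs
      ((LinearMap.mul ℝ (Mat n)).compl₁₂ (LinearMap.mulRight ℝ X) LinearMap.id) (frameJ n)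
    simp only [LinearMap.compl₁₂_apply, LinearMap.mul_apply', LinearMap.mulRight_apply,
      LinearMap.id_apply] at key
    rw [sandwich, sandwich, ← key, Finset.mul_sum, Finset.sum_mul]
    refine Finset.sum_congr rfl fun a _ ↦ ?_
    simp only [Matrix.mul_assoc, hJ]
    simp only [← Matrix.mul_assoc, hJ']
  have h2 : ∑ a, (Gᵀ * X * G * frameJ n a).trace • frameJ n a
      = Gᵀ * (∑ a, (X * frameJ n a).trace • frameJ n a) * G := by
    have key := sum_rotate hs ((LinearMap.lsmul ℝ (Mat n)).comp
      (Matrix.traceLinearMap (Idx n) ℝ ℝ ∘ₗ LinearMap.mulLeft ℝ X)) (frameJ n)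
    simp only [LinearMap.comp_apply, LinearMap.mulLeft_apply, Matrix.traceLinearMap_apply,
      LinearMap.lsmul_apply] at key
    rw [← key, Finset.mul_sum, Finset.sum_mul]
    refine Finset.sum_congr rfl fun a _ ↦ ?_
    rw [Matrix.mul_smul, Matrix.smul_mul]
    congr 1
    · rw [Matrix.mul_assoc, hJ, Matrix.mul_assoc, Matrix.trace_mul_comm, Matrix.mul_assoc,
        Matrix.mul_assoc, hG', Matrix.mul_one]
    · rw [Matrix.mul_assoc, ← hJ, ← Matrix.mul_assoc, hG, Matrix.one_mul]
  simp only [obsPart, h1, h2, Matrix.mul_add, Matrix.add_mul, Matrix.mul_smul, Matrix.smul_mul]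

/-- A matrix that brackets each `J_a` into `sp(1)` has obstruction part in `ℝ1 + sp(1)`, a subspace
annihilated by `obsPart`; self-adjointness forces the part to vanish. -/
theorem obsPart_eq_zero_of_bracket (hn : n ≠ 0) {κ : Mat n}
    (hκ : ∀ a, κ * frameJ n a - frameJ n a * κ ∈ sp1 n) : obsPart κ = 0 := by
  let L : Submodule ℝ (Mat n) := Submodule.span ℝ {1} ⊔ sp1 n
  have h1 : (1 : Mat n) ∈ L := Submodule.mem_sup_left (Submodule.mem_span_singleton_self _)
  have hJ : ∀ a, frameJ n a ∈ L := fun a ↦ Submodule.mem_sup_right (Submodule.subset_span ⟨a, rfl⟩)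
  have hJJ : ∀ b a, frameJ n b * frameJ n a ∈ L := by
    intro b a
    fin_cases b <;> fin_cases a <;>
      simp [J01, J12, J20, J10, J21, J02, frameJ_sq, h1, hJ]
  have hNJ : ∀ N ∈ sp1 n, ∀ a, N * frameJ n a ∈ L := by
    intro N hN a
    induction hN using Submodule.span_induction with
    | mem _ h =>
      obtain ⟨b, rfl⟩ := h
      exact hJJ b a
    | zero => simp
    | add _ _ _ _ h h' => rw [Matrix.add_mul]; exact L.add_mem h h'
    | smul c _ _ h => rw [Matrix.smul_mul]; exact L.smul_mem c h
  have hL0 : ∀ B ∈ L, obsPart B = 0 := by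
    have : L ≤ LinearMap.ker (obsLinear n) := by
      refine sup_le ?_ fun B hB ↦ obsPart_of_mem_sup hn (Submodule.mem_sup_right hB)
      rw [Submodule.span_le, Set.singleton_subset_iff]
      change obsPart 1 = 0
      simp only [obsPart, sandwich_of_commute (B := (1 : Mat n)) (fun a ↦ by simp),
        Matrix.one_mul, trace_frameJ, zero_smul, Finset.sum_const_zero]
      module
    exact this
  have hLt : ∀ B ∈ L, Bᵀ ∈ L := by
    have : L ≤ L.comap (Matrix.transposeLinearEquiv (Idx n) (Idx n) ℝ ℝ).toLinearMap := by
      refine sup_le ?_ ?_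
      · rw [Submodule.span_le, Set.singleton_subset_iff]
        simpa using h1
      · rw [sp1, Submodule.span_le]
        rintro _ ⟨a, rfl⟩
        simpa [frameJ_transpose] using hJ a
    exact this
  have hmem : obsPart κ ∈ L := by
    -- With `J_a² = -1`, the sum `-¼ ∑ [κ, J_a] J_a` equals `¾ κ + ¼ sandwich κ`.
    have : obsPart κ = -(1 / 4 : ℝ) • ∑ a, (κ * frameJ n a - frameJ n a * κ) * frameJ n a
        + (4 * n : ℝ)⁻¹ • ∑ a, (κ * frameJ n a).trace • frameJ n a := by
      simp only [obsPart, sandwich, Matrix.sub_mul, Matrix.mul_assoc, frameJ_sq,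
        Fin.sum_univ_three, Matrix.mul_neg, Matrix.mul_one]
      module
    rw [this]
    exact L.add_mem (L.smul_mem _ (L.sum_mem fun a _ ↦ hNJ _ (hκ a) a))
      (L.smul_mem _ (L.sum_mem fun a _ ↦ L.smul_mem _ (hJ a)))
  have h0 : (obsPart κ * (obsPart κ)ᵀ).trace = 0 := by
    rw [trace_obsPart_mul, hL0 _ (hLt _ hmem)]
    simp
  exact Matrix.trace_mul_conjTranspose_self_eq_zero_iff.1
    (by rwa [Matrix.conjTranspose_eq_transpose_of_trivial])

/-- Contraction is equivariant under the orthogonal matrix `G`; `κ` is the inhomogeneous term of a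
change of frame, which has no obstruction part. -/
theorem contract_obsPart_rotate (hs : ∀ b c, ∑ a, s b a * s c a = if b = c then 1 else 0)
    (hG : Gᵀ * G = 1) (hJ : ∀ a, G * frameJ n a = (∑ b, s b a • frameJ n b) * G)
    (τ κ : Idx n → Mat n) (hκ : ∀ p, obsPart (κ p) = 0) :
    contract (fun p ↦ obsPart (Gᵀ * (∑ r, G r p • τ r) * G + κ p))
      = Gᵀ *ᵥ contract (fun p ↦ obsPart (τ p)) := by
  have hG' : ∀ r t, ∑ p, G r p * G t p = if r = t then 1 else 0 := fun r t ↦ by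
    have h1 : G * Gᵀ = 1 := mul_eq_one_comm.1 hG
    have := congrFun (congrFun h1 r) t
    rwa [Matrix.mul_apply, Matrix.one_apply] at this
  have h1 : ∀ p, obsPart (Gᵀ * (∑ r, G r p • τ r) * G + κ p)
      = ∑ r, G r p • (Gᵀ * obsPart (τ r) * G) := by
    intro p
    have h2 : obsPart (∑ r, G r p • τ r) = ∑ r, G r p • obsPart (τ r) :=
      (map_sum (obsLinear n) _ _).trans (Finset.sum_congr rfl fun r _ ↦ obsPart_smul _ _)
    rw [obsPart_add, hκ, add_zero, obsPart_rotate hs hG hJ, h2, Finset.mul_sum, Finset.sum_mul]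
    simp only [Matrix.mul_smul, Matrix.smul_mul]
  ext q
  have h3 : ∀ r, ∑ p, G r p * (Gᵀ * obsPart (τ r) * G) q p = (Gᵀ * obsPart (τ r)) q r := by
    intro r
    simp only [Matrix.mul_apply (N := G), Finset.mul_sum]
    rw [Finset.sum_comm]
    have : ∀ t p, G r p * ((Gᵀ * obsPart (τ r)) q t * G t p)
        = (Gᵀ * obsPart (τ r)) q t * (G r p * G t p) := fun t p ↦ by ring
    simp only [this, ← Finset.mul_sum, hG']
    simp
  simp only [contract, h1, Matrix.sum_apply, Matrix.smul_apply, smul_eq_mul]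
  rw [Finset.sum_comm]
  simp only [h3]
  simp only [Matrix.mulVec, dotProduct, Matrix.mul_apply, contract, Finset.mul_sum]
  rw [Finset.sum_comm]

end RotationMatrix

variable {n : ℕ} {M : Type*} [TopologicalSpace M] [ChartedSpace (Model n) M]
  [IsManifold 𝓘(ℝ, Model n) ∞ M]

/-- On `V` the hyper pseudohermitian structure `(H', θ')` arises from `(H, θ)` by the rotation
`S`. -/
structure IsRotation (V : Set M) (H : Triple n M) (θ : Fin 3 → Π x : M, Tan n x →L[ℝ] ℝ)
    (H' : Triple n M) (θ' : Fin 3 → Π x : M, Tan n x →L[ℝ] ℝ) (S : Fin 3 → Fin 3 → M → ℝ) :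
    Prop where
  smooth : ∀ a b, FSmoothOn n (S a b) V
  orth_row : ∀ x ∈ V, ∀ b c, ∑ a, S b a x * S c a x = if b = c then 1 else 0
  orth_col : ∀ x ∈ V, ∀ b c, ∑ a, S a b x * S a c x = if b = c then 1 else 0
  core : ∀ x ∈ V, H'.core x = H.core x
  J : ∀ x ∈ V, ∀ v ∈ H.core x, ∀ a, H'.J a x v = ∑ b, S b a x • H.J b x v
  levi : ∀ x ∈ V, ∀ v ∈ H.core x, ∀ w ∈ H.core x, levi H' θ' x v w = levi H θ x v w
  theta : ∀ x ∈ V, ∀ a v, θ' a x v = ∑ b, S b a x * θ b x v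
  triple : ∀ W ⊆ V, ∀ T : Fin 3 → VF n M, IsNormalizedTriple W H θ T →
    IsNormalizedTriple W H' θ' fun a x ↦ ∑ b, S b a x • T b x

variable {V W : Set M} {H H' : Triple n M} {θ θ' : Fin 3 → Π x : M, Tan n x →L[ℝ] ℝ}
  {S : Fin 3 → Fin 3 → M → ℝ} {ε ε' : Idx n → VF n M} {T T' : Fin 3 → VF n M} {x : M}
  {P : Π x : M, Submodule ℝ (Tan n x)} {D : ConnectionMap n M}

theorem IsRotation.mono (R : IsRotation V H θ H' θ' S) (hW : W ⊆ V) :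
    IsRotation W H θ H' θ' S where
  smooth a b := (R.smooth a b).mono hW
  orth_row x hx := R.orth_row x (hW hx)
  orth_col x hx := R.orth_col x (hW hx)
  core x hx := R.core x (hW hx)
  J x hx := R.J x (hW hx)
  levi x hx := R.levi x (hW hx)
  theta x hx := R.theta x (hW hx)
  triple W' hW' := R.triple W' (hW'.trans hW)

theorem IsMovingFrame.coeff_sum_eps (F : IsMovingFrame V H θ ε T) (hx : x ∈ V) (f : Idx n → ℝ)
    (p : Idx n) : F.isFrame.coeff (Sum.inl p) x (∑ q, f q • ε q x) = f p := by
  have hcε : ∀ q, F.isFrame.coeff (Sum.inl p) x (ε q x) = if q = p then 1 else 0 := fun q ↦ by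
    simpa using F.isFrame.coeff_self hx (Sum.inl p) (Sum.inl q)
  simp [hcε]

/-- The matrix of a frame `ε'` with respect to the frame `ε`. -/
def changeMatrix (H : Triple n M) (θ : Fin 3 → Π x : M, Tan n x →L[ℝ] ℝ) (ε ε' : Idx n → VF n M)
    (x : M) : Mat n :=
  Matrix.of fun q p ↦ QCR.levi H θ x (ε' p x) (ε q x)

/-- The derivative of the change of frame. -/
def changeDeriv (H : Triple n M) (θ : Fin 3 → Π x : M, Tan n x →L[ℝ] ℝ) (ε ε' : Idx n → VF n M)
    (x : M) (w : Tan n x) : Mat n :=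
  Matrix.of fun q p ↦ mvfderiv 𝓘(ℝ, Model n) (fun y ↦ changeMatrix H θ ε ε' y q p) x w

namespace IsRotation

variable (R : IsRotation V H θ H' θ' S) (F : IsMovingFrame V H θ ε T)
  (F' : IsMovingFrame V H' θ' ε' T')

include R F F'

theorem eps_mem (hx : x ∈ V) (p : Idx n) : ε' p x ∈ H.core x := by
  rw [← R.core x hx]
  exact F'.eps_mem hx p

theorem eps_section (p : Idx n) : IsSection H.core (ε' p) V :=
  ⟨(F'.adapted.isSection p).1, fun _ hx ↦ R.eps_mem F F' hx p⟩

theorem eps_eq (hx : x ∈ V) (p : Idx n) :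
    ε' p x = ∑ q, changeMatrix H θ ε ε' x q p • ε q x :=
  F.core_expand hx (R.eps_mem F F' hx p)

theorem coeff_eps (hx : x ∈ V) (p q : Idx n) :
    F.isFrame.coeff (Sum.inl q) x (ε' p x) = changeMatrix H θ ε ε' x q p :=
  F.coeff_inl_core hx (R.eps_mem F F' hx p) q

theorem changeMatrix_smooth (q p : Idx n) :
    FSmoothOn n (fun x ↦ changeMatrix H θ ε ε' x q p) V :=
  F.ph.levi_smooth F.ph.isOpen subset_rfl (R.eps_section F F' p) (F.adapted.isSection q)

theorem changeMatrix_orth (hx : x ∈ V) :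
    (changeMatrix H θ ε ε' x)ᵀ * changeMatrix H θ ε ε' x = 1 := by
  ext p q
  have h1 := F'.levi_eps hx p q
  rw [R.levi x hx _ (R.eps_mem F F' hx p) _ (R.eps_mem F F' hx q),
    F.levi_eq_sum hx (R.eps_mem F F' hx p) (R.eps_mem F F' hx q)] at h1
  simp only [R.coeff_eps F F' hx] at h1
  rw [← h1]
  rfl

/-- Both frames represent their own complex structures by the same constant matrices, so the change
of frame intertwines these up to the rotation `S`. -/
theorem changeMatrix_J (hx : x ∈ V) (a : Fin 3) :
    changeMatrix H θ ε ε' x * frameJ n a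
      = (∑ b, S b a x • frameJ n b) * changeMatrix H θ ε ε' x := by
  ext q r
  have h1 := F'.J_eps hx a r
  rw [R.J x hx _ (R.eps_mem F F' hx r)] at h1
  have h2 := congrArg (F.isFrame.coeff (Sum.inl q) x) h1
  rw [map_sum, map_sum] at h2
  simp only [map_smul, R.coeff_eps F F' hx, smul_eq_mul] at h2
  rw [R.eps_eq F F' hx] at h2
  simp only [F.J_sum_eps hx, F.coeff_sum_eps hx] at h2
  rw [Matrix.mul_apply, Finset.sum_mul, Matrix.sum_apply]
  simp only [Matrix.smul_mul, Matrix.smul_apply, smul_eq_mul]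
  rw [Finset.sum_congr rfl fun s _ ↦ mul_comm _ _, ← h2]
  rfl

/-- The derivative in direction `w` of the relation in `changeMatrix_J`. -/
theorem changeDeriv_J (hx : x ∈ V) (w : Tan n x) (a : Fin 3) :
    changeDeriv H θ ε ε' x w * frameJ n a
      = (∑ b, mvfderiv 𝓘(ℝ, Model n) (S b a) x w • frameJ n b) * changeMatrix H θ ε ε' x
        + (∑ b, S b a x • frameJ n b) * changeDeriv H θ ε ε' x w := by
  ext q r
  have hV := F.ph.isOpen
  have hG : ∀ p q, FDiffAt n (fun y ↦ changeMatrix H θ ε ε' y p q) x := fun p q ↦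
    (R.changeMatrix_smooth F F' p q).fdiffAt hV hx
  have hS : ∀ p q, FDiffAt n (S p q) x := fun p q ↦ FSmoothOn.fdiffAt (R.smooth p q) hV hx
  have hc : ∀ c : ℝ, FDiffAt n (fun _ ↦ c) x := fun c ↦ FDiffAt.const c x
  have h1 : (fun y ↦ ∑ s, changeMatrix H θ ε ε' y q s * frameJ n a s r) =ᶠ[𝓝 x]
      fun y ↦ ∑ b, ∑ s, S b a y * (frameJ n b q s * changeMatrix H θ ε ε' y s r) := by
    filter_upwards [hV.mem_nhds hx] with y hy
    have := congrFun (congrFun (R.changeMatrix_J F F' hy a) q) r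
    rwa [Matrix.mul_apply, sum_smul_mul_apply] at this
  have hconst : ∀ c : ℝ, mvfderiv 𝓘(ℝ, Model n) (fun _ : M ↦ c) x w = 0 := fun c ↦ by
    rw [mvfderiv_eq_zero_of_eventually_const (c := c) (Filter.Eventually.of_forall fun _ ↦ rfl)]
    rfl
  have f1 : ∀ s ∈ Finset.univ,
      FDiffAt n (fun y ↦ changeMatrix H θ ε ε' y q s * frameJ n a s r) x :=
    fun s _ ↦ (hG q s).mul (hc _)
  have f2 : ∀ b, ∀ s ∈ Finset.univ,
      FDiffAt n (fun y ↦ S b a y * (frameJ n b q s * changeMatrix H θ ε ε' y s r)) x :=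
    fun b s _ ↦ (hS b a).mul ((hc _).mul (hG s r))
  have h2 := DFunLike.congr_fun (mvfderiv_congr h1) w
  rw [mvfderiv_finsetSum f1, mvfderiv_finsetSum (fun b _ ↦ FDiffAt.sum (f2 b))] at h2
  rw [Matrix.add_apply, sum_smul_mul_apply, sum_smul_mul_apply, Matrix.mul_apply,
    ← Finset.sum_add_distrib]
  have e1 : ∀ s, mvfderiv 𝓘(ℝ, Model n)
      (fun y ↦ changeMatrix H θ ε ε' y q s * frameJ n a s r) x w
        = changeDeriv H θ ε ε' x w q s * frameJ n a s r := fun s ↦ by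
    rw [mvfderiv_mul_apply (hG q s) (hc _), hconst, mul_zero, zero_add, mul_comm]
    rfl
  have e2 : ∀ b s, mvfderiv 𝓘(ℝ, Model n)
      (fun y ↦ S b a y * (frameJ n b q s * changeMatrix H θ ε ε' y s r)) x w
        = S b a x * (frameJ n b q s * changeDeriv H θ ε ε' x w s r)
          + mvfderiv 𝓘(ℝ, Model n) (S b a) x w
            * (frameJ n b q s * changeMatrix H θ ε ε' x s r) := fun b s ↦ by
    have hJG : FDiffAt n (fun y ↦ frameJ n b q s * changeMatrix H θ ε ε' y s r) x :=
      (hc _).mul (hG s r)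
    rw [mvfderiv_mul_apply (hS b a) hJG, mvfderiv_mul_apply (hc _) (hG s r), hconst]
    change _ * (_ * changeDeriv H θ ε ε' x w s r + _) + _ = _
    ring
  simp only [e1] at h2
  rw [h2]
  refine Finset.sum_congr rfl fun b _ ↦ ?_
  rw [mvfderiv_finsetSum (f2 b)]
  simp only [e2, Finset.sum_add_distrib]
  ring

/-- Multiplying the differentiated relation by `Gᵀ` shows that the bracket of `Gᵀ dG(w)` with each
`J_a` is a conjugate of a combination of the units, hence lies in `sp(1)`. -/
theorem obsPart_changeDeriv (hn : n ≠ 0) (hx : x ∈ V) (w : Tan n x) :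
    obsPart ((changeMatrix H θ ε ε' x)ᵀ * changeDeriv H θ ε ε' x w) = 0 := by
  have hG := R.changeMatrix_orth F F' hx
  have hG' : changeMatrix H θ ε ε' x * (changeMatrix H θ ε ε' x)ᵀ = 1 := mul_eq_one_comm.1 hG
  have hJ := R.changeMatrix_J F F' hx
  have hJ1 : ∀ a, (changeMatrix H θ ε ε' x)ᵀ * (∑ b, S b a x • frameJ n b)
      * changeMatrix H θ ε ε' x = frameJ n a := fun a ↦ by
    rw [Matrix.mul_assoc, ← hJ, ← Matrix.mul_assoc, hG, Matrix.one_mul]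
  have hJ2 : ∀ a, (changeMatrix H θ ε ε' x)ᵀ * (∑ b, S b a x • frameJ n b)
      = frameJ n a * (changeMatrix H θ ε ε' x)ᵀ := fun a ↦ by
    have h1 := congrArg (· * (changeMatrix H θ ε ε' x)ᵀ) (hJ1 a)
    simpa [Matrix.mul_assoc, hG'] using h1
  -- Orthonormality of the rows of `S` recovers `J_b` from the rotated units, whose conjugates are
  -- known.
  have hJ3 : ∀ b, (changeMatrix H θ ε ε' x)ᵀ * frameJ n b * changeMatrix H θ ε ε' x ∈ sp1 n := by
    intro b
    have h1 : frameJ n b = ∑ a, S b a x • ∑ c, S c a x • frameJ n c := by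
      simp only [Finset.smul_sum, smul_smul]
      rw [Finset.sum_comm]
      simp only [← Finset.sum_smul, R.orth_row x hx]
      simp
    rw [h1]
    simp only [Finset.mul_sum (s := (Finset.univ : Finset (Fin 3))) (f := fun a ↦ S b a x • _),
      Finset.sum_mul, Matrix.mul_smul, Matrix.smul_mul, hJ1]
    exact Submodule.sum_mem _ fun a _ ↦ Submodule.smul_mem _ _ (Submodule.subset_span ⟨a, rfl⟩)
  refine obsPart_eq_zero_of_bracket hn fun a ↦ ?_
  rw [Matrix.mul_assoc, R.changeDeriv_J F F' hx w a, Matrix.mul_add, ← Matrix.mul_assoc _ _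
    (changeDeriv H θ ε ε' x w), hJ2, Matrix.mul_assoc (frameJ n a), add_sub_cancel_right,
    Finset.sum_mul, Finset.mul_sum]
  refine Submodule.sum_mem _ fun b _ ↦ ?_
  rw [Matrix.smul_mul, Matrix.mul_smul, ← Matrix.mul_assoc]
  exact Submodule.smul_mem _ _ (hJ3 b)

/-- The gauge transformation rule for connection forms; the direction `ε'_p` is expanded in the old
frame as well. -/
theorem connectionMatrix_change (hD : IsCovariantDerivativeOn (Model n) D V)
    (hc : IsPreserved V D H.core) (hx : x ∈ V) (p : Idx n) :
    connectionMatrix H' θ' D ε' x (ε' p x)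
      = (changeMatrix H θ ε ε' x)ᵀ * (∑ r, changeMatrix H θ ε ε' x r p •
          connectionMatrix H θ D ε x (ε r x)) * changeMatrix H θ ε ε' x
        + (changeMatrix H θ ε ε' x)ᵀ * changeDeriv H θ ε ε' x (ε' p x) := by
  have hV := F.ph.isOpen
  have hG : ∀ p q, FDiffAt n (fun y ↦ changeMatrix H θ ε ε' y p q) x := fun p q ↦
    (R.changeMatrix_smooth F F' p q).fdiffAt hV hx
  have hm : ∀ q w, D (ε q) x w ∈ H.core x := fun q w ↦
    hc V hV subset_rfl _ (F.adapted.isSection q) x hx w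
  have hm' : ∀ q w, D (ε' q) x w ∈ H.core x := fun q w ↦
    hc V hV subset_rfl _ (R.eps_section F F' q) x hx w
  have hDε : ∀ q w, D (ε' q) x w = ∑ s, (changeMatrix H θ ε ε' x s q • D (ε s) x w
      + changeDeriv H θ ε ε' x w s q • ε s x) := by
    intro q w
    have h1 := IsCovariantDerivativeOn.sum_smul hD hx (fun s ↦ hG s q)
      (fun s ↦ (F.adapted.isSection s).1.diffAt hV hx) w
    rw [hD.congr_of_eventuallyEq ((F'.adapted.isSection q).1.diffAt hV hx)
      (DiffAt.sum fun s _ ↦ DiffAt.smul (hG s q) ((F.adapted.isSection s).1.diffAt hV hx))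
      (hV.mem_nhds hx) (σ' := fun y ↦ ∑ s, changeMatrix H θ ε ε' y s q • ε s y), h1]
    · rfl
    · filter_upwards [hV.mem_nhds hx] with y hy using R.eps_eq F F' hy q
  have hω : ∀ q s, F.isFrame.coeff (Sum.inl s) x (D (ε q) x (ε' p x))
      = (∑ r, changeMatrix H θ ε ε' x r p • connectionMatrix H θ D ε x (ε r x)) s q := by
    intro q s
    rw [R.eps_eq F F' hx p, map_sum, map_sum, Matrix.sum_apply]
    refine Finset.sum_congr rfl fun r _ ↦ ?_
    rw [map_smul, map_smul, F.coeff_inl_core hx (hm _ _)]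
    rfl
  ext r q
  have h1 : connectionMatrix H' θ' D ε' x (ε' p x) r q
      = QCR.levi H θ x (D (ε' q) x (ε' p x)) (ε' r x) :=
    R.levi x hx _ (hm' _ _) _ (R.eps_mem F F' hx r)
  rw [h1, F.levi_eq_sum hx (hm' _ _) (R.eps_mem F F' hx r), Matrix.mul_assoc, ← Matrix.mul_add,
    Matrix.mul_apply]
  refine Finset.sum_congr rfl fun s _ ↦ ?_
  rw [R.coeff_eps F F' hx, Matrix.transpose_apply, mul_comm, hDε, Finset.sum_add_distrib, map_add,
    F.coeff_sum_eps hx, map_sum, Matrix.add_apply, Matrix.mul_apply]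
  congr 2
  refine Finset.sum_congr rfl fun t _ ↦ ?_
  rw [map_smul, hω, smul_eq_mul, mul_comm]

/-- The inhomogeneous term drops out, so vanishing of the obstruction depends neither on the adapted
frame nor on the representative of the rotated structure. -/
theorem contract_change (hn : n ≠ 0) (hD : IsCovariantDerivativeOn (Model n) D V)
    (hc : IsPreserved V D H.core) (hx : x ∈ V) :
    contract (fun p ↦ obsPart (connectionMatrix H' θ' D ε' x (ε' p x)))
      = (changeMatrix H θ ε ε' x)ᵀ *ᵥ
        contract (fun p ↦ obsPart (connectionMatrix H θ D ε x (ε p x))) := by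
  rw [← contract_obsPart_rotate (fun b c ↦ R.orth_row x hx b c) (R.changeMatrix_orth F F' hx)
    (R.changeMatrix_J F F' hx) _ _ fun p ↦ R.obsPart_changeDeriv F F' hn hx (ε' p x)]
  simp only [R.connectionMatrix_change F F' hD hc hx]

end IsRotation

end Rotation

/-! ### Transfer of canonical connections along rotations. -/

section Transfer

open Matrix

variable {n : ℕ} {M : Type*} [TopologicalSpace M] [ChartedSpace (Model n) M]
  [IsManifold 𝓘(ℝ, Model n) ∞ M]

variable {V W : Set M} {H H' : Triple n M} {θ θ' : Fin 3 → Π x : M, Tan n x →L[ℝ] ℝ}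
  {S : Fin 3 → Fin 3 → M → ℝ} {ε : Idx n → VF n M} {T : Fin 3 → VF n M} {x : M}
  {P : Π x : M, Submodule ℝ (Tan n x)} {D : ConnectionMap n M}

/-- No complementarity is needed: the default value `0` also belongs to `A`. -/
theorem component_mem {E : Type*} [AddCommGroup E] [Module ℝ E] (A B : Submodule ℝ E) (v : E) :
    component A B v ∈ A := by
  rw [component]
  split_ifs
  exacts [Submodule.coe_mem _, A.zero_mem]

namespace IsRotation

variable (R : IsRotation W H θ H' θ' S)

include R

theorem perpForm_eq (hx : x ∈ W) (v w : Tan n x) : perpForm θ' x v w = perpForm θ x v w := by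
  have key := sum_rotate (fun b c ↦ R.orth_row x hx b c)
    ((LinearMap.mul ℝ ℝ).compl₁₂ (LinearMap.fst ℝ ℝ ℝ) (LinearMap.snd ℝ ℝ ℝ))
    (fun b ↦ (θ b x v, θ b x w))
  simp only [LinearMap.compl₁₂_apply, LinearMap.mul_apply', LinearMap.fst_apply,
    LinearMap.snd_apply, Prod.fst_sum, Prod.snd_sum, Prod.smul_fst, Prod.smul_snd,
    smul_eq_mul] at key
  simp only [perpForm, R.theta x hx]
  exact key

theorem leviExt_eq (hx : x ∈ W) (v w : Tan n x) : leviExt H' θ' P x v w = leviExt H θ P x v w := by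
  rw [leviExt, leviExt, R.core x hx, R.levi x hx _ (component_mem _ _ _) _ (component_mem _ _ _)]

theorem isSection_iff (hV : V ⊆ W) {X : VF n M} :
    IsSection H'.core X V ↔ IsSection H.core X V :=
  and_congr_right fun _ ↦ forall₂_congr fun x hx ↦ by rw [R.core x (hV hx)]

/-- The associated connections of two structures related by a rotation coincide. -/
theorem associated (h : IsAssociatedConnection W H θ P D) :
    IsAssociatedConnection W H' θ' P D where
  isConnection := h.isConnection
  smooth := h.smooth
  preserves_core V hV hVW Y hY x hx w := by
    rw [R.core x (hVW hx)]
    exact h.preserves_core V hV hVW Y ((R.isSection_iff hVW).1 hY) x hx w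
  preserves_perp := h.preserves_perp
  parallel_levi V hV hVW Y Z hY hZ x hx w := by
    rw [R.leviExt_eq (hVW hx), R.leviExt_eq (hVW hx), ← h.parallel_levi V hV hVW Y Z hY hZ x hx w,
      mvfderiv_congr]
    filter_upwards [hV.mem_nhds hx] with y hy using R.leviExt_eq (hVW hy) _ _
  parallel_perp V hV hVW Y Z hY hZ x hx w := by
    rw [R.perpForm_eq (hVW hx), R.perpForm_eq (hVW hx),
      ← h.parallel_perp V hV hVW Y Z hY hZ x hx w, mvfderiv_congr]
    filter_upwards [hV.mem_nhds hx] with y hy using R.perpForm_eq (hVW hy) _ _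
  torsion_core V hV hVW X Y hX hY x hx := by
    rw [R.core x (hVW hx)]
    exact h.torsion_core V hV hVW X Y ((R.isSection_iff hVW).1 hX) ((R.isSection_iff hVW).1 hY) x hx
  torsion_perp V hV hVW A B hA hB x hx := by
    rw [R.core x (hVW hx)]
    exact h.torsion_perp V hV hVW A B hA hB x hx
  torsion_symm_core V hV hVW A X Y hA hX hY x hx := by
    rw [R.isSection_iff hVW] at hX hY
    rw [R.core x (hVW hx), R.levi x (hVW hx) _ (component_mem _ _ _) _ (hY.2 x hx),
      R.levi x (hVW hx) _ (hX.2 x hx) _ (component_mem _ _ _)]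
    exact h.torsion_symm_core V hV hVW A X Y hA hX hY x hx
  torsion_symm_perp V hV hVW X A B hX hA hB x hx := by
    rw [R.isSection_iff hVW] at hX
    rw [R.core x (hVW hx), R.perpForm_eq (hVW hx), R.perpForm_eq (hVW hx)]
    exact h.torsion_symm_perp V hV hVW X A B hX hA hB x hx

theorem span_eq (hx : x ∈ W) (t : Fin 3 → Tan n x) :
    Submodule.span ℝ (Set.range fun a ↦ ∑ b, S b a x • t b) = Submodule.span ℝ (Set.range t) := by
  apply le_antisymm <;> rw [Submodule.span_le] <;> rintro _ ⟨a, rfl⟩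
  · exact Submodule.sum_mem _ fun b _ ↦ Submodule.smul_mem _ _ (Submodule.subset_span ⟨b, rfl⟩)
  · have h1 : t a = ∑ c, S a c x • ∑ b, S b c x • t b := by
      simp only [Finset.smul_sum, smul_smul]
      rw [Finset.sum_comm]
      simp only [← Finset.sum_smul, R.orth_row x hx]
      simp
    rw [h1]
    exact Submodule.sum_mem _ fun c _ ↦ Submodule.smul_mem _ _ (Submodule.subset_span ⟨c, rfl⟩)

/-- A moving frame without obstruction defines the canonical connection of every rotated
structure. -/
theorem isCanonical (hn : n ≠ 0) (F : IsMovingFrame V H θ ε T) (hF : ∀ x ∈ V, F.obstruction x = 0)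
    (hP : ∀ x ∈ V, P x = Submodule.span ℝ (Set.range fun a ↦ T a x)) (hWV : W ⊆ V)
    (h' : IsPseudohermitian W H' θ') : IsCanonical W H' θ' P F.connection := by
  have hT' := R.triple W subset_rfl T (F.normalized.mono hWV)
  have hP' : ∀ x ∈ W, P x = Submodule.span ℝ (Set.range fun a ↦ ∑ b, S b a x • T b x) :=
    fun x hx ↦ by rw [hP x (hWV hx), R.span_eq hx]
  have hD := F.isAssociatedConnection_connection F.ph.isOpen subset_rfl hP
  have hD' := R.associated (F.isAssociatedConnection_connection h'.isOpen hWV hP)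
  refine ⟨⟨_, hT'.admissible h' subset_rfl, hP'⟩, hD', ?_⟩
  intro V' hV' hV'W ε' hε' x hx
  -- The `E ⊗ H` condition ranges over all adapted frames of the rotated structure, and each is
  -- compared with the one frame whose obstruction is known to vanish.
  have F' : IsMovingFrame V' H' θ' ε' _ := ⟨h'.mono hV' hV'W, hε', hT'.mono hV'W⟩
  have hsk : ∀ p, (connectionMatrix H' θ' F.connection ε' x (ε' p x))ᵀ
      = - connectionMatrix H' θ' F.connection ε' x (ε' p x) := by
    intro p
    rw [F'.connectionMatrix_eq hV'W (fun y hy ↦ hP' y (hV'W hy)) hD' hx]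
    exact F'.symbolMatrix_transpose x p
  rw [ehComponentVanishes_iff hn hsk, (R.mono hV'W).contract_change (F.mono hV' (hV'W.trans hWV)) F'
    hn (F.connection_isCovariantDerivativeOn.mono (hV'W.trans hWV))
    (fun V₁ hV₁ hV₁' ↦ hD.preserves_core V₁ hV₁ (hV₁'.trans (hV'W.trans hWV))) hx]
  simp only [F.connectionMatrix_eq subset_rfl hP hD (hWV (hV'W hx))]
  exact (congrArg _ (hF x (hWV (hV'W hx)))).trans (Matrix.mulVec_zero _)

end IsRotation

/-! ### Rotations from the gluing condition -/

/-- `t` is an admissible triple of vectors with `θ_a(t_b) = δ_{ab}`. -/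
def IsNormalizedAt (H : Triple n M) (θ : Fin 3 → Π x : M, Tan n x →L[ℝ] ℝ) (x : M)
    (t : Fin 3 → Tan n x) : Prop :=
  (∀ a b, θ a x (t b) = if a = b then 1 else 0) ∧ ∀ a, H.J a x (t (a + 1)) = t (a + 2)

namespace IsPseudohermitian

variable (h : IsPseudohermitian V H θ)

include h

theorem exists_add_act_of_normalizedAt (hx : x ∈ V) {t t' : Fin 3 → Tan n x}
    (ht : IsNormalizedAt H θ x t) (ht' : IsNormalizedAt H θ x t') :
    ∃ z ∈ H.core x, ∀ a, t' a = t a + H.J a x z := by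
  have hm : ∀ a, t' a - t a ∈ H.core x := fun a ↦ (h.mem_core_iff hx).2 fun b ↦ by
    rw [map_sub, ht.1, ht'.1, sub_self]
  have hact : ∀ a, H.J a x (t' (a + 1) - t (a + 1)) = t' (a + 2) - t (a + 2) := fun a ↦ by
    rw [map_sub, ht.2, ht'.2]
  refine ⟨- H.J 2 x (t' 2 - t 2), Submodule.neg_mem _ (h.J_mem hx (hm 2) 2), fun a ↦ ?_⟩
  rw [← sub_eq_iff_eq_add', map_neg]
  have h0 : H.J 1 x (t' 2 - t 2) = t' 0 - t 0 := hact 1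
  have h1 : H.J 0 x (t' 1 - t 1) = t' 2 - t 2 := hact 0
  fin_cases a
  · exact (h0.symm.trans (by rw [Fin.zero_eta, h.J02 hx (hm 2), neg_neg]))
  · change t' 1 - t 1 = - H.J 1 x _
    rw [h.J12 hx (hm 2), ← h1, h.J00 hx (hm 1), neg_neg]
  · change t' 2 - t 2 = - H.J 2 x _
    rw [h.J22 hx (hm 2), neg_neg]

theorem normalizedAt_of_admissible (hx : x ∈ V) {t : Fin 3 → Tan n x}
    (ht : H.IsAdmissibleAt x t) :
    IsNormalizedAt H θ x (fun a ↦ (θ 0 x (t 0))⁻¹ • t a) := by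
  obtain ⟨h0, h1⟩ := h.theta_admissible hx ht
  refine ⟨fun a b ↦ ?_, fun a ↦ ?_⟩
  · rw [map_smul, smul_eq_mul, h1 a b, mul_ite, mul_zero, inv_mul_cancel₀ h0]
  · rw [map_smul, (ht a).2.2.2]

/-- For the first two indices this is `I_a² = -1` on `Q_a`; for the third it follows from the
definition of `I_2` on `I_0(Q_0 ∩ Q_1)`. -/
theorem J_normalizedAt (hx : x ∈ V) {t : Fin 3 → Tan n x} (ht : IsNormalizedAt H θ x t)
    (a : Fin 3) : H.J a x (t (a + 2)) = - t (a + 1) := by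
  have hQ : ∀ a b, a ≠ b → t b ∈ H.Q a x := fun a b hab ↦ by
    rw [h.mem_Q_iff hx, ht.1, if_neg hab]
  have h0 : H.J 0 x (t 1) = t 2 := ht.2 0
  have h1 : H.J 1 x (t 2) = t 0 := ht.2 1
  have e0 : H.J 0 x (t 2) = - t 1 := by
    rw [← h0, h.hyper.first.sq x hx _ (hQ 0 1 (by decide))]
  have e1 : H.J 1 x (t 0) = - t 2 := by
    rw [← h1, h.hyper.second.sq x hx _ (hQ 1 2 (by decide))]
  have e2 : H.J 2 x (t 1) = - t 0 := by
    rw [h.hyper.third_J_left x hx (t 1) ⟨- t 2, ⟨Submodule.neg_mem _ (hQ 0 2 (by decide)),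
      Submodule.neg_mem _ (hQ 1 2 (by decide))⟩, by rw [map_neg, e0, neg_neg]⟩, h0, h1]
  fin_cases a
  exacts [e0, e1, e2]

/-- `dθ_a + g(·, I_a ·)` is invariant under the complex structures. -/
theorem dForm_add_levi_J (hx : x ∈ V) (a c : Fin 3) {v w : Tan n x} (hv : v ∈ H.core x)
    (hw : w ∈ H.core x) :
    dForm (θ a) x (H.J c x v) w + levi H θ x (H.J c x v) (H.J a x w)
      = -(dForm (θ a) x v (H.J c x w) + levi H θ x v (H.J a x (H.J c x w))) := by
  obtain ⟨V₁, ε, hV₁, hxV₁, hV₁V, hε⟩ := h.exists_adaptedFrame hx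
  obtain ⟨V₂, T, hV₂, hxV₂, hV₂V, hT⟩ := h.exists_normalized hx
  have F : IsMovingFrame (V₁ ∩ V₂) H θ ε T := ⟨h.mono (hV₁.inter hV₂) fun y hy ↦ hV₁V hy.1,
    hε.mono Set.inter_subset_left, hT.mono Set.inter_subset_right⟩
  have hx' : x ∈ V₁ ∩ V₂ := ⟨hxV₁, hxV₂⟩
  obtain ⟨B, hB⟩ := exists_dForm_eq (h.compatible.smooth a) h.isOpen hx
  obtain ⟨L, hL⟩ := h.exists_levi_eq hx
  let G : Tan n x →ₗ[ℝ] Tan n x →ₗ[ℝ] ℝ := (B + L.compl₂ (H.J a x)).comp (H.J c x)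
    + (B + L.compl₂ (H.J a x)).compl₂ (H.J c x)
  suffices hG : G v w = 0 by
    simp only [G, LinearMap.add_apply, LinearMap.comp_apply, LinearMap.compl₂_apply] at hG
    rw [hB, hL, hB, hL]
    linarith
  -- On an adapted frame the claim is the commutation relation `dMatrix_commute`; bilinearity
  -- extends it to the core.
  have hpq : ∀ p q, G (ε p x) (ε q x) = 0 := by
    intro p q
    have hLJ : ∀ X Y : Mat n, L (∑ r, X r p • ε r x) (∑ r, Y r q • ε r x) = (Xᵀ * Y) p q :=
      fun X Y ↦ by rw [← hL, F.levi_sum hx']; rfl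
    have hL1 : ∀ Y : Mat n, L (ε p x) (∑ r, Y r q • ε r x) = Y p q := fun Y ↦ by
      have := hLJ 1 Y
      simpa [Matrix.one_apply] using this
    have h1 := F.dForm_J_eps hx' a c p q
    have h2 := F.dForm_eps_J hx' a c p q
    have h3 := congrFun (congrFun (F.dMatrix_commute hx' a c) p) q
    rw [hB] at h1 h2
    simp only [G, LinearMap.add_apply, LinearMap.comp_apply, LinearMap.compl₂_apply, h1, h2]
    have h4 : H.J a x (H.J c x (ε q x)) = ∑ r, (frameJ n a * frameJ n c) r q • ε r x := by
      rw [F.J_eps hx', F.J_sum_eps hx']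
      rfl
    rw [h4, hL1, F.J_eps hx' c, F.J_eps hx' a, hLJ, frameJ_transpose, Matrix.neg_mul]
    rw [Matrix.mul_add, Matrix.add_mul, Matrix.add_apply, Matrix.add_apply] at h3
    rw [Matrix.neg_apply]
    linarith
  rw [F.core_expand hx' hv, F.core_expand hx' hw]
  simp [LinearMap.sum_apply, hpq]

end IsPseudohermitian

/-- The cross product of two consecutive columns of a rotation is the third: the adjugate equals the
transpose. Here the determinant being `+1` matters. -/
theorem cross_of_specialOrthogonal {s : Matrix (Fin 3) (Fin 3) ℝ}
    (hs : s ∈ Matrix.specialOrthogonalGroup (Fin 3) ℝ) (a e : Fin 3) :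
    s (e + 1) a * s (e + 2) (a + 1) - s (e + 2) a * s (e + 1) (a + 1) = s e (a + 2) := by
  rw [Matrix.mem_specialOrthogonalGroup_iff, Matrix.mem_orthogonalGroup_iff'] at hs
  have h1 : s.adjugate = sᵀ := by
    rw [← Matrix.one_mul s.adjugate, ← hs.1, Matrix.mul_assoc, Matrix.mul_adjugate, hs.2, one_smul,
      Matrix.mul_one]
  have h2 := congrFun (congrFun h1 (a + 2)) e
  rw [Matrix.transpose_apply, Matrix.adjugate_fin_three] at h2
  rw [← h2]
  fin_cases a <;> fin_cases e <;> simp <;> ring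

end Transfer

/-! ### From the pointwise gluing condition to a smooth rotation. -/

section Glue

open Matrix

variable {n : ℕ} {M : Type*} [TopologicalSpace M] [ChartedSpace (Model n) M]
  [IsManifold 𝓘(ℝ, Model n) ∞ M]

variable {V : Set M} {H H' : Triple n M} {θ θ' : Fin 3 → Π x : M, Tan n x →L[ℝ] ℝ}
  {S : M → Matrix (Fin 3) (Fin 3) ℝ} {s : Matrix (Fin 3) (Fin 3) ℝ} {x : M}

/-- The complex structures of two structures that are glued at a point. -/
theorem GluesAt.J_eq (h : IsPseudohermitian V H θ) (h' : IsPseudohermitian V H' θ') (hx : x ∈ V)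
    (hs : GluesAt H H' x s) (hθ : ∀ a, θ' a x = ∑ b, s b a • θ b x) {t : Fin 3 → Tan n x}
    (ht : IsNormalizedAt H θ x t) {a : Fin 3} {w : Tan n x} (hw : θ' a x w = 0) :
    H'.J a x w = ∑ b, s b a • H.J b x (w - θ b x w • t b) := by
  obtain ⟨u, u', Ju, Ju', hu, hu', hJu, hJu', hv⟩ := hs
  obtain ⟨z, hz, huz⟩ := h.exists_add_act_of_normalizedAt hx ht
    (h.normalizedAt_of_admissible hx hu)
  obtain ⟨h0, h1⟩ := h'.theta_admissible hx hu'
  -- For the unit vector `e_a` the family member is the kernel of `θ'_a`, and `S e_a` is the `a`-th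
  -- column.
  have hmem : w ∈ H'.familyQ x u' (Pi.single a 1) := by
    refine ⟨w - ∑ b, ((θ' 0 x (u' 0))⁻¹ * θ' b x w) • u' b, ?_,
      fun b ↦ (θ' 0 x (u' 0))⁻¹ * θ' b x w, ?_, by rw [sub_add_cancel]⟩
    · rw [h'.mem_core_iff hx]
      intro b
      simp only [map_sub, map_sum, map_smul, smul_eq_mul, h1 b, mul_ite, mul_zero,
        Finset.sum_ite_eq, Finset.mem_univ, if_true]
      field_simp
      ring
    · simp [Pi.single_apply, hw]
  have key := (hv (Pi.single a 1) (by simp [Pi.single_apply])).2 w hmem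
  simp only [Matrix.mulVec_single_one, Matrix.col_apply, Pi.single_apply, ite_smul, one_smul,
    zero_smul, Finset.sum_ite_eq', Finset.mem_univ, if_true] at key
  rw [← (hJu' a).1 w ((h'.mem_Q_iff hx).2 hw), key]
  -- The extended structure annihilates `u_b`, so it sees `w` only modulo `u_b`. Exchanging the
  -- normalized `u_b` for `t_b` costs `θ_b(w) z`.
  have hb : ∀ b, Ju b w = H.J b x (w - θ b x w • t b) + θ b x w • z := by
    intro b
    have hQ : w - θ b x w • ((θ 0 x (u 0))⁻¹ • u b) ∈ H.Q b x := by
      rw [h.mem_Q_iff hx, map_sub, map_smul, (h.normalizedAt_of_admissible hx hu).1 b b, if_pos rfl,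
        smul_eq_mul, mul_one, sub_self]
    have e1 : Ju b w = Ju b (w - θ b x w • ((θ 0 x (u 0))⁻¹ • u b)) := by
      rw [map_sub, map_smul, map_smul, (hJu b).2, smul_zero, smul_zero, sub_zero]
    rw [e1, (hJu b).1 _ hQ, huz b, smul_add, ← sub_sub, map_sub, map_smul (H.J b x) _ (H.J b x z),
      h.J_sq hx hz, smul_neg, sub_neg_eq_add]
  -- These corrections add up to `θ'_a(w) z = 0`, so the choice of admissible triple is irrelevant.
  have hz0 : ∑ b, s b a • θ b x w • z = 0 := by
    have : ∑ b, s b a * θ b x w = 0 := by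
      rw [hθ a] at hw
      simpa using hw
    simp only [smul_smul, ← Finset.sum_smul, this, zero_smul]
  simp only [hb, smul_add, Finset.sum_add_distrib, hz0, add_zero]

theorem GluesAt.core_eq (h : IsPseudohermitian V H θ) (h' : IsPseudohermitian V H' θ')
    (hx : x ∈ V) (hs : s ∈ Matrix.specialOrthogonalGroup (Fin 3) ℝ)
    (hθ : ∀ a, θ' a x = ∑ b, s b a • θ b x) : H'.core x = H.core x := by
  have hs' := (Matrix.mem_orthogonalGroup_iff _ _).1 (Matrix.mem_specialOrthogonalGroup_iff.1 hs).1
  have hvec : ∀ v, (fun a ↦ θ' a x v) = sᵀ *ᵥ fun b ↦ θ b x v := fun v ↦ by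
    funext a
    simp [hθ, Matrix.mulVec, dotProduct]
  ext v
  have e1 : v ∈ H'.core x ↔ (fun a ↦ θ' a x v) = 0 := by
    rw [h'.mem_core_iff hx, funext_iff]; rfl
  have e2 : v ∈ H.core x ↔ (fun a ↦ θ a x v) = 0 := by
    rw [h.mem_core_iff hx, funext_iff]; rfl
  rw [e1, e2, hvec]
  refine ⟨fun h0 ↦ ?_, fun h0 ↦ by rw [h0, Matrix.mulVec_zero]⟩
  have := congrArg (s *ᵥ ·) h0
  simpa [Matrix.mulVec_mulVec, ← Matrix.star_eq_conjTranspose, hs'] using this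

/-- On the core `dθ` is minus `θ` of a bracket, which involves `θ` only at `x`. Hence no derivative
of the rotation appears, and its smoothness is not needed yet. -/
theorem dForm_eq_sum_of_core (h : IsPseudohermitian V H θ) (h' : IsPseudohermitian V H' θ')
    (hx : x ∈ V) (hcore : ∀ y ∈ V, H'.core y = H.core y)
    (hθ : ∀ a, θ' a x = ∑ b, s b a • θ b x) (a : Fin 3) {v w : Tan n x} (hv : v ∈ H.core x)
    (hw : w ∈ H.core x) : dForm (θ' a) x v w = ∑ b, s b a * dForm (θ b) x v w := by
  obtain ⟨V₁, X, hV₁, hxV₁, hV₁V, hX, rfl⟩ := h.exists_core_section hx hv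
  obtain ⟨V₂, Y, hV₂, hxV₂, hV₂V, hY, rfl⟩ := h.exists_core_section hx hw
  have hXd := hX.1.diffAt hV₁ hxV₁
  have hYd := hY.1.diffAt hV₂ hxV₂
  rw [dForm_eq_neg_bracket (h'.compatible.smooth a) h'.isOpen hx hXd hYd, hθ a]
  · have : ∀ b, dForm (θ b) x (X x) (Y x) = - θ b x (bracket X Y x) := fun b ↦
      dForm_eq_neg_bracket (h.compatible.smooth b) h.isOpen hx hXd hYd
        (Filter.eventually_of_mem (hV₁.mem_nhds hxV₁) fun y hy ↦
          h.theta_core (hV₁V hy) (hX.2 y hy) b)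
        (Filter.eventually_of_mem (hV₂.mem_nhds hxV₂) fun y hy ↦
          h.theta_core (hV₂V hy) (hY.2 y hy) b)
    simp [this]
  · exact Filter.eventually_of_mem (hV₁.mem_nhds hxV₁) fun y hy ↦
      h'.theta_core (hV₁V hy) (by rw [hcore y (hV₁V hy)]; exact hX.2 y hy) a
  · exact Filter.eventually_of_mem (hV₂.mem_nhds hxV₂) fun y hy ↦
      h'.theta_core (hV₂V hy) (by rw [hcore y (hV₂V hy)]; exact hY.2 y hy) a

/-- The form `β = dθ'_0 + g(·, I'_0 ·)` is a combination of the forms `dθ_b + g(·, I_b ·)`, hence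
invariant under all complex structures. It cancels in the formula for the new Levi form, which
leaves `g`. -/
theorem levi_eq_of_core (h : IsPseudohermitian V H θ) (h' : IsPseudohermitian V H' θ')
    (hx : x ∈ V) (hcore : ∀ y ∈ V, H'.core y = H.core y)
    (hθ : ∀ a, θ' a x = ∑ b, s b a • θ b x)
    (hJ : ∀ a, ∀ v ∈ H.core x, H'.J a x v = ∑ b, s b a • H.J b x v) {v w : Tan n x}
    (hv : v ∈ H.core x) (hw : w ∈ H.core x) : levi H' θ' x v w = levi H θ x v w := by
  have hc := hcore x hx
  choose B hB using fun a ↦ exists_dForm_eq (h.compatible.smooth a) h.isOpen hx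
  obtain ⟨L, hL⟩ := h.exists_levi_eq hx
  have hJm : ∀ a, ∀ v ∈ H.core x, H'.J a x v ∈ H.core x := fun a v hv ↦ by
    rw [← hc] at hv ⊢
    exact h'.J_mem hx hv a
  let β : Tan n x →ₗ[ℝ] Tan n x →ₗ[ℝ] ℝ := ∑ b, s b 0 • (B b + L.compl₂ (H.J b x))
  have hβ : ∀ v ∈ H.core x, ∀ w ∈ H.core x,
      β v w = dForm (θ' 0) x v w + L v (H'.J 0 x w) := by
    intro v hv w hw
    rw [dForm_eq_sum_of_core h h' hx hcore hθ 0 hv hw, hJ 0 w hw]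
    simp [β, LinearMap.sum_apply, hB, Finset.sum_add_distrib]
  have hinv : ∀ c, ∀ v ∈ H.core x, ∀ w ∈ H.core x,
      β (H'.J c x v) w = - β v (H'.J c x w) := by
    intro c v hv w hw
    rw [hJ c v hv, hJ c w hw]
    have h1 : ∀ d, β (H.J d x v) w = - β v (H.J d x w) := by
      intro d
      simp only [β, LinearMap.sum_apply, LinearMap.smul_apply, LinearMap.add_apply,
        LinearMap.compl₂_apply, ← Finset.sum_neg_distrib, smul_eq_mul]
      refine Finset.sum_congr rfl fun b _ ↦ ?_
      rw [← mul_neg, ← hB, ← hB, ← hL, ← hL, h.dForm_add_levi_J hx b d hv hw]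
    simp [LinearMap.sum_apply, h1]
  have hLJ : ∀ c, ∀ v ∈ H.core x, ∀ w ∈ H.core x, L (H'.J c x v) w = - L v (H'.J c x w) := by
    intro c v hv w hw
    rw [hJ c v hv, hJ c w hw]
    have h1 : ∀ d, L (H.J d x v) w = - L v (H.J d x w) := fun d ↦ by
      rw [← hL, ← hL, h.levi_J_left hx hv hw]
    simp [LinearMap.sum_apply, h1]
  have hv1 := hJm 1 v hv
  have hw2 := hJm 2 w hw
  have e1 := hinv 1 v hv _ hw2
  have hw' := hw
  rw [← hc] at hw'
  rw [h'.J12 hx hw', hβ _ hv1 _ hw2, hβ _ hv _ (hJm 0 w hw), h'.J02 hx hw', h'.J00 hx hw',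
    map_neg, map_neg, hLJ 1 v hv _ (hJm 1 w hw), h'.J11 hx hw', map_neg] at e1
  rw [levi, hL]
  linarith

/-- The gluing condition for hyper pseudohermitian structures. -/
theorem isRotation_of_gluesAt (h : IsPseudohermitian V H θ) (h' : IsPseudohermitian V H' θ')
    (hS : ∀ x ∈ V, S x ∈ Matrix.specialOrthogonalGroup (Fin 3) ℝ)
    (hG : ∀ x ∈ V, GluesAt H H' x (S x))
    (hθ : ∀ x ∈ V, ∀ a, θ' a x = ∑ b, S x b a • θ b x) :
    IsRotation V H θ H' θ' (fun a b x ↦ S x a b) := by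
  have hrow : ∀ x ∈ V, ∀ b c, ∑ a, S x b a * S x c a = if b = c then 1 else 0 := by
    intro x hx b c
    have := congrFun (congrFun ((Matrix.mem_orthogonalGroup_iff _ _).1
      (Matrix.mem_specialOrthogonalGroup_iff.1 (hS x hx)).1) b) c
    simpa [Matrix.mul_apply, Matrix.one_apply] using this
  have hcol : ∀ x ∈ V, ∀ b c, ∑ a, S x a b * S x a c = if b = c then 1 else 0 := by
    intro x hx b c
    have := congrFun (congrFun ((Matrix.mem_orthogonalGroup_iff' _ _).1
      (Matrix.mem_specialOrthogonalGroup_iff.1 (hS x hx)).1) b) c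
    simpa [Matrix.mul_apply, Matrix.one_apply] using this
  have hcore : ∀ x ∈ V, H'.core x = H.core x := fun x hx ↦
    GluesAt.core_eq h h' hx (hS x hx) (hθ x hx)
  have hθ' : ∀ x ∈ V, ∀ a v, θ' a x v = ∑ b, S x b a * θ b x v := fun x hx a v ↦ by
    simp [hθ x hx]
  have hJ : ∀ x ∈ V, ∀ v ∈ H.core x, ∀ a, H'.J a x v = ∑ b, S x b a • H.J b x v := by
    intro x hx v hv a
    obtain ⟨W, T, -, hxW, -, hT⟩ := h.exists_normalized hx
    rw [(hG x hx).J_eq h h' hx (hθ x hx) (t := fun a ↦ T a x) ⟨hT.dual x hxW, hT.act x hxW⟩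
      (h'.theta_core hx (by rwa [hcore x hx]) a)]
    simp [h.theta_core hx hv]
  -- The matrix is chosen pointwise without regularity, but its entries are `θ'_a(T_b)`.
  have hsmooth : ∀ a b, FSmoothOn n (fun x ↦ S x a b) V := by
    intro b a x hx
    obtain ⟨W, T, hW, hxW, hWV, hT⟩ := h.exists_normalized hx
    have h1 := (h'.compatible.smooth a).smooth hW hWV (hT.smooth b)
    have h2 : FSmoothOn n (fun x ↦ S x b a) W := h1.congr fun y hy ↦ by
      simp [hθ' y (hWV hy), hT.dual y hy]
    exact (h2.contMDiffAt (hW.mem_nhds hxW)).contMDiffWithinAt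
  refine ⟨hsmooth, hrow, hcol, hcore, hJ, fun x hx v hv w hw ↦
    levi_eq_of_core h h' hx hcore (hθ x hx) (fun a v hv ↦ hJ x hx v hv a) hv hw, hθ', ?_⟩
  intro W hWV T hT
  have hdual : ∀ x ∈ W, ∀ a b, θ' a x (∑ c, S x c b • T c x) = if a = b then 1 else 0 := by
    intro x hx a b
    simp only [map_sum, map_smul, hθ' x (hWV hx), hT.dual x hx, mul_ite, mul_one, mul_zero,
      Finset.sum_ite_eq, Finset.mem_univ, if_true, smul_eq_mul]
    exact hcol x (hWV hx) a b
  refine ⟨fun a ↦ SmoothOn.sum fun b _ ↦ SmoothOn.smul ((hsmooth b a).mono hWV) (hT.smooth b),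
    hdual, fun x hx a ↦ ?_⟩
  have hTx : IsNormalizedAt H θ x fun a ↦ T a x := ⟨hT.dual x hx, hT.act x hx⟩
  have ha : a ≠ a + 1 := by fin_cases a <;> decide
  rw [(hG x (hWV hx)).J_eq h h' (hWV hx) (hθ x (hWV hx)) hTx
    ((hdual x hx a (a + 1)).trans (if_neg ha))]
  -- `I_b` rotates the plane of the other two members of the triple, so the result below is a cross
  -- product of columns of `S`.
  have hstep : ∀ b, H.J b x ((∑ c, S x c (a + 1) • T c x)
      - θ b x (∑ c, S x c (a + 1) • T c x) • T b x)
      = S x (b + 1) (a + 1) • T (b + 2) x - S x (b + 2) (a + 1) • T (b + 1) x := by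
    intro b
    have e : (∑ c, S x c (a + 1) • T c x) = S x b (a + 1) • T b x
        + S x (b + 1) (a + 1) • T (b + 1) x + S x (b + 2) (a + 1) • T (b + 2) x := by
      fin_cases b <;> simp [Fin.sum_univ_three] <;> abel
    have e2 : θ b x (∑ c, S x c (a + 1) • T c x) = S x b (a + 1) := by
      simp [hT.dual x hx]
    have e3 := h.J_normalizedAt (hWV hx) hTx b
    rw [e2, e, add_assoc, add_sub_cancel_left, map_add, map_smul, map_smul, hT.act x hx, e3,
      smul_neg, sub_eq_add_neg]
  simp only [hstep]
  have hcr := fun e ↦ cross_of_specialOrthogonal (hS x (hWV hx)) a e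
  have c0 : S x 1 a * S x 2 (a + 1) - S x 2 a * S x 1 (a + 1) = S x 0 (a + 2) := hcr 0
  have c1 : S x 2 a * S x 0 (a + 1) - S x 0 a * S x 2 (a + 1) = S x 1 (a + 2) := hcr 1
  have c2 : S x 0 a * S x 1 (a + 1) - S x 1 a * S x 0 (a + 1) = S x 2 (a + 2) := hcr 2
  rw [Fin.sum_univ_three, Fin.sum_univ_three, ← c0, ← c1, ← c2]
  change S x 0 a • (S x 1 (a + 1) • T 2 x - S x 2 (a + 1) • T 1 x)
    + S x 1 a • (S x 2 (a + 1) • T 0 x - S x 0 (a + 1) • T 2 x)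
    + S x 2 a • (S x 0 (a + 1) • T 1 x - S x 1 (a + 1) • T 0 x) = _
  module

end Glue

/-! ### Locality of the conditions and patching. -/

section Patch

variable {n : ℕ} {M : Type*} [TopologicalSpace M] [ChartedSpace (Model n) M]
  [IsManifold 𝓘(ℝ, Model n) ∞ M]

variable {U W : Set M} {H : Triple n M} {θ : Fin 3 → Π x : M, Tan n x →L[ℝ] ℝ}
  {P P' : Π x : M, Submodule ℝ (Tan n x)} {D D' : ConnectionMap n M} {x : M}

theorem torsion_congr (hD : ∀ Y : VF n M, DiffAt Y x → D' Y x = D Y x) {X Y : VF n M}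
    (hX : DiffAt X x) (hY : DiffAt Y x) : torsion D' X Y x = torsion D X Y x := by
  rw [torsion, torsion, hD X hX, hD Y hY]

/-- Values of a connection on fields not differentiable at the point are meaningless, so agreement
on differentiable fields suffices. -/
theorem IsAssociatedConnection.congr (hW : IsOpen W) (h : IsAssociatedConnection W H θ P D)
    (hP : ∀ x ∈ W, P' x = P x) (hD : ∀ x ∈ W, ∀ Y : VF n M, DiffAt Y x → D' Y x = D Y x) :
    IsAssociatedConnection W H θ P' D' := by
  have hsec : ∀ {V : Set M} {A : VF n M}, V ⊆ W → IsSection P' A V → IsSection P A V :=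
    fun hV hA ↦ ⟨hA.1, fun x hx ↦ by rw [← hP x (hV hx)]; exact hA.2 x hx⟩
  have htor : ∀ {V : Set M} {X Y : VF n M}, IsOpen V → V ⊆ W → SmoothOn X V → SmoothOn Y V →
      ∀ x ∈ V, torsion D' X Y x = torsion D X Y x := fun hV hVW hX hY x hx ↦
    torsion_congr (hD x (hVW hx)) (hX.diffAt hV hx) (hY.diffAt hV hx)
  refine ⟨⟨fun {σ σ' x} hσ hσ' hx ↦ ?_, fun {σ g x} hσ hg hx ↦ ?_⟩, ⟨fun {σ} hσ ↦ ?_⟩, ?_, ?_, ?_,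
    ?_, ?_, ?_, ?_, ?_⟩
  · rw [hD x hx _ hσ, hD x hx _ hσ', hD x hx _ (DiffAt.add hσ hσ')]
    exact h.isConnection.add hσ hσ' hx
  · rw [hD x hx _ hσ, hD x hx _ (DiffAt.smul hg hσ)]
    exact h.isConnection.leibniz hσ hg hx
  · refine (h.smooth.contMDiff hσ).congr fun x hx ↦ ?_
    rw [hD x hx σ ((hσ.contMDiffAt (hW.mem_nhds hx)).mdifferentiableAt (by simp))]
  · intro V hV hVW Y hY x hx w
    rw [hD x (hVW hx) Y (hY.1.diffAt hV hx)]
    exact h.preserves_core V hV hVW Y hY x hx w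
  · intro V hV hVW Y hY x hx w
    rw [hD x (hVW hx) Y (hY.1.diffAt hV hx), hP x (hVW hx)]
    exact h.preserves_perp V hV hVW Y (hsec hVW hY) x hx w
  · intro V hV hVW Y Z hY hZ x hx w
    have hlev : ∀ y ∈ W, leviExt H θ P' y = leviExt H θ P y := fun y hy ↦ by
      funext v w
      rw [leviExt, leviExt, hP y hy]
    rw [hD x (hVW hx) Y (hY.diffAt hV hx), hD x (hVW hx) Z (hZ.diffAt hV hx), hlev x (hVW hx),
      ← h.parallel_levi V hV hVW Y Z hY hZ x hx w, mvfderiv_congr]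
    filter_upwards [hV.mem_nhds hx] with y hy
    rw [hlev y (hVW hy)]
  · intro V hV hVW Y Z hY hZ x hx w
    rw [hD x (hVW hx) Y (hY.diffAt hV hx), hD x (hVW hx) Z (hZ.diffAt hV hx)]
    exact h.parallel_perp V hV hVW Y Z hY hZ x hx w
  · intro V hV hVW X Y hX hY x hx
    rw [htor hV hVW hX.1 hY.1 x hx, hP x (hVW hx)]
    exact h.torsion_core V hV hVW X Y hX hY x hx
  · intro V hV hVW A B hA hB x hx
    rw [htor hV hVW hA.1 hB.1 x hx, hP x (hVW hx)]
    exact h.torsion_perp V hV hVW A B (hsec hVW hA) (hsec hVW hB) x hx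
  · intro V hV hVW A X Y hA hX hY x hx
    rw [htor hV hVW hA.1 hX.1 x hx, htor hV hVW hA.1 hY.1 x hx, hP x (hVW hx)]
    exact h.torsion_symm_core V hV hVW A X Y (hsec hVW hA) hX hY x hx
  · intro V hV hVW X A B hX hA hB x hx
    rw [htor hV hVW hA.1 hX.1 x hx, htor hV hVW hB.1 hX.1 x hx, hP x (hVW hx)]
    exact h.torsion_symm_perp V hV hVW X A B hX (hsec hVW hA) (hsec hVW hB) x hx

theorem IsCanonical.congr (hW : IsOpen W) (h : IsCanonical W H θ P D)
    (hP : ∀ x ∈ W, P' x = P x) (hD : ∀ x ∈ W, ∀ Y : VF n M, DiffAt Y x → D' Y x = D Y x) :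
    IsCanonical W H θ P' D' := by
  refine ⟨?_, h.associated.congr hW hP hD, fun V hV hVW ε hε x hx ↦ ?_⟩
  · obtain ⟨T, hT, hTP⟩ := h.admissible
    exact ⟨T, hT, fun x hx ↦ (hP x hx).trans (hTP x hx)⟩
  · have : ∀ p, connectionMatrix H θ D' ε x (ε p x) = connectionMatrix H θ D ε x (ε p x) := by
      intro p
      ext r q
      rw [connectionMatrix, connectionMatrix, Matrix.of_apply, Matrix.of_apply,
        hD x (hVW hx) _ ((hε.isSection q).1.diffAt hV hx)]
    simp only [this]
    exact h.eh V hV hVW ε hε x hx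

/-- Covariant derivatives on an open set are recognized locally. -/
theorem isCovariantDerivativeOn_of_local
    (h : ∀ x ∈ U, ∃ W, IsOpen W ∧ x ∈ W ∧ W ⊆ U ∧ IsCovariantDerivativeOn (Model n) D W) :
    IsCovariantDerivativeOn (Model n) D U where
  add {σ σ' x} hσ hσ' hx := by
    obtain ⟨W, -, hxW, -, h⟩ := h x hx
    exact h.add hσ hσ' hxW
  leibniz {σ g x} hσ hg hx := by
    obtain ⟨W, -, hxW, -, h⟩ := h x hx
    exact h.leibniz hσ hg hxW

theorem contMDiffCovariantDerivativeOn_of_local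
    (h : ∀ x ∈ U, ∃ W, IsOpen W ∧ x ∈ W ∧ W ⊆ U ∧
      ContMDiffCovariantDerivativeOn (Model n) ∞ D W) :
    ContMDiffCovariantDerivativeOn (Model n) ∞ D U where
  contMDiff {σ} hσ x hx := by
    obtain ⟨W, hW, hxW, hWU, h⟩ := h x hx
    exact ((h.contMDiff (hσ.mono hWU)).contMDiffAt (hW.mem_nhds hxW)).contMDiffWithinAt

theorem IsAssociatedConnection.of_local
    (h : ∀ x ∈ U, ∃ W, IsOpen W ∧ x ∈ W ∧ W ⊆ U ∧ IsAssociatedConnection W H θ P D) :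
    IsAssociatedConnection U H θ P D where
  isConnection := isCovariantDerivativeOn_of_local fun x hx ↦ by
    obtain ⟨W, hW, hxW, hWU, h⟩ := h x hx
    exact ⟨W, hW, hxW, hWU, h.isConnection⟩
  smooth := contMDiffCovariantDerivativeOn_of_local fun x hx ↦ by
    obtain ⟨W, hW, hxW, hWU, h⟩ := h x hx
    exact ⟨W, hW, hxW, hWU, h.smooth⟩
  preserves_core V hV hVU Y hY x hx w := by
    obtain ⟨W, hW, hxW, -, h⟩ := h x (hVU hx)
    exact h.preserves_core (V ∩ W) (hV.inter hW) Set.inter_subset_right Y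
      (hY.mono Set.inter_subset_left) x ⟨hx, hxW⟩ w
  preserves_perp V hV hVU Y hY x hx w := by
    obtain ⟨W, hW, hxW, -, h⟩ := h x (hVU hx)
    exact h.preserves_perp (V ∩ W) (hV.inter hW) Set.inter_subset_right Y
      (hY.mono Set.inter_subset_left) x ⟨hx, hxW⟩ w
  parallel_levi V hV hVU Y Z hY hZ x hx w := by
    obtain ⟨W, hW, hxW, -, h⟩ := h x (hVU hx)
    exact h.parallel_levi (V ∩ W) (hV.inter hW) Set.inter_subset_right Y Z
      (hY.mono Set.inter_subset_left) (hZ.mono Set.inter_subset_left) x ⟨hx, hxW⟩ w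
  parallel_perp V hV hVU Y Z hY hZ x hx w := by
    obtain ⟨W, hW, hxW, -, h⟩ := h x (hVU hx)
    exact h.parallel_perp (V ∩ W) (hV.inter hW) Set.inter_subset_right Y Z
      (hY.mono Set.inter_subset_left) (hZ.mono Set.inter_subset_left) x ⟨hx, hxW⟩ w
  torsion_core V hV hVU X Y hX hY x hx := by
    obtain ⟨W, hW, hxW, -, h⟩ := h x (hVU hx)
    exact h.torsion_core (V ∩ W) (hV.inter hW) Set.inter_subset_right X Y
      (hX.mono Set.inter_subset_left) (hY.mono Set.inter_subset_left) x ⟨hx, hxW⟩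
  torsion_perp V hV hVU A B hA hB x hx := by
    obtain ⟨W, hW, hxW, -, h⟩ := h x (hVU hx)
    exact h.torsion_perp (V ∩ W) (hV.inter hW) Set.inter_subset_right A B
      (hA.mono Set.inter_subset_left) (hB.mono Set.inter_subset_left) x ⟨hx, hxW⟩
  torsion_symm_core V hV hVU A X Y hA hX hY x hx := by
    obtain ⟨W, hW, hxW, -, h⟩ := h x (hVU hx)
    exact h.torsion_symm_core (V ∩ W) (hV.inter hW) Set.inter_subset_right A X Y
      (hA.mono Set.inter_subset_left) (hX.mono Set.inter_subset_left)
      (hY.mono Set.inter_subset_left) x ⟨hx, hxW⟩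
  torsion_symm_perp V hV hVU X A B hX hA hB x hx := by
    obtain ⟨W, hW, hxW, -, h⟩ := h x (hVU hx)
    exact h.torsion_symm_perp (V ∩ W) (hV.inter hW) Set.inter_subset_right X A B
      (hX.mono Set.inter_subset_left) (hA.mono Set.inter_subset_left)
      (hB.mono Set.inter_subset_left) x ⟨hx, hxW⟩

/-- A triple dual to `θ_x` is determined by its span. -/
theorem eq_of_dual_of_mem_span {t t' : Fin 3 → Tan n x}
    (ht : ∀ a b, θ a x (t b) = if a = b then 1 else 0)
    (ht' : ∀ a b, θ a x (t' b) = if a = b then 1 else 0)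
    (hs : ∀ a, t a ∈ Submodule.span ℝ (Set.range t')) : t = t' := by
  funext a
  obtain ⟨c, hc⟩ := (Submodule.mem_span_range_iff_exists_fun ℝ).1 (hs a)
  have h1 : ∀ b, c b = if b = a then 1 else 0 := fun b ↦ by
    have := congrArg (θ b x) hc
    simpa [ht, ht'] using this
  rw [← hc]
  simp [h1]

/-- An admissible triple must be found on all of `U`. Normalized triples are determined by their
span, so the local ones agree and glue. -/
theorem IsAdmissiblePlaneField.of_local (h : IsPseudohermitian U H θ)
    (hP : ∀ x ∈ U, ∃ W, IsOpen W ∧ x ∈ W ∧ W ⊆ U ∧ IsAdmissiblePlaneField W H P) :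
    IsAdmissiblePlaneField U H P := by
  classical
  have h1 : ∀ x ∈ U, ∃ (W : Set M) (T : Fin 3 → VF n M), IsOpen W ∧ x ∈ W ∧ W ⊆ U ∧
      IsNormalizedTriple W H θ T ∧
        ∀ x ∈ W, P x = Submodule.span ℝ (Set.range fun a ↦ T a x) := by
    intro x hx
    obtain ⟨W, hW, hxW, hWU, hPW⟩ := hP x hx
    obtain ⟨T, hT, hPT⟩ := h.exists_normalized_of_admissible hW hWU hPW
    exact ⟨W, T, hW, hxW, hWU, hT, hPT⟩
  choose! W T hW hxW hWU hT hPT using h1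
  have hagree : ∀ x ∈ U, ∀ y ∈ W x, ∀ a, T y a y = T x a y := by
    intro x hx y hy a
    have hyU := hWU x hx hy
    refine congrFun (eq_of_dual_of_mem_span (t := fun a ↦ T y a y) (t' := fun a ↦ T x a y)
      ((hT y hyU).dual y (hxW y hyU)) ((hT x hx).dual y hy) fun a ↦ ?_) a
    rw [← hPT x hx y hy, hPT y hyU y (hxW y hyU)]
    exact Submodule.subset_span ⟨a, rfl⟩
  have hN : IsNormalizedTriple U H θ fun a y ↦ T y a y :=
    ⟨fun a ↦ SmoothOn.of_local fun x hx ↦ ⟨W x, hW x hx, hxW x hx,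
      ((hT x hx).smooth a).congr fun y hy ↦ hagree x hx y hy a⟩,
      fun x hx ↦ (hT x hx).dual x (hxW x hx), fun x hx ↦ (hT x hx).act x (hxW x hx)⟩
  exact ⟨_, hN.admissible h subset_rfl, fun x hx ↦ hPT x hx x (hxW x hx)⟩

theorem IsCanonical.of_local (h : IsPseudohermitian U H θ)
    (hP : ∀ x ∈ U, ∃ W, IsOpen W ∧ x ∈ W ∧ W ⊆ U ∧ IsCanonical W H θ P D) :
    IsCanonical U H θ P D where
  admissible := IsAdmissiblePlaneField.of_local h fun x hx ↦ by
    obtain ⟨W, hW, hxW, hWU, hc⟩ := hP x hx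
    exact ⟨W, hW, hxW, hWU, hc.admissible⟩
  associated := IsAssociatedConnection.of_local fun x hx ↦ by
    obtain ⟨W, hW, hxW, hWU, hc⟩ := hP x hx
    exact ⟨W, hW, hxW, hWU, hc.associated⟩
  eh V hV hVU ε hε x hx := by
    obtain ⟨W, hW, hxW, -, hc⟩ := hP x (hVU hx)
    exact hc.eh (V ∩ W) (hV.inter hW) Set.inter_subset_right ε (hε.mono Set.inter_subset_left) x
      ⟨hx, hxW⟩

theorem IsPseudohermitian.canonical_unique (h : IsPseudohermitian U H θ)
    (hdef : IsDefinite U H θ) (hn : 2 ≤ n) (hc : IsCanonical U H θ P D)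
    (hc' : IsCanonical U H θ P' D') : AgreeOn U P P' D D' := by
  intro x hx
  obtain ⟨V, ε, T, F, hxV, hVU, hF⟩ := h.exists_balanced hdef hn hx
  obtain ⟨h1, h2⟩ := h.agree_of_balanced hdef hn F hVU hF hc
  obtain ⟨h1', h2'⟩ := h.agree_of_balanced hdef hn F hVU hF hc'
  exact ⟨(h1 x hxV).trans (h1' x hxV).symm,
    fun Y hY ↦ (h2 x hxV Y hY).trans (h2' x hxV Y hY).symm⟩

/-- The local canonical connections of structures related by rotations patch together. -/
theorem exists_isCanonical (hn : 2 ≤ n) {ι : Type*} {U : ι → Set M} {H : ι → Triple n M}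
    {θ : ι → Fin 3 → Π x : M, Tan n x →L[ℝ] ℝ} (hU : ∀ x, ∃ i, x ∈ U i)
    (h : ∀ i, IsPseudohermitian (U i) (H i) (θ i)) (hdef : ∀ i, IsDefinite (U i) (H i) (θ i))
    (hR : ∀ i j, ∃ S, IsRotation (U i ∩ U j) (H i) (θ i) (H j) (θ j) S) :
    ∃ (P : Π x : M, Submodule ℝ (Tan n x)) (D : ConnectionMap n M),
      ∀ i, IsCanonical (U i) (H i) (θ i) P D := by
  choose i hi using hU
  choose V ε T F hxV hVU hF using fun x ↦ (h (i x)).exists_balanced (hdef (i x)) hn (hi x)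
  have hV := fun x ↦ (F x).ph.isOpen
  let P : M → Π x : M, Submodule ℝ (Tan n x) :=
    fun x y ↦ Submodule.span ℝ (Set.range fun a ↦ T x a y)
  -- The local solution near `x` serves every structure that meets its domain, not only the one it
  -- was built from.
  have hcan : ∀ x j, IsCanonical (V x ∩ U j) (H j) (θ j) (P x) (F x).connection := by
    intro x j
    obtain ⟨S, R⟩ := hR (i x) j
    exact (R.mono (Set.inter_subset_inter_left _ (hVU x))).isCanonical (by omega) (F x) (hF x)
      (fun _ _ ↦ rfl) Set.inter_subset_left
      ((h j).mono ((hV x).inter (h j).isOpen) Set.inter_subset_right)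
  -- Near `y` the solution built at `x` is canonical for the structure used at `y`, so local
  -- uniqueness identifies the two.
  have hagree : ∀ x, ∀ y ∈ V x, P y y = P x y ∧
      ∀ Y : VF n M, DiffAt Y y → (F y).connection Y y = (F x).connection Y y := by
    intro x y hy
    have hW : V y ∩ V x ⊆ V x ∩ U (i y) := fun z hz ↦ ⟨hz.2, hVU y hz.1⟩
    have F' := (F y).mono ((hV y).inter (hV x)) Set.inter_subset_left
    obtain ⟨h1, h2⟩ := ((h (i y)).mono ((hV x).inter (h (i y)).isOpen)
      Set.inter_subset_right).agree_of_balanced (fun z hz ↦ hdef (i y) z hz.2) hn F' hW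
      (fun z hz ↦ by rw [(F y).obstruction_mono F' hz.1 hz]; exact hF y z hz.1) (hcan x (i y))
    refine ⟨(h1 y ⟨hxV y, hy⟩).symm, fun Y hY ↦ ?_⟩
    rw [h2 y ⟨hxV y, hy⟩ Y hY]
    exact F'.eq_connection (P := P y) Set.inter_subset_left (fun _ _ ↦ rfl)
      ((F y).isAssociatedConnection_connection (hV y) subset_rfl fun _ _ ↦ rfl) ⟨hxV y, hy⟩ hY
  -- At each point the global objects take the values of the solution built at that very point.
  refine ⟨fun y ↦ P y y, fun Y y ↦ (F y).connection Y y, fun j ↦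
    IsCanonical.of_local (h j) fun x hx ↦ ⟨V x ∩ U j, (hV x).inter (h j).isOpen, ⟨hxV x, hx⟩,
      Set.inter_subset_right, (hcan x j).congr ((hV x).inter (h j).isOpen)
        (fun y hy ↦ (hagree x y hy.1).1) fun y hy ↦ (hagree x y hy.1).2⟩⟩

variable {ι : Type*} (Θ : QuaternionicPseudohermitian n M ι)

theorem QuaternionicPseudohermitian.isPseudohermitian (i : ι) :
    IsPseudohermitian (Θ.U i) (Θ.str i) (Θ.θ i) :=
  ⟨Θ.isOpen i, Θ.hyper i, Θ.compatible i, Θ.levi_pos i⟩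

theorem QuaternionicPseudohermitian.IsUltraPseudoconvex.isDefinite
    {Θ : QuaternionicPseudohermitian n M ι} (hΘ : Θ.IsUltraPseudoconvex) (i : ι) :
    IsDefinite (Θ.U i) (Θ.str i) (Θ.θ i) :=
  fun x hx ↦ hΘ.imp (fun h ↦ h i x hx) fun h ↦ h i x hx

theorem QuaternionicPseudohermitian.exists_isRotation (i j : ι) :
    ∃ S, IsRotation (Θ.U i ∩ Θ.U j) (Θ.str i) (Θ.θ i) (Θ.str j) (Θ.θ j) S := by
  choose! S hS hG using Θ.glue i j
  have hU := (Θ.isOpen i).inter (Θ.isOpen j)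
  exact ⟨_, isRotation_of_gluesAt ((Θ.isPseudohermitian i).mono hU Set.inter_subset_left)
    ((Θ.isPseudohermitian j).mono hU Set.inter_subset_right) hS hG
    fun x hx ↦ Θ.θ_glue i j x hx (S x) (hS x hx) (hG x hx)⟩

end Patch
end QCR
end

/-! ### The global connection and uniqueness on every chart of the structure. -/

open QCR in
theorem theorem3p3 (n : ℕ) (hn : 7 < 4 * n + 3)
    (M : Type*) [TopologicalSpace M] [T2Space M] [SecondCountableTopology M]
    [ChartedSpace (Model n) M] [IsManifold 𝓘(ℝ, Model n) ∞ M]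
    (ι : Type*) (Θ : QuaternionicPseudohermitian n M ι) (hΘ : Θ.IsUltraPseudoconvex) :
    ∃ (P : Π x : M, Submodule ℝ (Tan n x))
      (D : CovariantDerivative 𝓘(ℝ, Model n) (Model n) (TangentSpace 𝓘(ℝ, Model n) : M → Type _)),
      D.ContMDiffCovariantDerivative ∞ ∧
      ∀ i, IsCanonical (Θ.U i) (Θ.str i) (Θ.θ i) P D ∧
        ∀ P' D', IsCanonical (Θ.U i) (Θ.str i) (Θ.θ i) P' D' → AgreeOn (Θ.U i) P P' D D' := by
  have hn' : 2 ≤ n := by omega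
  obtain ⟨P, D, hc⟩ := exists_isCanonical hn' Θ.cover Θ.isPseudohermitian hΘ.isDefinite
    Θ.exists_isRotation
  have hloc : ∀ x ∈ (Set.univ : Set M), ∃ i, IsOpen (Θ.U i) ∧ x ∈ Θ.U i ∧ Θ.U i ⊆ Set.univ ∧
      IsAssociatedConnection (Θ.U i) (Θ.str i) (Θ.θ i) P D := fun x _ ↦
    (Θ.cover x).imp fun i hi ↦ ⟨Θ.isOpen i, hi, Set.subset_univ _, (hc i).associated⟩
  refine ⟨P, ⟨D, isCovariantDerivativeOn_of_local fun x hx ↦ ?_⟩,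
    ⟨contMDiffCovariantDerivativeOn_of_local fun x hx ↦ ?_⟩, fun i ↦ ⟨hc i, fun P' D' hc' ↦
      (Θ.isPseudohermitian i).canonical_unique (hΘ.isDefinite i) hn' (hc i) hc'⟩⟩
  · obtain ⟨i, h1, h2, h3, h4⟩ := hloc x hx
    exact ⟨_, h1, h2, h3, h4.isConnection⟩
  · obtain ⟨i, h1, h2, h3, h4⟩ := hloc x hx
    exact ⟨_, h1, h2, h3, h4.smooth⟩
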